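/- Let $d\ge 0$ be an integer, and identify $\mathbf R^{2d}\ni (x,\xi )$ with $\mathbf C^d\ni x+i\xi$. **Weights.** A weight on $\mathbf R^{2d}$ is a positive function $\omega \in L^\infty _{loc}(\mathbf R^{2d})$ which on every compact set is bounded from below by a positive constant. Consider the conditions $$C^{-1}\omega (X)^2\le \omega (X+Y)\,\omega (X-Y)\le C\omega (X)^2\quad \text{when}\quad Rc\le |X|\le c/|Y|, \tag{1}$$ $$C^{-1}e^{-c|X|^2}\le \omega (X)\le Ce^{c|X|^2}\quad \text{for all } X\in \mathbf R^{2d}. \tag{2}$$ $\mathscr P_Q(\mathbf C^d)$ is the set of all weights such that (1) holds for some $c,C>0$ and $R\ge 2$, and (2) holds for some $c,C>0$. $\mathscr P_Q^0(\mathbf C^d)$ is the set of all weights such that (1) holds for some $c,C>0$ and $R\ge 2$, and for every $c>0$ there is a $C>0$ such that (2) holds. **Mixed quasi-norm spaces.** A mixed quasi-norm space $\mathscr B$ on $\mathbf C^d\simeq \mathbf R^{2d}$ is given by $n\ge 1$, real linear subspaces $V_1,\dots ,V_n$ with $V_1\oplus \cdots \oplus V_n=\mathbf R^{2d}$, and exponents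 $p_1,\dots ,p_n\in (0,\infty ]$. For measurable $f$, its quasi-norm is $\|f\|_{\mathscr B}=F_n$, where $F_0(x_1,\dots ,x_n)=|f(x_1+\cdots +x_n)|$ and $F_j(x_{j+1},\dots ,x_n)=\|F_{j-1}(\,\cdot \,,x_{j+1},\dots ,x_n)\|_{L^{p_j}(V_j)}$ for $j=1,\dots ,n$, $V_j$ being equipped with its Lebesgue measure. Set $\nu _1(\mathscr B)=\min (p_1,\dots ,p_n)$. **Modulation spaces.** For $h>0$ let $\mathcal S_{1/2,h}(\mathbf R^d)$ be the set of all $f\in C^\infty (\mathbf R^d)$ such that $$\|f\|_{\mathcal S_{1/2,h}}=\sup _{\alpha ,\beta \in \mathbf N^d,\ x\in \mathbf R^d}\frac {|x^\beta \partial ^\alpha f(x)|}{h^{|\alpha |+|\beta |}(\alpha !\,\beta !)^{1/2}}<\infty ,$$ let $\mathcal S_{1/2}=\bigcup _{h>0}\mathcal S_{1/2,h}$, and let $\mathcal S_{1/2}'(\mathbf R^d)$ be the space of all linear forms on $\mathcal S_{1/2}(\mathbf R^d)$ whose restriction to $\mathcal S_{1/2,h}(\mathbf R^d)$ is continuous for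 every $h>0$. With $\phi (x)=\pi ^{-d/4}e^{-|x|^2/2}$, the short-time Fourier transform of $f\in \mathcal S_{1/2}'(\mathbf R^d)$ is $$V_\phi f(x,\xi )=(2\pi )^{-d/2}\big \langle f,\overline {\phi (\,\cdot \,-x)}\,e^{-i\langle \,\cdot \,,\xi \rangle }\big \rangle .$$ For $\omega \in \mathscr P_Q^0(\mathbf C^d)$, $M(\omega ,\mathscr B)$ is the set of all $f\in \mathcal S_{1/2}'(\mathbf R^d)$ such that $\|f\|_{M(\omega ,\mathscr B)}=\|V_\phi f\cdot \omega \|_{\mathscr B}<\infty$. **Spaces of entire functions.** For a function $F$ on $\mathbf C^d$ let $$(U^{-1}F)(x,\xi )=(2\pi )^{-d/2}e^{-(|x|^2+|\xi |^2)/4}e^{-i\langle x,\xi \rangle /2}F(2^{-1/2}x-i2^{-1/2}\xi ).$$ For $\omega \in \mathscr P_Q(\mathbf C^d)$, $A(\omega ,\mathscr B)$ is the set of all entire functions $F$ on $\mathbf C^d$ such that $\|F\|_{A(\omega ,\mathscr B)}=\|(U^{-1}F)\,\omega \|_{\mathscr B}<\infty$. **Theorem.** Let $\omega _1\in \mathscr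 P_Q^0(\mathbf C^d)$, $\omega _2\in \mathscr P_Q(\mathbf C^d)$, and let $\mathscr B$ be a mixed quasi-norm space on $\mathbf C^d$. Then the following is true: 1. $M(\omega _1,\mathscr B)$ and $A(\omega _2,\mathscr B)$, with the quasi-norms above, are quasi-Banach spaces; that is, they are complex vector spaces on which these are quasi-norms (finite, definite, absolutely homogeneous, and satisfying $\|f+g\|\le K(\|f\|+\|g\|)$ for some constant $K\ge 1$), and every Cauchy sequence converges. 2. If in addition $\nu _1(\mathscr B)\ge 1$, then $M(\omega _1,\mathscr B)$ and $A(\omega _2,\mathscr B)$, with the same functionals as norms, are Banach spaces. -/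

import Mathlib

open MeasureTheory
open scoped ENNReal NNReal

namespace GSMod

noncomputable section

/-! ### Weights -/

/-- A weight on a Euclidean space: a positive function in `L^∞_loc` which is bounded from below
by a positive constant on every compact set. -/
structure IsWeight {E : Type} [MeasureSpace E] [TopologicalSpace E] (ω : E → ℝ) : Prop where
  pos : ∀ x, 0 < ω x
  aemeasurable : AEMeasurable ω (volume : Measure E)
  locally_ess_bounded : ∀ K : Set E, IsCompact K →
    ∃ C : ℝ, ∀ᵐ x ∂((volume : Measure E).restrict K), ω x ≤ C
  locally_bounded_below : ∀ K : Set E, IsCompact K → ∃ c : ℝ, 0 < c ∧ ∀ x ∈ K, c ≤ ω x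

/-- `C⁻¹ ω(x)² ≤ ω(x+y) ω(x-y) ≤ C ω(x)²` whenever `R c ≤ |x| ≤ c / |y|`, for some positive
`c`, `C` and some `R ≥ 2`; the upper bound on `|x|` is void for `y = 0`. -/
def WeaklyModerate {E : Type} [NormedAddCommGroup E] (ω : E → ℝ) : Prop :=
  ∃ c C R : ℝ, 0 < c ∧ 0 < C ∧ 2 ≤ R ∧ ∀ x y : E, R * c ≤ ‖x‖ → ‖x‖ * ‖y‖ ≤ c →
    C⁻¹ * ω x ^ 2 ≤ ω (x + y) * ω (x - y) ∧ ω (x + y) * ω (x - y) ≤ C * ω x ^ 2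

/-- `C⁻¹ exp(-c|x|²) ≤ ω(x) ≤ C exp(c|x|²)` for all `x`. -/
def GaussBound {E : Type} [NormedAddCommGroup E] (ω : E → ℝ) (c C : ℝ) : Prop :=
  ∀ x : E, C⁻¹ * Real.exp (-c * ‖x‖ ^ 2) ≤ ω x ∧ ω x ≤ C * Real.exp (c * ‖x‖ ^ 2)

/-- The class `𝒫_Q` of weights of weakly Gaussian type. -/
structure WeightPQ {E : Type} [NormedAddCommGroup E] [MeasureSpace E] (ω : E → ℝ) : Prop where
  isWeight : IsWeight ω
  moderate : WeaklyModerate ω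
  gauss : ∃ c C : ℝ, 0 < c ∧ 0 < C ∧ GaussBound ω c C

/-- The class `𝒫_Q^0` of weights of weakly subgaussian type. -/
structure WeightPQ0 {E : Type} [NormedAddCommGroup E] [MeasureSpace E] (ω : E → ℝ) : Prop where
  isWeight : IsWeight ω
  moderate : WeaklyModerate ω
  gauss : ∀ c : ℝ, 0 < c → ∃ C : ℝ, 0 < C ∧ GaussBound ω c C

/-! ### Mixed quasi-norm spaces -/

/-- The iterated quasi-norm: first the `L^{p 0}` quasi-norm in the variable `x 0`, then the
`L^{p 1}` quasi-norm in `x 1`, and so on. -/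
def iteratedLpNorm : (n : ℕ) → (X : Fin n → Type) → [∀ j, MeasurableSpace (X j)] →
    ((j : Fin n) → Measure (X j)) → (Fin n → ℝ≥0∞) → (((j : Fin n) → X j) → ℝ≥0∞) → ℝ≥0∞
  | 0, _, _, _, _, f => f (fun j => j.elim0)
  | n + 1, X, _, μ, p, f =>
      iteratedLpNorm n (fun j => X j.succ) (fun j => μ j.succ) (fun j => p j.succ)
        (fun x' => eLpNorm (fun x₀ : X 0 => f (Fin.cons x₀ x')) (p 0) (μ 0))

/-- Lebesgue measure on a linear subspace of a Euclidean space (normalised by orthonormal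
bases of the subspace). -/
def subspaceMeasure {ι : Type} [Fintype ι] (V : Submodule ℝ (EuclideanSpace ℝ ι)) : Measure V :=
  (stdOrthonormalBasis ℝ V).toBasis.addHaar

/-- The data of a mixed quasi-norm space on `ℝ^ι`: subspaces `V 0, …, V (n-1)`, `n ≥ 1`, whose
direct sum is the whole space, and Lebesgue exponents `p j ∈ (0, ∞]`. -/
structure MixedSpace (ι : Type) [Fintype ι] where
  n : ℕ
  n_pos : 0 < n
  V : Fin n → Submodule ℝ (EuclideanSpace ℝ ι)
  isInternal : DirectSum.IsInternal V
  p : Fin n → ℝ≥0∞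
  p_pos : ∀ j, 0 < p j

/-- The smallest Lebesgue exponent. -/
def MixedSpace.nu1 {ι : Type} [Fintype ι] (B : MixedSpace ι) : ℝ≥0∞ := ⨅ j, B.p j

/-- The mixed quasi-norm of `f`, with value `∞` allowed. -/
def MixedSpace.qnorm {ι : Type} [Fintype ι] (B : MixedSpace ι)
    (f : EuclideanSpace ℝ ι → ℂ) : ℝ≥0∞ :=
  iteratedLpNorm B.n (fun j => B.V j) (fun j => subspaceMeasure (B.V j)) B.p
    (fun x => ‖f (∑ j, (x j : EuclideanSpace ℝ ι))‖ₑ)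

/-! ### Gelfand–Shilov spaces -/

/-- The partial derivative `∂_i f`. -/
def partialD {d : ℕ} (i : Fin d) (f : EuclideanSpace ℝ (Fin d) → ℂ) :
    EuclideanSpace ℝ (Fin d) → ℂ :=
  fun x => fderiv ℝ f x (EuclideanSpace.single i 1)

/-- `∏_{i ∈ l} ∂_i^{α_i} f` for a list `l` of coordinates. -/
def listD {d : ℕ} (α : Fin d → ℕ) (l : List (Fin d)) (f : EuclideanSpace ℝ (Fin d) → ℂ) :
    EuclideanSpace ℝ (Fin d) → ℂ :=
  l.foldr (fun i g => (partialD i)^[α i] g) f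

/-- The multi-index derivative `∂^α f`. -/
def multiD {d : ℕ} (α : Fin d → ℕ) (f : EuclideanSpace ℝ (Fin d) → ℂ) :
    EuclideanSpace ℝ (Fin d) → ℂ :=
  listD α (List.finRange d) f

/-- The denominator `h^{|α|+|β|} (α! β!)^s`. -/
def gsDenom {d : ℕ} (s h : ℝ) (α β : Fin d → ℕ) : ℝ :=
  h ^ ((∑ i, α i) + ∑ i, β i) *
    (((∏ i, (α i).factorial) * ∏ i, (β i).factorial : ℕ) : ℝ) ^ s

/-- `‖f‖_{𝒮_{s,h}} = sup |x^β ∂^α f(x)| / (h^{|α|+|β|} (α! β!)^s)`. -/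
def gsNorm {d : ℕ} (s h : ℝ) (f : EuclideanSpace ℝ (Fin d) → ℂ) : ℝ≥0∞ :=
  ⨆ (α : Fin d → ℕ) (β : Fin d → ℕ) (x : EuclideanSpace ℝ (Fin d)),
    ENNReal.ofReal (|∏ i, x i ^ β i| * ‖multiD α f x‖ / gsDenom s h α β)

section helpers

variable {d : ℕ}

theorem gsDenom_pos {s h : ℝ} (hh : 0 < h) (α β : Fin d → ℕ) : 0 < gsDenom s h α β := by
  unfold gsDenom
  have : (0 : ℝ) < (((∏ i, (α i).factorial) * ∏ i, (β i).factorial : ℕ) : ℝ) := by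
    have : 0 < (∏ i, (α i).factorial) * ∏ i, (β i).factorial :=
      Nat.mul_pos (Finset.prod_pos fun i _ => Nat.factorial_pos _)
        (Finset.prod_pos fun i _ => Nat.factorial_pos _)
    exact_mod_cast this
  positivity

theorem gsNorm_lt_top_iff {s h : ℝ} (hh : 0 < h) (f : EuclideanSpace ℝ (Fin d) → ℂ) :
    gsNorm s h f < ∞ ↔ ∃ C : ℝ, ∀ (α β : Fin d → ℕ) (x : EuclideanSpace ℝ (Fin d)),
      |∏ i, x i ^ β i| * ‖multiD α f x‖ ≤ C * gsDenom s h α β := by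
  constructor
  · intro H
    refine ⟨(gsNorm s h f).toReal, fun α β x => ?_⟩
    rw [← div_le_iff₀ (gsDenom_pos hh α β)]
    refine (ENNReal.ofReal_le_iff_le_toReal H.ne).1 ?_
    exact le_iSup_of_le α (le_iSup_of_le β (le_iSup_of_le x le_rfl))
  · rintro ⟨C, hC⟩
    refine lt_of_le_of_lt (b := ENNReal.ofReal C) ?_ ENNReal.ofReal_lt_top
    refine iSup_le fun α => iSup_le fun β => iSup_le fun x => ENNReal.ofReal_le_ofReal ?_
    rw [div_le_iff₀ (gsDenom_pos hh α β)]
    exact hC α β x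

theorem partialD_contDiff {f : EuclideanSpace ℝ (Fin d) → ℂ} (hf : ContDiff ℝ (⊤ : ℕ∞) f) (i : Fin d) :
    ContDiff ℝ (⊤ : ℕ∞) (partialD i f) :=
  (hf.fderiv_right (m := (⊤ : ℕ∞)) (by simp)).clm_apply contDiff_const

theorem partialD_iterate_contDiff {f : EuclideanSpace ℝ (Fin d) → ℂ} (hf : ContDiff ℝ (⊤ : ℕ∞) f)
    (i : Fin d) (k : ℕ) : ContDiff ℝ (⊤ : ℕ∞) ((partialD i)^[k] f) := by
  induction k with
  | zero => simpa using hf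
  | succ k ih => rw [Function.iterate_succ_apply']; exact partialD_contDiff ih i

theorem listD_contDiff (α : Fin d → ℕ) (l : List (Fin d)) {f : EuclideanSpace ℝ (Fin d) → ℂ}
    (hf : ContDiff ℝ (⊤ : ℕ∞) f) : ContDiff ℝ (⊤ : ℕ∞) (listD α l f) := by
  induction l with
  | nil => simpa [listD] using hf
  | cons i l ih => exact partialD_iterate_contDiff ih i (α i)

theorem partialD_comb {f g : EuclideanSpace ℝ (Fin d) → ℂ} (hf : ContDiff ℝ (⊤ : ℕ∞) f)
    (hg : ContDiff ℝ (⊤ : ℕ∞) g) (a : ℂ) (i : Fin d) :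
    partialD i (f + a • g) = partialD i f + a • partialD i g := by
  funext x
  have h1 : DifferentiableAt ℝ f x := hf.differentiable (by simp) x
  have h2 : DifferentiableAt ℝ g x := hg.differentiable (by simp) x
  simp [partialD, fderiv_add h1 (h2.const_smul a), fderiv_const_smul h2]

theorem partialD_iterate_comb {f g : EuclideanSpace ℝ (Fin d) → ℂ} (hf : ContDiff ℝ (⊤ : ℕ∞) f)
    (hg : ContDiff ℝ (⊤ : ℕ∞) g) (a : ℂ) (i : Fin d) (k : ℕ) :
    (partialD i)^[k] (f + a • g) = (partialD i)^[k] f + a • (partialD i)^[k] g := by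
  induction k with
  | zero => rfl
  | succ k ih =>
    rw [Function.iterate_succ_apply', Function.iterate_succ_apply', Function.iterate_succ_apply',
      ih, partialD_comb (partialD_iterate_contDiff hf i k) (partialD_iterate_contDiff hg i k)]

theorem listD_comb (α : Fin d → ℕ) (l : List (Fin d)) {f g : EuclideanSpace ℝ (Fin d) → ℂ}
    (hf : ContDiff ℝ (⊤ : ℕ∞) f) (hg : ContDiff ℝ (⊤ : ℕ∞) g) (a : ℂ) :
    listD α l (f + a • g) = listD α l f + a • listD α l g := by
  induction l with
  | nil => rfl
  | cons i l ih =>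
    change (partialD i)^[α i] (listD α l (f + a • g)) = (partialD i)^[α i] (listD α l f) +
      a • (partialD i)^[α i] (listD α l g)
    rw [ih, partialD_iterate_comb (listD_contDiff α l hf) (listD_contDiff α l hg)]

theorem gsDenom_mono {s h h' : ℝ} (hh : 0 < h) (hle : h ≤ h') (α β : Fin d → ℕ) :
    gsDenom s h α β ≤ gsDenom s h' α β := by
  unfold gsDenom
  gcongr

theorem gs_comb_mem {s : ℝ} {f g : EuclideanSpace ℝ (Fin d) → ℂ} (a : ℂ)
    (hf : ContDiff ℝ (⊤ : ℕ∞) f ∧ ∃ h : ℝ, 0 < h ∧ gsNorm s h f < ∞)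
    (hg : ContDiff ℝ (⊤ : ℕ∞) g ∧ ∃ h : ℝ, 0 < h ∧ gsNorm s h g < ∞) :
    ContDiff ℝ (⊤ : ℕ∞) (f + a • g) ∧ ∃ h : ℝ, 0 < h ∧ gsNorm s h (f + a • g) < ∞ := by
  obtain ⟨cf, h₁, hh₁, Hf⟩ := hf
  obtain ⟨cg, h₂, hh₂, Hg⟩ := hg
  refine ⟨cf.add (cg.const_smul a), max h₁ h₂, lt_max_of_lt_left hh₁, ?_⟩
  rw [gsNorm_lt_top_iff hh₁] at Hf
  rw [gsNorm_lt_top_iff hh₂] at Hg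
  rw [gsNorm_lt_top_iff (lt_max_of_lt_left hh₁)]
  obtain ⟨A, hA⟩ := Hf
  obtain ⟨B, hB⟩ := Hg
  refine ⟨|A| + ‖a‖ * |B|, fun α β x => ?_⟩
  have e : multiD α (f + a • g) x = multiD α f x + a * multiD α g x := by
    unfold multiD
    rw [listD_comb α _ cf cg]
    rfl
  rw [e]
  have h1 : |∏ i, x i ^ β i| * ‖multiD α f x‖ ≤ |A| * gsDenom s (max h₁ h₂) α β :=
    (hA α β x).trans (mul_le_mul (le_abs_self A) (gsDenom_mono hh₁ (le_max_left _ _) α β)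
      (gsDenom_pos hh₁ α β).le (abs_nonneg A))
  have h2 : |∏ i, x i ^ β i| * ‖multiD α g x‖ ≤ |B| * gsDenom s (max h₁ h₂) α β :=
    (hB α β x).trans (mul_le_mul (le_abs_self B) (gsDenom_mono hh₂ (le_max_right _ _) α β)
      (gsDenom_pos hh₂ α β).le (abs_nonneg B))
  calc |∏ i, x i ^ β i| * ‖multiD α f x + a * multiD α g x‖
      ≤ |∏ i, x i ^ β i| * (‖multiD α f x‖ + ‖a‖ * ‖multiD α g x‖) := by
        gcongr
        exact (norm_add_le _ _).trans (by rw [norm_mul])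
    _ = |∏ i, x i ^ β i| * ‖multiD α f x‖ + ‖a‖ * (|∏ i, x i ^ β i| * ‖multiD α g x‖) := by ring
    _ ≤ |A| * gsDenom s (max h₁ h₂) α β + ‖a‖ * (|B| * gsDenom s (max h₁ h₂) α β) := by
        gcongr
    _ = (|A| + ‖a‖ * |B|) * gsDenom s (max h₁ h₂) α β := by ring

theorem multiD_zero (α : Fin d → ℕ) :
    multiD α (0 : EuclideanSpace ℝ (Fin d) → ℂ) = 0 := by
  have h := listD_comb α (List.finRange d) (f := (0 : EuclideanSpace ℝ (Fin d) → ℂ)) (g := 0)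
    contDiff_const contDiff_const (-1)
  unfold multiD
  simpa using h

theorem gs_zero_mem {s : ℝ} : ContDiff ℝ (⊤ : ℕ∞) (0 : EuclideanSpace ℝ (Fin d) → ℂ) ∧
    ∃ h : ℝ, 0 < h ∧ gsNorm s h (0 : EuclideanSpace ℝ (Fin d) → ℂ) < ∞ := by
  refine ⟨contDiff_const, 1, one_pos, ?_⟩
  rw [gsNorm_lt_top_iff one_pos]
  exact ⟨0, fun α β x => by simp [multiD_zero]⟩

end helpers

/-- The Gelfand–Shilov space `𝒮_s(ℝ^d) = ⋃_{h>0} 𝒮_{s,h}(ℝ^d)`. -/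
def GelfandShilov (d : ℕ) (s : ℝ) : Submodule ℂ (EuclideanSpace ℝ (Fin d) → ℂ) where
  carrier := {f | ContDiff ℝ (⊤ : ℕ∞) f ∧ ∃ h : ℝ, 0 < h ∧ gsNorm s h f < ∞}
  add_mem' := by
    intro f g hf hg
    simpa using gs_comb_mem 1 hf hg
  zero_mem' := gs_zero_mem
  smul_mem' := by
    intro a f hf
    simpa using gs_comb_mem a gs_zero_mem hf

/-- The Gelfand–Shilov distribution space `𝒮_s'(ℝ^d) = ⋂_{h>0} 𝒮_{s,h}'(ℝ^d)`: linear forms on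
`𝒮_s(ℝ^d)` whose restriction to each Banach space `𝒮_{s,h}(ℝ^d)` is continuous. -/
def GelfandShilovDual (d : ℕ) (s : ℝ) : Submodule ℂ (Module.Dual ℂ (GelfandShilov d s)) where
  carrier := {f | ∀ h : ℝ, 0 < h → ∃ C : ℝ, ∀ φ : GelfandShilov d s,
    gsNorm s h (φ : EuclideanSpace ℝ (Fin d) → ℂ) < ∞ →
      ‖f φ‖ ≤ C * (gsNorm s h (φ : EuclideanSpace ℝ (Fin d) → ℂ)).toReal}
  add_mem' := by
    intro f g hf hg h hh
    obtain ⟨A, hA⟩ := hf h hh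
    obtain ⟨B, hB⟩ := hg h hh
    refine ⟨A + B, fun φ hφ => ?_⟩
    rw [add_mul]
    exact (norm_add_le _ _).trans (add_le_add (hA φ hφ) (hB φ hφ))
  zero_mem' := fun h _ => ⟨0, fun φ _ => by simp⟩
  smul_mem' := by
    intro a f hf h hh
    obtain ⟨A, hA⟩ := hf h hh
    refine ⟨‖a‖ * A, fun φ hφ => ?_⟩
    rw [mul_assoc, LinearMap.smul_apply, norm_smul]
    exact mul_le_mul_of_nonneg_left (hA φ hφ) (norm_nonneg a)

/-! ### The short-time Fourier transform with Gaussian window -/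

/-- The window `φ(x) = π^{-d/4} exp(-|x|²/2)`. -/
def gaussWindow (d : ℕ) (x : EuclideanSpace ℝ (Fin d)) : ℂ :=
  ((Real.pi ^ (-(d : ℝ) / 4) * Real.exp (-‖x‖ ^ 2 / 2) : ℝ) : ℂ)

/-- The function `y ↦ conj (φ(y - x)) exp(-i⟨y,ξ⟩)`. -/
def stftAtom {d : ℕ} (x ξ : EuclideanSpace ℝ (Fin d)) (y : EuclideanSpace ℝ (Fin d)) : ℂ :=
  (starRingEnd ℂ) (gaussWindow d (y - x)) * Complex.exp (-Complex.I * ((inner ℝ y ξ : ℝ) : ℂ))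

section atoms

variable {d : ℕ}

/-- `c ∏_j u_j(y_j)`. -/
def tens (c : ℂ) (u : Fin d → ℝ → ℂ) (y : EuclideanSpace ℝ (Fin d)) : ℂ := c * ∏ j, u j (y j)

theorem tens_contDiff (c : ℂ) {u : Fin d → ℝ → ℂ} (hu : ∀ j, ContDiff ℝ (⊤ : ℕ∞) (u j)) :
    ContDiff ℝ (⊤ : ℕ∞) (tens c u) := by
  unfold tens
  refine contDiff_const.mul (contDiff_prod fun j _ => (hu j).comp ?_)
  exact (EuclideanSpace.proj j : EuclideanSpace ℝ (Fin d) →L[ℝ] ℝ).contDiff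

theorem partialD_tens (c : ℂ) {u : Fin d → ℝ → ℂ} (hu : ∀ j, ContDiff ℝ (⊤ : ℕ∞) (u j)) (i : Fin d) :
    partialD i (tens c u) = tens c (Function.update u i (deriv (u i))) := by
  funext y
  have hdiff : DifferentiableAt ℝ (tens c u) y := (tens_contDiff c hu).differentiable (by simp) y
  have hline : HasDerivAt (fun t : ℝ => y + t • (EuclideanSpace.single i (1 : ℝ)))
      (EuclideanSpace.single i (1 : ℝ)) 0 := by
    simpa using ((hasDerivAt_id (0 : ℝ)).smul_const (EuclideanSpace.single i (1 : ℝ))).const_add y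
  have h1 : HasDerivAt (fun t : ℝ => tens c u (y + t • (EuclideanSpace.single i (1 : ℝ))))
      (partialD i (tens c u) y) 0 := by
    have hd : HasFDerivAt (tens c u) (fderiv ℝ (tens c u) y)
        (y + (0 : ℝ) • (EuclideanSpace.single i (1 : ℝ))) := by
      simpa using hdiff.hasFDerivAt
    exact hd.comp_hasDerivAt 0 hline
  have h2 : HasDerivAt (fun t : ℝ => tens c u (y + t • (EuclideanSpace.single i (1 : ℝ))))
      (tens c (Function.update u i (deriv (u i))) y) 0 := by
    have hu' : HasDerivAt (u i) (deriv (u i) (y i)) (y i + 0) := by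
      simpa using ((hu i).differentiable (by simp) (y i)).hasDerivAt
    have h3 : HasDerivAt (fun t : ℝ => u i (y i + t)) (deriv (u i) (y i)) 0 :=
      HasDerivAt.comp_const_add (y i) 0 hu'
    have h4 := (h3.mul_const (∏ j ∈ Finset.univ.erase i, u j (y j))).const_mul c
    have e1 : (fun t : ℝ => tens c u (y + t • (EuclideanSpace.single i (1 : ℝ)))) =
        fun t : ℝ => c * (u i (y i + t) * ∏ j ∈ Finset.univ.erase i, u j (y j)) := by
      funext t
      unfold tens
      rw [← Finset.mul_prod_erase Finset.univ _ (Finset.mem_univ i)]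
      congr 2
      · simp
      · refine Finset.prod_congr rfl fun j hj => ?_
        have : j ≠ i := Finset.ne_of_mem_erase hj
        simp [this]
    have e2 : tens c (Function.update u i (deriv (u i))) y =
        c * (deriv (u i) (y i) * ∏ j ∈ Finset.univ.erase i, u j (y j)) := by
      unfold tens
      rw [← Finset.mul_prod_erase Finset.univ _ (Finset.mem_univ i)]
      congr 2
      · simp
      · refine Finset.prod_congr rfl fun j hj => ?_
        have : j ≠ i := Finset.ne_of_mem_erase hj
        simp [this]
    rw [e1, e2]
    exact h4
  exact h1.unique h2

theorem deriv_iter_contDiff {f : ℝ → ℂ} (hf : ContDiff ℝ (⊤ : ℕ∞) f) (k : ℕ) :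
    ContDiff ℝ (⊤ : ℕ∞) (deriv^[k] f) := by
  induction k with
  | zero => simpa using hf
  | succ k ih =>
    rw [Function.iterate_succ_apply']
    exact ((contDiff_infty_iff_deriv (𝕜 := ℝ)).1 ih).2

theorem partialD_iter_tens (c : ℂ) {u : Fin d → ℝ → ℂ} (hu : ∀ j, ContDiff ℝ (⊤ : ℕ∞) (u j))
    (i : Fin d) (k : ℕ) :
    (partialD i)^[k] (tens c u) = tens c (Function.update u i (deriv^[k] (u i))) := by
  induction k with
  | zero => simp
  | succ k ih =>
    rw [Function.iterate_succ_apply', ih, partialD_tens]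
    · simp [Function.iterate_succ_apply']
    · intro j
      by_cases hj : j = i
      · subst hj
        simpa using deriv_iter_contDiff (hu j) k
      · simpa [hj] using hu j

theorem listD_tens (c : ℂ) {u : Fin d → ℝ → ℂ} (hu : ∀ j, ContDiff ℝ (⊤ : ℕ∞) (u j)) (α : Fin d → ℕ)
    (l : List (Fin d)) :
    listD α l (tens c u) = tens c (fun j => deriv^[α j * l.count j] (u j)) := by
  induction l with
  | nil => simp [listD]
  | cons i l ih =>
    change (partialD i)^[α i] (listD α l (tens c u)) = _
    rw [ih, partialD_iter_tens c (fun j => deriv_iter_contDiff (hu j) _)]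
    congr 1
    funext j
    by_cases hj : j = i
    · subst hj
      simp only [Function.update_self, List.count_cons_self]
      rw [← Function.iterate_add_apply]
      congr 1
      ring_nf
    · have : i ≠ j := fun h => hj h.symm
      simp [hj, this]

theorem multiD_tens (c : ℂ) {u : Fin d → ℝ → ℂ} (hu : ∀ j, ContDiff ℝ (⊤ : ℕ∞) (u j))
    (α : Fin d → ℕ) :
    multiD α (tens c u) = tens c (fun j => deriv^[α j] (u j)) := by
  unfold multiD
  rw [listD_tens c hu]
  congr 1
  funext j
  rw [List.count_eq_one_of_mem (List.nodup_finRange d) (List.mem_finRange j), mul_one]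

/-- The entire function `w ↦ exp(-(w-a)²/2 - i w ξ)`. -/
def gEntire (a ξ : ℝ) (w : ℂ) : ℂ :=
  Complex.exp (-(w - (a : ℂ)) ^ 2 / 2 - Complex.I * w * (ξ : ℂ))

theorem gEntire_diff (a ξ : ℝ) : Differentiable ℂ (gEntire a ξ) := by
  unfold gEntire
  fun_prop

theorem deriv_iter_ofReal {U : ℂ → ℂ} (hU : Differentiable ℂ U) (k : ℕ) :
    deriv^[k] (fun t : ℝ => U t) = fun t : ℝ => iteratedDeriv k U t := by
  induction k with
  | zero => simp
  | succ k ih =>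
    rw [Function.iterate_succ_apply', ih, iteratedDeriv_succ]
    funext t
    have hd : Differentiable ℂ (iteratedDeriv k U) :=
      (hU.contDiff (n := ⊤)).differentiable_iteratedDeriv k (by simp)
    exact ((hd t).hasDerivAt.comp_ofReal).deriv

theorem gEntire_norm (a ξ t r : ℝ) (w : ℂ) (hw : ‖w - t‖ = r) :
    ‖gEntire a ξ w‖ ≤ Real.exp (-(t - a) ^ 2 / 4 + r ^ 2 / 2 + r * |ξ|) := by
  have hsq : (w.re - t) ^ 2 + w.im ^ 2 = r ^ 2 := by
    rw [← hw, Complex.sq_norm, Complex.normSq_apply]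
    simp
    ring
  have him : |w.im| ≤ r := by
    rw [← hw]
    simpa using Complex.abs_im_le_norm (w - t)
  unfold gEntire
  rw [Complex.norm_exp]
  apply Real.exp_le_exp.2
  have e : (-(w - (a : ℂ)) ^ 2 / 2 - Complex.I * w * (ξ : ℂ)).re =
      -((w.re - a) ^ 2 - w.im ^ 2) / 2 + w.im * ξ := by
    have : (-(w - (a : ℂ)) ^ 2 / 2) = -(w - (a : ℂ)) ^ 2 / ((2 : ℝ) : ℂ) := by norm_num
    rw [this, Complex.sub_re, Complex.div_ofReal_re]
    simp [pow_two]
  rw [e]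
  have h1 : w.im * ξ ≤ r * |ξ| :=
    (le_abs_self _).trans (by rw [abs_mul]; gcongr)
  nlinarith [sq_nonneg ((t - a) + 2 * (w.re - t))]

theorem gEntire_bound (a ξ : ℝ) : ∃ A : ℝ, 0 < A ∧ ∀ (n m : ℕ) (t : ℝ),
    |t| ^ m * ‖deriv^[n] (fun t : ℝ => gEntire a ξ t) t‖ ≤
      A * 3 ^ (n + m) * (((n.factorial * m.factorial : ℕ) : ℝ) ^ (1 / 2 : ℝ)) := by
  refine ⟨Real.exp (1 + ξ ^ 2 / 2 + a ^ 2 / 4), Real.exp_pos _, fun n m t => ?_⟩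
  rw [deriv_iter_ofReal (gEntire_diff a ξ)]
  set r : ℝ := Real.sqrt (n + 1) with hr
  have hn1 : (0 : ℝ) < n + 1 := by positivity
  have hr0 : 0 < r := Real.sqrt_pos.2 hn1
  have hr2 : r ^ 2 = n + 1 := Real.sq_sqrt hn1.le
  have hc := Complex.norm_iteratedDeriv_le_of_forall_mem_sphere_norm_le (c := (t : ℂ)) n hr0
    (gEntire_diff a ξ).diffContOnCl (fun w hw => gEntire_norm a ξ t r w (by
      simpa [dist_eq_norm] using hw))
  have hsf : Real.sqrt n.factorial ≤ r ^ n := by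
    apply Real.sqrt_le_iff.2
    refine ⟨by positivity, ?_⟩
    rw [← pow_mul, mul_comm, pow_mul, hr2]
    have : n.factorial ≤ (n + 1) ^ n :=
      (Nat.factorial_le_pow n).trans (Nat.pow_le_pow_left (Nat.le_succ n) n)
    exact_mod_cast this
  have hfac : (n.factorial : ℝ) / r ^ n ≤ Real.sqrt n.factorial := by
    rw [div_le_iff₀ (by positivity)]
    calc (n.factorial : ℝ) = Real.sqrt n.factorial * Real.sqrt n.factorial :=
          (Real.mul_self_sqrt (by positivity)).symm
      _ ≤ _ := by gcongr
  have htm : |t| ^ m ≤ 2 ^ m * Real.sqrt m.factorial * Real.exp (t ^ 2 / 8) := by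
    have h1 : (t ^ 2 / 4) ^ m / m.factorial ≤ Real.exp (t ^ 2 / 4) :=
      Real.pow_div_factorial_le_exp _ (by positivity) m
    rw [div_le_iff₀ (by positivity), div_pow, div_le_iff₀ (by positivity)] at h1
    refine abs_le_of_sq_le_sq' ?_ (by positivity) |>.2
    calc (|t| ^ m) ^ 2 = (t ^ 2) ^ m := by
          rw [← pow_mul, mul_comm, pow_mul, sq_abs]
      _ ≤ Real.exp (t ^ 2 / 4) * m.factorial * 4 ^ m := h1
      _ = (2 ^ m * Real.sqrt m.factorial * Real.exp (t ^ 2 / 8)) ^ 2 := by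
          rw [mul_pow, mul_pow, Real.sq_sqrt (by positivity), ← pow_mul, mul_comm m 2, pow_mul,
            ← Real.exp_nat_mul]
          norm_num
          ring_nf
  have hrxi : r * |ξ| ≤ (n + 1) / 2 + ξ ^ 2 / 2 := by
    have := sq_nonneg (r - |ξ|)
    nlinarith [sq_abs ξ]
  have hexp : Real.exp (t ^ 2 / 8) * Real.exp (-(t - a) ^ 2 / 4 + r ^ 2 / 2 + r * |ξ|) ≤
      Real.exp (1 + ξ ^ 2 / 2 + a ^ 2 / 4) * 3 ^ n := by
    have h3 : Real.exp n ≤ 3 ^ n := by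
      rw [← mul_one (n : ℝ), Real.exp_nat_mul]
      exact pow_le_pow_left₀ (Real.exp_pos _).le (Real.exp_one_lt_three.le) n
    calc _ = Real.exp (t ^ 2 / 8 + (-(t - a) ^ 2 / 4 + r ^ 2 / 2 + r * |ξ|)) :=
          (Real.exp_add _ _).symm
      _ ≤ Real.exp ((1 + ξ ^ 2 / 2 + a ^ 2 / 4) + n) := by
          apply Real.exp_le_exp.2
          rw [hr2]
          nlinarith [sq_nonneg (t - 2 * a)]
      _ = Real.exp (1 + ξ ^ 2 / 2 + a ^ 2 / 4) * Real.exp n := Real.exp_add _ _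
      _ ≤ _ := by gcongr
  rw [← Real.sqrt_eq_rpow]
  push_cast
  rw [Real.sqrt_mul (by positivity)]
  calc |t| ^ m * ‖iteratedDeriv n (gEntire a ξ) t‖
      ≤ (2 ^ m * Real.sqrt m.factorial * Real.exp (t ^ 2 / 8)) *
        (n.factorial * Real.exp (-(t - a) ^ 2 / 4 + r ^ 2 / 2 + r * |ξ|) / r ^ n) := by
        gcongr
    _ = 2 ^ m * Real.sqrt m.factorial * ((n.factorial : ℝ) / r ^ n) *
        (Real.exp (t ^ 2 / 8) * Real.exp (-(t - a) ^ 2 / 4 + r ^ 2 / 2 + r * |ξ|)) := by ring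
    _ ≤ 3 ^ m * Real.sqrt m.factorial * Real.sqrt n.factorial *
        (Real.exp (1 + ξ ^ 2 / 2 + a ^ 2 / 4) * 3 ^ n) := by
        gcongr
        norm_num
    _ = _ := by ring

theorem gEntire_real_contDiff (a ξ : ℝ) : ContDiff ℝ (⊤ : ℕ∞) (fun t : ℝ => gEntire a ξ t) := by
  unfold gEntire
  have : ContDiff ℝ (⊤ : ℕ∞) (fun t : ℝ => (t : ℂ)) := Complex.ofRealCLM.contDiff
  fun_prop

theorem stftAtom_eq_tens (x ξ : EuclideanSpace ℝ (Fin d)) :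
    stftAtom x ξ = tens ((Real.pi ^ (-(d : ℝ) / 4) : ℝ) : ℂ)
      (fun j t => gEntire (x j) (ξ j) t) := by
  funext y
  unfold stftAtom tens gaussWindow gEntire
  rw [Complex.conj_ofReal, ← Complex.exp_sum, Complex.ofReal_mul, mul_assoc, Complex.ofReal_exp,
    ← Complex.exp_add]
  congr 2
  rw [EuclideanSpace.norm_sq_eq, PiLp.inner_apply]
  push_cast
  rw [neg_div, Finset.sum_div, Finset.mul_sum, ← Finset.sum_neg_distrib,
    ← Finset.sum_add_distrib]
  refine Finset.sum_congr rfl fun j _ => ?_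
  rw [Real.norm_eq_abs, ← Complex.ofReal_pow, sq_abs]
  simp
  ring

theorem stftAtom_mem (x ξ : EuclideanSpace ℝ (Fin d)) :
    stftAtom x ξ ∈ GelfandShilov d (1 / 2) := by
  have hu : ∀ j : Fin d, ContDiff ℝ (⊤ : ℕ∞) (fun t : ℝ => gEntire (x j) (ξ j) t) :=
    fun j => gEntire_real_contDiff _ _
  rw [stftAtom_eq_tens]
  refine ⟨tens_contDiff _ hu, 3, by norm_num, ?_⟩
  rw [gsNorm_lt_top_iff (by norm_num)]
  choose A hA0 hA using fun j : Fin d => gEntire_bound (x j) (ξ j)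
  refine ⟨‖((Real.pi ^ (-(d : ℝ) / 4) : ℝ) : ℂ)‖ * ∏ j, A j, fun α β y => ?_⟩
  rw [multiD_tens _ hu]
  unfold tens gsDenom
  rw [norm_mul, norm_prod, Finset.abs_prod]
  have key : (∏ j, |y j ^ β j|) * ∏ j, ‖deriv^[α j] (fun t : ℝ => gEntire (x j) (ξ j) t) (y j)‖ ≤
      ∏ j, (A j * 3 ^ (α j + β j) *
        ((((α j).factorial * (β j).factorial : ℕ) : ℝ) ^ (1 / 2 : ℝ))) := by
    rw [← Finset.prod_mul_distrib]
    refine Finset.prod_le_prod (fun j _ => by positivity) fun j _ => ?_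
    rw [abs_pow]
    exact hA j (α j) (β j) (y j)
  rw [Finset.prod_mul_distrib, Finset.prod_mul_distrib, Finset.prod_pow_eq_pow_sum,
    Finset.sum_add_distrib, Real.finsetProd_rpow _ _ (fun j _ => by positivity),
    ← Nat.cast_prod, Finset.prod_mul_distrib] at key
  calc _ = ‖((Real.pi ^ (-(d : ℝ) / 4) : ℝ) : ℂ)‖ * ((∏ j, |y j ^ β j|) *
        ∏ j, ‖deriv^[α j] (fun t : ℝ => gEntire (x j) (ξ j) t) (y j)‖) := by ring
    _ ≤ _ := mul_le_mul_of_nonneg_left key (norm_nonneg _)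
    _ = _ := by ring

end atoms

/-- Phase space `ℝ^{2d} ≃ ℂ^d`; a point is `(x, ξ)` with `x` the `inl` coordinates and `ξ` the
`inr` coordinates. -/
abbrev Phase (d : ℕ) : Type := EuclideanSpace ℝ (Fin d ⊕ Fin d)

/-- The position part `x` of `(x, ξ)`. -/
def Phase.pos {d : ℕ} (X : Phase d) : EuclideanSpace ℝ (Fin d) :=
  WithLp.toLp 2 fun i => X (Sum.inl i)

/-- The frequency part `ξ` of `(x, ξ)`. -/
def Phase.freq {d : ℕ} (X : Phase d) : EuclideanSpace ℝ (Fin d) :=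
  WithLp.toLp 2 fun i => X (Sum.inr i)

/-- The short-time Fourier transform
`V_φ f (x,ξ) = (2π)^{-d/2} ⟨f, conj (φ(· - x)) exp(-i⟨·,ξ⟩)⟩` of `f ∈ 𝒮_{1/2}'(ℝ^d)`. -/
def stft {d : ℕ} (f : GelfandShilovDual d (1 / 2)) (X : Phase d) : ℂ :=
  (((2 * Real.pi) ^ (-(d : ℝ) / 2) : ℝ) : ℂ) *
    (f : Module.Dual ℂ (GelfandShilov d (1 / 2))) ⟨stftAtom X.pos X.freq, stftAtom_mem _ _⟩

/-! ### The spaces `M(ω, ℬ)` and `A(ω, ℬ)` -/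

/-- `‖f‖_{M(ω,ℬ)} = ‖V_φ f · ω‖_ℬ`. -/
def modNorm {d : ℕ} (ω : Phase d → ℝ) (B : MixedSpace (Fin d ⊕ Fin d))
    (f : GelfandShilovDual d (1 / 2)) : ℝ≥0∞ :=
  B.qnorm fun X => stft f X * (ω X : ℂ)

/-- The modulation space `M(ω, ℬ)`. -/
def modSpace {d : ℕ} (ω : Phase d → ℝ) (B : MixedSpace (Fin d ⊕ Fin d)) :
    Set (GelfandShilovDual d (1 / 2)) :=
  {f | modNorm ω B f < ∞}

/-- `(U⁻¹F)(x,ξ) = (2π)^{-d/2} exp(-(|x|²+|ξ|²)/4) exp(-i⟨x,ξ⟩/2) F(2^{-1/2}x - i 2^{-1/2}ξ)`, the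
inverse of
`(UG)(x,ξ) = (2π)^{d/2} exp((|x|²+|ξ|²)/2) exp(-i⟨x,ξ⟩) G(2^{1/2}x, -2^{1/2}ξ)`,
where `(x,ξ) ∈ ℝ^{2d}` is identified with `x + iξ ∈ ℂ^d`. -/
def bargmannPullback {d : ℕ} (F : EuclideanSpace ℂ (Fin d) → ℂ) (X : Phase d) : ℂ :=
  (((2 * Real.pi) ^ (-(d : ℝ) / 2) * Real.exp (-‖X‖ ^ 2 / 4) : ℝ) : ℂ) *
    Complex.exp (-Complex.I * ((inner ℝ X.pos X.freq : ℝ) : ℂ) / 2) *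
    F (WithLp.toLp 2 fun i =>
      (((Real.sqrt 2)⁻¹ * X.pos i : ℝ) : ℂ) - Complex.I * (((Real.sqrt 2)⁻¹ * X.freq i : ℝ) : ℂ))

/-- `‖F‖_{B(ω,ℬ)} = ‖(U⁻¹F) ω‖_ℬ`. -/
def analNorm {d : ℕ} (ω : Phase d → ℝ) (B : MixedSpace (Fin d ⊕ Fin d))
    (F : EuclideanSpace ℂ (Fin d) → ℂ) : ℝ≥0∞ :=
  B.qnorm fun X => bargmannPullback F X * (ω X : ℂ)

/-- The space `A(ω, ℬ)` of entire functions `F` on `ℂ^d` with `‖F‖_{B(ω,ℬ)} < ∞`. (Entire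
functions are continuous, hence in every `L^r_loc`.) -/
def analSpace {d : ℕ} (ω : Phase d → ℝ) (B : MixedSpace (Fin d ⊕ Fin d)) :
    Set (EuclideanSpace ℂ (Fin d) → ℂ) :=
  {F | Differentiable ℂ F ∧ analNorm ω B F < ∞}

/-! ### Quasi-Banach spaces -/

/-- The subset `S` of the complex vector space `X` is a linear subspace, `N` is a (finite)
quasi-norm on `S` with constant `K` in the quasi-triangle inequality, and `S` is complete:
every sequence in `S` which is Cauchy for `N` converges for `N` to an element of `S`. -/
structure IsCompleteQuasiNormed {X : Type} [AddCommGroup X] [Module ℂ X] (S : Set X)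
    (N : X → ℝ≥0∞) (K : ℝ≥0) : Prop where
  zero_mem : (0 : X) ∈ S
  add_mem : ∀ f ∈ S, ∀ g ∈ S, f + g ∈ S
  smul_mem : ∀ (a : ℂ), ∀ f ∈ S, a • f ∈ S
  finite : ∀ f ∈ S, N f < ∞
  eq_zero_iff : ∀ f ∈ S, N f = 0 ↔ f = 0
  smul_eq : ∀ (a : ℂ), ∀ f ∈ S, N (a • f) = ‖a‖ₑ * N f
  add_le : ∀ f ∈ S, ∀ g ∈ S, N (f + g) ≤ K * (N f + N g)
  complete : ∀ u : ℕ → X, (∀ k, u k ∈ S) →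
    (∀ ε : ℝ≥0∞, 0 < ε → ∃ k₀, ∀ k ≥ k₀, ∀ l ≥ k₀, N (u k - u l) < ε) →
    ∃ f ∈ S, Filter.Tendsto (fun k => N (u k - f)) Filter.atTop (nhds 0)

/-- `S` with `N` is a quasi-Banach space. -/
def IsQuasiBanachSpace {X : Type} [AddCommGroup X] [Module ℂ X] (S : Set X)
    (N : X → ℝ≥0∞) : Prop :=
  ∃ K : ℝ≥0, 1 ≤ K ∧ IsCompleteQuasiNormed S N K

/-- `S` with `N` is a Banach space: the quasi-triangle inequality holds with constant `1`. -/
def IsBanachSpace {X : Type} [AddCommGroup X] [Module ℂ X] (S : Set X)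
    (N : X → ℝ≥0∞) : Prop :=
  IsCompleteQuasiNormed S N 1

end

end GSMod

open GSMod

namespace GSMod
noncomputable section

/-! ### Iterated Lebesgue quasi-norms -/

section eLpNormENNReal

variable {α β : Type*} [MeasurableSpace α] [MeasurableSpace β] {μ : Measure α} {ν : Measure β}

/-! Both quasi-norms have the form `‖L f · ω‖_ℬ` with `L` linear: the short-time Fourier transform
for `M`, the map `U⁻¹` for `A`. The mixed quasi-norm is absolutely homogeneous, satisfies the
quasi-triangle inequality with constant `∏ j, LpAddConst (p j)` (which is `1` when all exponents are
at least `1`), and has the Fatou property. Hence the algebraic part is immediate, and completeness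
follows once every Cauchy sequence `u k` has a candidate limit `f` in the ambient space with `L (u
k) → L f` pointwise: Fatou then gives `N (u k - f) ≤ liminf_l N (u k - u l)`. This is
`isCompleteQuasiNormed_of_pointwise_limits`. What remains is definiteness and the candidate, and
both come from bounds on point evaluations.

The central bound is `exists_enorm_bargmannPullback_le`: `|U⁻¹F(X)|` is at most a constant times
`e^{|X|+1} / m` times `‖(U⁻¹F) ω‖_ℬ`, where `m` is a lower bound of `ω` on the ball of radius 2
about `X`. It combines a mean value inequality for `|F|^p` with `p = min(1, ν₁)`
(`CircleMean.enorm_rpow_le`) with Hölder's inequality in each of the variables of `ℬ`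
(`lintegral_ball_le_qnorm`). Only continuity and the mean value property on circles in complex lines
are required of `F`.

For `A(ω, ℬ)` the bound is locally uniform, so Cauchy sequences converge locally uniformly to entire
functions.

For `M(ω, ℬ)` one has `V_φ f = U⁻¹F`, where `F` is the Bargmann transform of `f`
(`exists_stft_eq_bargmannPullback`). Since `ω` is bounded below by Gaussians of arbitrarily small
rate, `|V_φ f(X)|` is bounded by `C_δ e^{δ|X|²} ‖f‖` for every `δ > 0`. On the other side, each test
function in `𝒮_{1/2,h}` is a superposition of Gaussian atoms whose coefficients decay like a
Gaussian of a rate depending only on `h` (`exists_gabor_expansion`). Pairing the two gives `|⟨f, φ⟩|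
≤ C ‖φ‖_{𝒮_{1/2,h}} ‖f‖_M` (`exists_enorm_apply_le`), so a Cauchy sequence converges on each test
function and its limit is again in `𝒮_{1/2}'`.

To move a distribution through integrals, `𝒮_{1/2,h}` is embedded isometrically in `ℓ^∞` through the
numbers `x^β ∂^α φ(x)` divided by their weights, and the distribution is extended to `ℓ^∞` by
Hahn–Banach; Bochner integrals there are computed coordinatewise. -/

theorem eLpNorm_const_mul_ennreal {c : ℝ≥0∞} (hc : c ≠ ∞) (f : α → ℝ≥0∞) (p : ℝ≥0∞) :
    eLpNorm (fun x => c * f x) p μ = c * eLpNorm f p μ := by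
  rcases eq_or_ne p 0 with rfl | hp0
  · simp
  rcases eq_or_ne p ∞ with rfl | hp
  · simpa [eLpNormEssSup] using ENNReal.essSup_const_mul
  have hp' : 0 < p.toReal := ENNReal.toReal_pos hp0 hp
  rw [eLpNorm_eq_lintegral_rpow_enorm_toReal hp0 hp, eLpNorm_eq_lintegral_rpow_enorm_toReal hp0 hp]
  simp only [enorm_eq_self, ENNReal.mul_rpow_of_nonneg _ _ hp'.le]
  rw [lintegral_const_mul' _ _ (ENNReal.rpow_ne_top_of_nonneg hp'.le hc),
    ENNReal.mul_rpow_of_nonneg _ _ (by positivity), ← ENNReal.rpow_mul,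
    mul_one_div_cancel hp'.ne', ENNReal.rpow_one]

/-- Fatou's lemma for every exponent: `t ↦ t ^ q` with `q > 0` is an order isomorphism of `[0, ∞]`,
so it commutes with `liminf`. -/
theorem eLpNorm_liminf_le {f : ℕ → α → ℝ≥0∞} (hf : ∀ k, AEMeasurable (f k) μ) {p : ℝ≥0∞}
    (hp0 : p ≠ 0) :
    eLpNorm (fun x => Filter.liminf (fun k => f k x) Filter.atTop) p μ ≤
      Filter.liminf (fun k => eLpNorm (f k) p μ) Filter.atTop := by
  rcases eq_or_ne p ∞ with rfl | hp
  · simpa [eLpNormEssSup] using ENNReal.essSup_liminf_le f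
  have hp' : 0 < p.toReal := ENNReal.toReal_pos hp0 hp
  simp only [eLpNorm_eq_lintegral_rpow_enorm_toReal hp0 hp, enorm_eq_self]
  have key : ∀ (q : ℝ) (_ : 0 < q) (u : ℕ → ℝ≥0∞), (Filter.liminf u Filter.atTop) ^ q =
      Filter.liminf (fun k => u k ^ q) Filter.atTop := fun q hq u =>
    (ENNReal.orderIsoRpow q hq).liminf_apply
  rw [← key _ (by positivity)]
  gcongr
  simp only [key _ hp']
  exact lintegral_liminf_le' fun k => (hf k).pow_const _

/-- The essential supremum of a slice is at most `a` exactly when the slice of `{f > a}` is null,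
and measures of slices depend measurably on the parameter. -/
theorem measurable_essSup_prod [SFinite μ] {f : α × β → ℝ≥0∞} (hf : Measurable f) :
    Measurable fun y => essSup (fun x => f (x, y)) μ := by
  refine measurable_of_Iic fun a => ?_
  have : (fun y => essSup (fun x => f (x, y)) μ) ⁻¹' Set.Iic a =
      (fun y => μ ((fun x => (x, y)) ⁻¹' {z | a < f z})) ⁻¹' {0} := by
    ext y
    simp only [Set.mem_preimage, Set.mem_Iic, Set.mem_singleton_iff]
    have e : μ ((fun x => (x, y)) ⁻¹' {z | a < f z}) = 0 ↔ ∀ᵐ x ∂μ, f (x, y) ≤ a := by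
      simp only [ae_iff, not_le]
      rfl
    rw [e]
    exact ⟨fun h => (ENNReal.ae_le_essSup fun x => f (x, y)).mono fun x hx => hx.trans h,
      fun h => essSup_le_of_ae_le _ h⟩
  rw [this]
  exact (measurable_measure_prodMk_right (measurableSet_lt measurable_const hf))
    (measurableSet_singleton 0)

theorem ae_ae_of_ae_prod_snd [SFinite μ] [SFinite ν] {p : α × β → Prop}
    (h : ∀ᵐ z ∂μ.prod ν, p z) : ∀ᵐ y ∂ν, ∀ᵐ x ∂μ, p (x, y) :=
  Measure.ae_ae_of_ae_prod (Measure.measurePreserving_swap.quasiMeasurePreserving.ae h)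

/-- Passing to a measurable representative alters the slice norms only for a null set of parameters.
-/
theorem aemeasurable_eLpNorm_prod [SFinite μ] [SFinite ν] {f : α × β → ℝ≥0∞}
    (hf : AEMeasurable f (μ.prod ν)) (p : ℝ≥0∞) :
    AEMeasurable (fun y => eLpNorm (fun x => f (x, y)) p μ) ν := by
  rcases eq_or_ne p 0 with rfl | hp0
  · simp
  refine ⟨fun y => eLpNorm (fun x => hf.mk f (x, y)) p μ, ?_, ?_⟩
  · rcases eq_or_ne p ∞ with rfl | hp
    · simpa [eLpNormEssSup] using measurable_essSup_prod hf.measurable_mk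
    · simp only [eLpNorm_eq_lintegral_rpow_enorm_toReal hp0 hp, enorm_eq_self]
      exact (Measurable.lintegral_prod_left' (hf.measurable_mk.pow_const _)).pow_const _
  · filter_upwards [ae_ae_of_ae_prod_snd hf.ae_eq_mk] with y hy
    exact eLpNorm_congr_ae hy

end eLpNormENNReal

/-! ### Iterated quasi-norms: monotonicity, quasi-triangle inequality, Fatou property, local Hölder
bound. -/

section iterated

/-- The `L^{p}` quasi-norm in the first variable, as a function of the remaining ones. -/
def headLpNorm {n : ℕ} {X : Fin (n + 1) → Type} [∀ j, MeasurableSpace (X j)]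
    (μ : (j : Fin (n + 1)) → Measure (X j)) (p : ℝ≥0∞) (f : ((j : Fin (n + 1)) → X j) → ℝ≥0∞) :
    ((j : Fin n) → X j.succ) → ℝ≥0∞ :=
  fun x' => eLpNorm (fun x₀ : X 0 => f (Fin.cons x₀ x')) p (μ 0)

theorem iteratedLpNorm_succ {n : ℕ} {X : Fin (n + 1) → Type} [∀ j, MeasurableSpace (X j)]
    (μ : (j : Fin (n + 1)) → Measure (X j)) (p : Fin (n + 1) → ℝ≥0∞)
    (f : ((j : Fin (n + 1)) → X j) → ℝ≥0∞) :
    iteratedLpNorm (n + 1) X μ p f = iteratedLpNorm n (fun j => X j.succ) (fun j => μ j.succ)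
      (fun j => p j.succ) (headLpNorm μ (p 0) f) := rfl

section head

variable {n : ℕ} {X : Fin (n + 1) → Type} [∀ j, MeasurableSpace (X j)]
  {μ : (j : Fin (n + 1)) → Measure (X j)} [∀ j, SigmaFinite (μ j)]

/-- This puts Tonelli's theorem for `Measure.pi` in the shape of the recursion defining
`iteratedLpNorm`, which peels off the first variable. -/
theorem measurePreserving_cons :
    MeasurePreserving (fun z : X 0 × ((j : Fin n) → X j.succ) => (Fin.cons z.1 z.2 : ∀ j, X j))
      ((μ 0).prod (Measure.pi fun j : Fin n => μ j.succ)) (Measure.pi μ) := by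
  have h := (measurePreserving_piFinSuccAbove μ 0).symm
  have e : (⇑(MeasurableEquiv.piFinSuccAbove X 0).symm) = fun z => Fin.cons z.1 z.2 := by
    funext z
    exact (MeasurableEquiv.symm_apply_eq _).2 rfl
  rw [e] at h
  exact h

theorem ae_ae_cons {P : (∀ j, X j) → Prop} (h : ∀ᵐ x ∂Measure.pi μ, P x) :
    ∀ᵐ x' ∂(Measure.pi fun j : Fin n => μ j.succ), ∀ᵐ x₀ ∂μ 0, P (Fin.cons x₀ x') :=
  ae_ae_of_ae_prod_snd (measurePreserving_cons.quasiMeasurePreserving.ae h)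

theorem aemeasurable_headLpNorm {f : (∀ j, X j) → ℝ≥0∞} (hf : AEMeasurable f (Measure.pi μ))
    (p : ℝ≥0∞) : AEMeasurable (headLpNorm μ p f) (Measure.pi fun j : Fin n => μ j.succ) :=
  aemeasurable_eLpNorm_prod
    (hf.comp_quasiMeasurePreserving measurePreserving_cons.quasiMeasurePreserving) p

theorem ae_aemeasurable_cons {f : (∀ j, X j) → ℝ≥0∞} (hf : AEMeasurable f (Measure.pi μ)) :
    ∀ᵐ x' ∂(Measure.pi fun j : Fin n => μ j.succ),
      AEMeasurable (fun x₀ => f (Fin.cons x₀ x')) (μ 0) := by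
  filter_upwards [ae_ae_cons hf.ae_eq_mk] with x' hx'
  refine ⟨fun x₀ => hf.mk f (Fin.cons x₀ x'), hf.measurable_mk.comp ?_, hx'⟩
  exact measurePreserving_cons (μ := μ).measurable.comp measurable_prodMk_right

theorem lintegral_pi_cons {f : (∀ j, X j) → ℝ≥0∞} (hf : AEMeasurable f (Measure.pi μ)) :
    ∫⁻ x, f x ∂Measure.pi μ =
      ∫⁻ x', ∫⁻ x₀, f (Fin.cons x₀ x') ∂μ 0 ∂(Measure.pi fun j : Fin n => μ j.succ) := by
  rw [← (measurePreserving_cons (μ := μ)).map_eq] at hf ⊢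
  rw [lintegral_map' hf measurePreserving_cons.aemeasurable, lintegral_prod_symm]
  exact hf.comp_aemeasurable (measurePreserving_cons (μ := μ)).aemeasurable

theorem headLpNorm_mono_ae {f g : (∀ j, X j) → ℝ≥0∞} (h : f ≤ᵐ[Measure.pi μ] g) (p : ℝ≥0∞) :
    headLpNorm μ p f ≤ᵐ[Measure.pi fun j : Fin n => μ j.succ] headLpNorm μ p g := by
  filter_upwards [ae_ae_cons h] with x' hx'
  exact eLpNorm_mono_enorm_ae (by simpa using hx')

end head

/-- Null sets of the product have null slices for almost every parameter, so the recursion never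
sees them. This is needed because inequalities between inner norms hold only for almost every outer
variable. -/
theorem iteratedLpNorm_mono_ae {n : ℕ} : ∀ {X : Fin n → Type} [∀ j, MeasurableSpace (X j)]
    {μ : (j : Fin n) → Measure (X j)} [∀ j, SigmaFinite (μ j)] (p : Fin n → ℝ≥0∞)
    {f g : (∀ j, X j) → ℝ≥0∞}, f ≤ᵐ[Measure.pi μ] g →
      iteratedLpNorm n X μ p f ≤ iteratedLpNorm n X μ p g := by
  induction n with
  | zero =>
    intro X _ μ _ p f g h
    -- The empty product carries a Dirac mass, so an almost everywhere statement holds at its only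
    -- point.
    rw [Measure.pi_of_empty μ fun j => j.elim0] at h
    obtain ⟨x, hx⟩ := h.exists
    rwa [Subsingleton.elim x fun j => j.elim0] at hx
  | succ n ih =>
    intro X _ μ _ p f g h
    exact ih _ (headLpNorm_mono_ae h _)

theorem iteratedLpNorm_const_mul {n : ℕ} {c : ℝ≥0∞} (hc : c ≠ ∞) :
    ∀ {X : Fin n → Type} [∀ j, MeasurableSpace (X j)]
    {μ : (j : Fin n) → Measure (X j)} (p : Fin n → ℝ≥0∞) (f : (∀ j, X j) → ℝ≥0∞),
      iteratedLpNorm n X μ p (fun x => c * f x) = c * iteratedLpNorm n X μ p f := by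
  induction n with
  | zero => intros; rfl
  | succ n ih =>
    intro X _ μ p f
    rw [iteratedLpNorm_succ, iteratedLpNorm_succ, ← ih]
    congr 1
    funext x'
    exact eLpNorm_const_mul_ennreal hc _ _

/-- Each variable contributes the constant of its own `L^p` space; by homogeneity that constant can
be pulled out of the remaining norms. -/
theorem iteratedLpNorm_add_le {n : ℕ} : ∀ {X : Fin n → Type} [∀ j, MeasurableSpace (X j)]
    {μ : (j : Fin n) → Measure (X j)} [∀ j, SigmaFinite (μ j)] (p : Fin n → ℝ≥0∞)
    {f g : (∀ j, X j) → ℝ≥0∞}, AEMeasurable f (Measure.pi μ) → AEMeasurable g (Measure.pi μ) →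
      iteratedLpNorm n X μ p (fun x => f x + g x) ≤
        (∏ j, ENNReal.LpAddConst (p j)) * (iteratedLpNorm n X μ p f + iteratedLpNorm n X μ p g) := by
  induction n with
  | zero => intros; simp [iteratedLpNorm]
  | succ n ih =>
    intro X _ μ _ p f g hf hg
    rw [iteratedLpNorm_succ, Fin.prod_univ_succ, mul_assoc]
    calc _ ≤ iteratedLpNorm n _ _ _ (fun x' => ENNReal.LpAddConst (p 0) *
          (headLpNorm μ (p 0) f x' + headLpNorm μ (p 0) g x')) := by
          refine iteratedLpNorm_mono_ae (μ := fun j => μ j.succ) _ ?_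
          filter_upwards [ae_aemeasurable_cons hf, ae_aemeasurable_cons hg] with x' h1 h2
          exact eLpNorm_add_le' h1.aestronglyMeasurable h2.aestronglyMeasurable (p 0)
      _ = _ := iteratedLpNorm_const_mul (ENNReal.LpAddConst_lt_top _).ne _ _
      _ ≤ _ := by
          gcongr
          exact ih _ (aemeasurable_headLpNorm hf _) (aemeasurable_headLpNorm hg _)

/-- Fatou in the innermost variable, then monotonicity of the outer norms, then induction. -/
theorem iteratedLpNorm_liminf_le {n : ℕ} : ∀ {X : Fin n → Type} [∀ j, MeasurableSpace (X j)]
    {μ : (j : Fin n) → Measure (X j)} [∀ j, SigmaFinite (μ j)] {p : Fin n → ℝ≥0∞},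
    (∀ j, p j ≠ 0) → ∀ {f : ℕ → (∀ j, X j) → ℝ≥0∞}, (∀ k, AEMeasurable (f k) (Measure.pi μ)) →
      iteratedLpNorm n X μ p (fun x => Filter.liminf (fun k => f k x) Filter.atTop) ≤
        Filter.liminf (fun k => iteratedLpNorm n X μ p (f k)) Filter.atTop := by
  induction n with
  | zero => intros; exact le_rfl
  | succ n ih =>
    intro X _ μ _ p hp f hf
    rw [iteratedLpNorm_succ]
    refine le_trans (iteratedLpNorm_mono_ae (μ := fun j => μ j.succ) _ ?_)
      (ih (fun j => hp j.succ) fun k => aemeasurable_headLpNorm (hf k) (p 0))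
    filter_upwards [ae_all_iff.2 fun k => ae_aemeasurable_cons (hf k)] with x' hx'
    exact eLpNorm_liminf_le hx' (hp 0)

/-- On products of sets of finite measure, the local `L^q` quasi-norm is dominated by the iterated
one when `q` is at most every exponent. -/
theorem lintegral_pi_rpow_le_iteratedLpNorm {n : ℕ} {q : ℝ} (hq : 0 < q) :
    ∀ {X : Fin n → Type} [∀ j, MeasurableSpace (X j)]
    {μ : (j : Fin n) → Measure (X j)} [∀ j, SigmaFinite (μ j)] {p : Fin n → ℝ≥0∞},
    (∀ j, ENNReal.ofReal q ≤ p j) → ∀ {K : (j : Fin n) → Set (X j)}, (∀ j, μ j (K j) ≠ ∞) →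
    ∀ {f : (∀ j, X j) → ℝ≥0∞}, AEMeasurable f (Measure.pi μ) →
      (∫⁻ x, f x ^ q ∂(Measure.pi fun j => (μ j).restrict (K j))) ^ (1 / q) ≤
        (∏ j, μ j (K j) ^ (1 / q - 1 / (p j).toReal)) * iteratedLpNorm n X μ p f := by
  induction n with
  | zero =>
    intro X _ μ _ p hp K hK f hf
    have : ∀ x, f x = f fun j => j.elim0 := fun x => congrArg f (Subsingleton.elim _ _)
    simp_rw [this]
    simp [iteratedLpNorm, ← ENNReal.rpow_mul, hq.ne']
  | succ n ih =>
    intro X _ μ _ p hp K hK f hf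
    have hac : ∀ j, (μ j).restrict (K j) ≪ μ j := fun j => Measure.restrict_le_self.absolutelyContinuous
    have hac' : (Measure.pi fun j => (μ j).restrict (K j)) ≪ Measure.pi μ := by
      rw [← Measure.restrict_pi_pi]
      exact Measure.restrict_le_self.absolutelyContinuous
    have hac'' : (Measure.pi fun j : Fin n => (μ j.succ).restrict (K j.succ)) ≪
      Measure.pi fun j : Fin n => μ j.succ := by
      rw [← Measure.restrict_pi_pi]
      exact Measure.restrict_le_self.absolutelyContinuous
    -- The Hölder constant on `K 0`. For `p 0 = ∞` the convention `toReal = 0` makes the exponent `1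
    -- / q`, as it should be.
    set c : ℝ≥0∞ := μ 0 (K 0) ^ (1 / q - 1 / (p 0).toReal) with hc
    have hct : c ≠ ∞ := by
      refine ENNReal.rpow_ne_top_of_nonneg (sub_nonneg.2 ?_) (hK 0)
      rcases eq_or_ne (p 0) ∞ with h | h
      · simp [h, hq.le]
      · exact one_div_le_one_div_of_le hq ((ENNReal.ofReal_le_iff_le_toReal h).1 (hp 0))
    rw [iteratedLpNorm_succ, Fin.prod_univ_succ, lintegral_pi_cons ((hf.mono_ac hac').pow_const q)]
    calc _ ≤ (∫⁻ x', (c * headLpNorm μ (p 0) f x') ^ q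
            ∂(Measure.pi fun j : Fin n => (μ j.succ).restrict (K j.succ))) ^ (1 / q) := by
          gcongr ?_ ^ _
          refine lintegral_mono_ae ?_
          filter_upwards [hac''.ae_le (ae_aemeasurable_cons hf)] with x' hx'
          have h := eLpNorm_le_eLpNorm_mul_rpow_measure_univ (μ := (μ 0).restrict (K 0)) (hp 0)
            (hx'.mono_ac (hac 0)).aestronglyMeasurable
          rw [eLpNorm_eq_lintegral_rpow_enorm_toReal (by simpa using hq) (by simp),
            ENNReal.toReal_ofReal hq.le, Measure.restrict_apply_univ, mul_comm] at h
          have h2 := h.trans (mul_le_mul_right (eLpNorm_mono_measure _ Measure.restrict_le_self) _)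
          rw [← ENNReal.rpow_inv_le_iff hq]
          simpa [hc, headLpNorm] using h2
      _ ≤ _ := ih (p := fun j => p j.succ) (fun j => hp j.succ) (fun j => hK j.succ)
          ((aemeasurable_headLpNorm hf _).const_mul c)
      _ = _ := by
          rw [iteratedLpNorm_const_mul hct]
          ring

end iterated

/-! ### The circle mean value property and local `L^p` bounds -/

section CircleMean

variable {E : Type*} [NormedAddCommGroup E] [NormedSpace ℂ E]

/-- `F` is continuous and equal to its mean over every circle in every complex line. -/
structure CircleMean (F : E → ℂ) : Prop where
  continuous : Continuous F
  mean : ∀ z w, F z =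
    (2 * Real.pi)⁻¹ • ∫ θ in (0 : ℝ)..2 * Real.pi, F (z + Complex.exp (θ * Complex.I) • w)

/-- The restriction of `F` to the complex line `s ↦ z + s w` is entire, and its mean over the unit
circle is its value at the centre. -/
theorem _root_.Differentiable.circleMean {F : E → ℂ} (hF : Differentiable ℂ F) : CircleMean F := by
  refine ⟨hF.continuous, fun z w => ?_⟩
  have h : Differentiable ℂ fun s : ℂ => F (z + s • w) := hF.comp (by fun_prop)
  have h2 := (h.diffContOnCl (s := Metric.ball (0 : ℂ) |1|)).circleAverage
  rw [Real.circleAverage_def] at h2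
  simpa [circleMap] using h2.symm

variable [MeasurableSpace E] [BorelSpace E] [FiniteDimensional ℝ E] (μ : Measure E)
  [μ.IsAddHaarMeasure]

/-- A linear automorphism multiplies Haar measure by a constant, and this one maps the unit ball
onto itself, so the constant is `1`. -/
theorem measurePreserving_unit_smul {u : ℂ} (hu : ‖u‖ = 1) :
    MeasurePreserving (fun z : E => u • z) μ μ := by
  have hu0 : u ≠ 0 := by
    rintro rfl
    simp at hu
  let L : E ≃ₗ[ℝ] E := (LinearEquiv.smulOfNeZero ℂ E u hu0).restrictScalars ℝ
  have hL : ∀ z, (L : E →ₗ[ℝ] E) z = u • z := fun z => rfl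
  have hm : Measurable fun z : E => u • z := (continuous_const_smul u).measurable
  refine ⟨hm, ?_⟩
  have h := Measure.map_linearMap_addHaar_eq_smul_addHaar μ (f := (L : E →ₗ[ℝ] E))
    (LinearEquiv.isUnit_det' L).ne_zero
  have e : ⇑(L : E →ₗ[ℝ] E) = fun z => u • z := rfl
  rw [e] at h
  have hb : (fun z : E => u • z) ⁻¹' Metric.ball 0 1 = Metric.ball 0 1 := by
    ext z
    simp [norm_smul, hu]
  have h1 := congrArg (fun ν : Measure E => ν (Metric.ball 0 1)) h
  simp only [Measure.map_apply hm Metric.isOpen_ball.measurableSet, hb, Measure.smul_apply,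
    smul_eq_mul] at h1
  rw [h]
  have hc : ENNReal.ofReal |(LinearMap.det (L : E →ₗ[ℝ] E))⁻¹| = 1 := by
    have hp : μ (Metric.ball 0 1) ≠ 0 := (Metric.measure_ball_pos μ 0 one_pos).ne'
    exact ((ENNReal.mul_left_inj hp measure_ball_lt_top.ne).1 (by rw [one_mul]; exact h1)).symm
  rw [hc, one_smul]

variable {μ}

/-- Integrate the circle identity over `w` in the ball and exchange the integrals: by rotation
invariance the inner integral does not depend on the angle. -/
theorem CircleMean.enorm_mul_measure_ball_le {F : E → ℂ} (hF : CircleMean F) (z : E) (r : ℝ) :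
    ‖F z‖ₑ * μ (Metric.ball 0 r) ≤ ∫⁻ w in Metric.ball 0 r, ‖F (z + w)‖ₑ ∂μ := by
  have hpi : (0 : ℝ) ≤ 2 * Real.pi := by positivity
  have hpt : ∀ w, ‖F z‖ₑ ≤ ‖(2 * Real.pi)⁻¹‖ₑ *
      ∫⁻ θ in Set.Ioc (0 : ℝ) (2 * Real.pi), ‖F (z + Complex.exp (θ * Complex.I) • w)‖ₑ := by
    intro w
    nth_rewrite 1 [hF.mean z w]
    rw [enorm_smul, intervalIntegral.integral_of_le hpi]
    gcongr
    exact enorm_integral_le_lintegral_enorm _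
  have hc : Continuous fun q : E × ℝ => ‖F (z + Complex.exp (q.2 * Complex.I) • q.1)‖ₑ := by
    have := hF.continuous
    fun_prop
  calc ‖F z‖ₑ * μ (Metric.ball 0 r) = ∫⁻ _ in Metric.ball 0 r, ‖F z‖ₑ ∂μ := by simp
    _ ≤ ∫⁻ w in Metric.ball 0 r, (‖(2 * Real.pi)⁻¹‖ₑ * ∫⁻ θ in Set.Ioc (0 : ℝ) (2 * Real.pi),
        ‖F (z + Complex.exp (θ * Complex.I) • w)‖ₑ) ∂μ := lintegral_mono hpt
    _ = ‖(2 * Real.pi)⁻¹‖ₑ * ∫⁻ θ in Set.Ioc (0 : ℝ) (2 * Real.pi), (∫⁻ w in Metric.ball 0 r,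
        ‖F (z + Complex.exp (θ * Complex.I) • w)‖ₑ ∂μ) := by
        rw [lintegral_const_mul' _ _ enorm_ne_top, lintegral_lintegral_swap]
        exact hc.measurable.aemeasurable
    _ = ‖(2 * Real.pi)⁻¹‖ₑ * ∫⁻ _ in Set.Ioc (0 : ℝ) (2 * Real.pi), (∫⁻ w in Metric.ball 0 r,
        ‖F (z + w)‖ₑ ∂μ) := by
        congr 2
        funext θ
        have hu : ‖Complex.exp (θ * Complex.I)‖ = 1 := Complex.norm_exp_ofReal_mul_I θ
        have hp := (measurePreserving_unit_smul μ hu).restrict_preimage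
          (Metric.isOpen_ball (x := (0 : E)) (ε := r)).measurableSet
        have hb : (fun z : E => Complex.exp (θ * Complex.I) • z) ⁻¹' Metric.ball 0 r =
            Metric.ball 0 r := by
          ext z
          simp [norm_smul, hu]
        rw [hb] at hp
        refine hp.lintegral_comp (f := fun w => ‖F (z + w)‖ₑ) ?_
        have := hF.continuous
        exact Continuous.measurable (by fun_prop)
    _ = _ := by
        rw [setLIntegral_const, Real.volume_Ioc, mul_comm _ (ENNReal.ofReal _), ← mul_assoc,
          sub_zero, ← Real.enorm_eq_ofReal hpi, ← enorm_mul, inv_mul_cancel₀ (by positivity)]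
        simp

variable (μ) in
/-- The local `L^p` bound for `0 < p ≤ 1`, obtained from the one for `p = 1` by maximising
`(1 - |w|) ^ k |F (z + w)|` over the unit ball. -/
theorem CircleMean.enorm_rpow_le {p : ℝ} (hp0 : 0 < p) (hp1 : p ≤ 1) :
    ∃ C : ℝ≥0∞, C ≠ ∞ ∧ ∀ F : E → ℂ, CircleMean F → ∀ z,
      ‖F z‖ₑ ^ p ≤ C * ∫⁻ w in Metric.ball 0 1, ‖F (z + w)‖ₑ ^ p ∂μ := by
  have : ProperSpace E := FiniteDimensional.proper_real E
  set N := Module.finrank ℝ E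
  -- With `k p = N + 1` the powers of `r` below cancel the volume factor `r ^ N` and leave one
  -- factor `r ≤ 1`; the extra `1` keeps `k` positive in dimension zero.
  set k : ℝ := (N + 1) / p with hk
  have hk0 : 0 < k := by positivity
  have hkp : k * p = N + 1 := by rw [hk]; field_simp
  obtain ⟨β, hβ0, hβ⟩ : ∃ β : ℝ, 0 < β ∧ μ (Metric.ball 0 1) = ENNReal.ofReal β :=
    ⟨(μ (Metric.ball 0 1)).toReal, ENNReal.toReal_pos (Metric.measure_ball_pos μ 0 one_pos).ne'
      measure_ball_lt_top.ne, (ENNReal.ofReal_toReal measure_ball_lt_top.ne).symm⟩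
  have hC0 : 0 < 2 ^ k / β := by positivity
  refine ⟨ENNReal.ofReal (2 ^ k / β), ENNReal.ofReal_ne_top, fun F hF z => ?_⟩
  have hFc := hF.continuous
  set I := ∫⁻ w in Metric.ball 0 1, ‖F (z + w)‖ₑ ^ p ∂μ with hI
  rcases eq_or_ne I ∞ with hI' | hI'
  · rw [hI', ENNReal.mul_top (by simpa using hC0)]
    exact le_top
  obtain ⟨i, hi0, hi⟩ : ∃ i : ℝ, 0 ≤ i ∧ I = ENNReal.ofReal i :=
    ⟨I.toReal, ENNReal.toReal_nonneg, (ENNReal.ofReal_toReal hI').symm⟩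
  set g : E → ℝ := fun w => (1 - ‖w‖) ^ k * ‖F (z + w)‖ with hg
  have hgc : Continuous g := by
    refine Continuous.mul ?_ (by fun_prop)
    exact Continuous.rpow_const (by fun_prop) fun _ => Or.inr hk0.le
  obtain ⟨w₀, hw₀, hmax⟩ := (isCompact_closedBall (0 : E) 1).exists_isMaxOn
    ⟨0, by simp⟩ hgc.continuousOn
  have hz : ‖F z‖ ≤ g w₀ := by
    have := hmax (show (0 : E) ∈ Metric.closedBall 0 1 by simp)
    simpa [hg] using this
  have hM0 : 0 ≤ g w₀ := (norm_nonneg _).trans hz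
  suffices hM : (g w₀) ^ p ≤ 2 ^ k / β * i by
    rw [hi, ← ENNReal.ofReal_mul hC0.le, ← ofReal_norm,
      ENNReal.ofReal_rpow_of_nonneg (norm_nonneg _) hp0.le]
    exact ENNReal.ofReal_le_ofReal ((Real.rpow_le_rpow (norm_nonneg _) hz hp0.le).trans hM)
  rcases hM0.eq_or_lt with hM | hM
  · rw [← hM, Real.zero_rpow hp0.ne']
    positivity
  have hw1 : ‖w₀‖ < 1 := by
    refine lt_of_le_of_ne (by simpa using hw₀) fun h => hM.ne' ?_
    simp [hg, h, hk0.ne']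
  -- Half the distance to the unit sphere: on the ball of radius `r` about `w₀` the weight is at
  -- least `r ^ k`, so maximality bounds `|F|` there by `M / r ^ k`.
  set r : ℝ := (1 - ‖w₀‖) / 2 with hr
  have hr0 : 0 < r := by rw [hr]; linarith
  have hr1 : r ≤ 1 := by rw [hr]; linarith [norm_nonneg w₀]
  set M := g w₀
  have hsub : ∀ w ∈ Metric.ball (0 : E) r, r ≤ 1 - ‖w₀ + w‖ := fun w hw => by
    have h1 : ‖w‖ < r := by simpa using hw
    have h2 := norm_add_le w₀ w
    rw [hr] at h1 ⊢
    linarith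
  have hbd : ∀ w ∈ Metric.ball (0 : E) r, ‖F (z + (w₀ + w))‖ ≤ M / r ^ k := fun w hw => by
    have h1 := hsub w hw
    rw [le_div_iff₀ (by positivity), mul_comm]
    refine le_trans ?_ (hmax (show w₀ + w ∈ Metric.closedBall (0 : E) 1 by
      simp only [Metric.mem_closedBall, dist_zero_right]; linarith))
    simp only [hg]
    gcongr
  have h1 := hF.enorm_mul_measure_ball_le (μ := μ) (z + w₀) r
  -- Write `|F| = |F|^(1-p) |F|^p` and use the supremum bound on the first factor only.
  have h2 : ∫⁻ w in Metric.ball 0 r, ‖F (z + w₀ + w)‖ₑ ∂μ ≤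
      ENNReal.ofReal ((M / r ^ k) ^ (1 - p)) * I := by
    calc _ ≤ ∫⁻ w in Metric.ball 0 r, ENNReal.ofReal ((M / r ^ k) ^ (1 - p)) *
          ‖F (z + (w₀ + w))‖ₑ ^ p ∂μ := by
          refine setLIntegral_mono_ae' Metric.isOpen_ball.measurableSet (ae_of_all _ fun w hw => ?_)
          rw [add_assoc, ← ofReal_norm, ENNReal.ofReal_rpow_of_nonneg (norm_nonneg _) hp0.le,
            ← ENNReal.ofReal_mul (by positivity)]
          refine ENNReal.ofReal_le_ofReal ?_
          calc ‖F (z + (w₀ + w))‖ = ‖F (z + (w₀ + w))‖ ^ (1 - p) * ‖F (z + (w₀ + w))‖ ^ p := by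
                rw [← Real.rpow_add_of_nonneg (norm_nonneg _) (by linarith) hp0.le]
                simp
            _ ≤ _ := by
                gcongr
                exact hbd w hw
      _ = ENNReal.ofReal ((M / r ^ k) ^ (1 - p)) *
          ∫⁻ w in Metric.ball 0 r, ‖F (z + (w₀ + w))‖ₑ ^ p ∂μ := by
          rw [lintegral_const_mul' _ _ ENNReal.ofReal_ne_top]
      _ = ENNReal.ofReal ((M / r ^ k) ^ (1 - p)) *
          ∫⁻ w in Metric.ball w₀ r, ‖F (z + w)‖ₑ ^ p ∂μ := by
          congr 1
          have hp := (measurePreserving_add_left μ w₀).restrict_preimage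
            (Metric.isOpen_ball (x := w₀) (ε := r)).measurableSet
          have hb : (fun w => w₀ + w) ⁻¹' Metric.ball w₀ r = Metric.ball 0 r := by
            ext w
            simp
          rw [hb] at hp
          refine hp.lintegral_comp (f := fun w => ‖F (z + w)‖ₑ ^ p) ?_
          exact Measurable.pow_const (Continuous.measurable (by fun_prop)) _
      _ ≤ _ := by
          gcongr
          refine lintegral_mono_set (Metric.ball_subset_ball' ?_)
          rw [hr, dist_zero_right]
          linarith [norm_nonneg w₀]
  have h3 := h1.trans h2
  rw [Measure.addHaar_ball_of_pos μ 0 hr0, hβ, hi, ← ofReal_norm,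
    ← ENNReal.ofReal_mul (by positivity), ← ENNReal.ofReal_mul (by positivity),
    ← ENNReal.ofReal_mul (by positivity), ENNReal.ofReal_le_ofReal_iff (by positivity)] at h3
  have hMe : M = 2 ^ k * r ^ k * ‖F (z + w₀)‖ := by
    rw [← Real.mul_rpow (by norm_num) hr0.le, hr]
    simp only [M, hg]
    congr 2
    ring
  have hMp : M ^ (1 - p) * M ^ p = M := by
    rw [← Real.rpow_add hM]
    simp
  have hrk : r ^ k = r ^ (k * (1 - p)) * (r ^ N * r) := by
    rw [← Real.rpow_natCast r N, ← Real.rpow_add_one hr0.ne', ← hkp, ← Real.rpow_add hr0]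
    congr 1
    ring
  have hdiv : (M / r ^ k) ^ (1 - p) * r ^ (k * (1 - p)) = M ^ (1 - p) := by
    rw [Real.div_rpow hM.le (by positivity), ← Real.rpow_mul hr0.le, div_mul_cancel₀]
    positivity
  have h4 : M * (r ^ N * β) ≤ 2 ^ k * (r ^ N * r) * (M ^ (1 - p) * i) := by
    calc M * (r ^ N * β) = 2 ^ k * r ^ k * (‖F (z + w₀)‖ * (r ^ N * β)) := by rw [hMe]; ring
      _ ≤ 2 ^ k * r ^ k * ((M / r ^ k) ^ (1 - p) * i) := by gcongr
      _ = 2 ^ k * (r ^ N * r) * (((M / r ^ k) ^ (1 - p) * r ^ (k * (1 - p))) * i) := by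
          rw [hrk]; ring
      _ = _ := by rw [hdiv]
  -- The factor `M ^ (1 - p)` on the right is absorbed on the left. This is legitimate because the
  -- maximum `M` is finite and positive.
  have h5 : M ^ (1 - p) * r ^ N * (M ^ p * β) ≤ M ^ (1 - p) * r ^ N * (2 ^ k * i) := by
    calc M ^ (1 - p) * r ^ N * (M ^ p * β) = (M ^ (1 - p) * M ^ p) * (r ^ N * β) := by ring
      _ ≤ 2 ^ k * (r ^ N * r) * (M ^ (1 - p) * i) := by rw [hMp]; exact h4
      _ = (M ^ (1 - p) * r ^ N * (2 ^ k * i)) * r := by ring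
      _ ≤ _ := mul_le_of_le_one_right (by positivity) hr1
  have h6 := le_of_mul_le_mul_left h5 (by positivity)
  rw [div_mul_eq_mul_div, le_div_iff₀ hβ0]
  exact h6

end CircleMean

/-! ### Mixed quasi-norms on phase space -/

namespace MixedSpace

variable {ι : Type} [Fintype ι] (B : MixedSpace ι)

instance (V : Submodule ℝ (EuclideanSpace ℝ ι)) : (subspaceMeasure V).IsAddHaarMeasure := by
  unfold subspaceMeasure
  infer_instance

/-- The linear isomorphism `(x_1, …, x_n) ↦ x_1 + ⋯ + x_n`. -/
def sumEquiv : ((j : Fin B.n) → B.V j) ≃ₗ[ℝ] EuclideanSpace ℝ ι :=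
  (DirectSum.linearEquivFunOnFintype ℝ (Fin B.n) fun j => B.V j).symm.trans
    (LinearEquiv.ofBijective (DirectSum.coeLinearMap B.V) B.isInternal)

theorem sumEquiv_apply (x : (j : Fin B.n) → B.V j) :
    B.sumEquiv x = ∑ j, (x j : EuclideanSpace ℝ ι) := by
  have : x = DirectSum.linearEquivFunOnFintype ℝ (Fin B.n) (fun j => B.V j)
      (∑ j, DirectSum.lof ℝ (Fin B.n) (fun j => B.V j) j (x j)) := by
    simp [DirectSum.linearEquivFunOnFintype_lof, Finset.univ_sum_single]
  conv_lhs => rw [this]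
  simp only [sumEquiv, LinearEquiv.trans_apply, LinearEquiv.symm_apply_apply, map_sum]
  exact Finset.sum_congr rfl fun j _ => DirectSum.coeLinearMap_lof B.V j (x j)

/-- The product of the Lebesgue measures of the subspaces. -/
def piMeasure : Measure ((j : Fin B.n) → B.V j) := Measure.pi fun j => subspaceMeasure (B.V j)

instance : B.piMeasure.IsAddHaarMeasure := by
  unfold piMeasure
  infer_instance

/-- Uniqueness of Haar measure. The subspaces need not be orthogonal, so the constant `c` need not
be `1`. -/
theorem exists_map_piMeasure : ∃ c : ℝ≥0∞, c ≠ 0 ∧ c ≠ ∞ ∧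
    (volume : Measure (EuclideanSpace ℝ ι)) = c • B.piMeasure.map B.sumEquiv := by
  have : (B.piMeasure.map B.sumEquiv).IsAddHaarMeasure :=
    B.sumEquiv.toAddEquiv.isAddHaarMeasure_map _
      (LinearMap.continuous_of_finiteDimensional B.sumEquiv.toLinearMap)
      (LinearMap.continuous_of_finiteDimensional B.sumEquiv.symm.toLinearMap)
  exact ⟨_, by simpa using (Measure.addHaarScalarFactor_pos_of_isAddHaarMeasure _ _).ne',
    ENNReal.coe_ne_top, Measure.isAddLeftInvariant_eq_smul volume (B.piMeasure.map B.sumEquiv)⟩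

theorem continuous_sumEquiv : Continuous B.sumEquiv :=
  LinearMap.continuous_of_finiteDimensional B.sumEquiv.toLinearMap

theorem quasiMeasurePreserving_sumEquiv :
    Measure.QuasiMeasurePreserving B.sumEquiv B.piMeasure volume := by
  refine ⟨B.continuous_sumEquiv.measurable, ?_⟩
  obtain ⟨c, hc0, -, hc⟩ := B.exists_map_piMeasure
  rw [hc]
  exact Measure.absolutelyContinuous_smul hc0

theorem qnorm_eq (f : EuclideanSpace ℝ ι → ℂ) :
    B.qnorm f = iteratedLpNorm B.n (fun j => B.V j) (fun j => subspaceMeasure (B.V j)) B.p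
      fun x => ‖f (B.sumEquiv x)‖ₑ := by
  simp only [qnorm, sumEquiv_apply]

variable {B}

theorem aemeasurable_sumEquiv {f : EuclideanSpace ℝ ι → ℂ} (hf : AEMeasurable f) :
    AEMeasurable (fun x => ‖f (B.sumEquiv x)‖ₑ) (Measure.pi fun j => subspaceMeasure (B.V j)) :=
  (hf.comp_quasiMeasurePreserving B.quasiMeasurePreserving_sumEquiv).enorm

theorem qnorm_const_mul (a : ℂ) (f : EuclideanSpace ℝ ι → ℂ) :
    B.qnorm (fun X => a * f X) = ‖a‖ₑ * B.qnorm f := by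
  simp only [qnorm_eq, enorm_mul]
  exact iteratedLpNorm_const_mul enorm_ne_top _ _

variable (B) in
/-- The constant in the quasi-triangle inequality. -/
def quasiConst : ℝ≥0∞ := ∏ j, ENNReal.LpAddConst (B.p j)

theorem quasiConst_ne_top : B.quasiConst ≠ ∞ :=
  ENNReal.prod_ne_top fun j _ => (ENNReal.LpAddConst_lt_top (B.p j)).ne

theorem quasiConst_eq_one (h : 1 ≤ B.nu1) : B.quasiConst = 1 :=
  Finset.prod_eq_one fun j _ => ENNReal.LpAddConst_of_one_le (h.trans (iInf_le _ j))

theorem qnorm_add_le {f g : EuclideanSpace ℝ ι → ℂ} (hf : AEMeasurable f) (hg : AEMeasurable g) :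
    B.qnorm (fun X => f X + g X) ≤ B.quasiConst * (B.qnorm f + B.qnorm g) := by
  simp only [qnorm_eq]
  refine le_trans ?_ (iteratedLpNorm_add_le B.p (aemeasurable_sumEquiv hf)
    (aemeasurable_sumEquiv hg))
  exact iteratedLpNorm_mono_ae B.p (ae_of_all _ fun x => enorm_add_le _ _)

/-- The Fatou property of `ℬ`, from which completeness is deduced. -/
theorem qnorm_le_liminf {f : ℕ → EuclideanSpace ℝ ι → ℂ} {g : EuclideanSpace ℝ ι → ℂ}
    (hf : ∀ k, AEMeasurable (f k))
    (h : ∀ X, Filter.Tendsto (fun k => f k X) Filter.atTop (nhds (g X))) :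
    B.qnorm g ≤ Filter.liminf (fun k => B.qnorm (f k)) Filter.atTop := by
  simp only [qnorm_eq]
  refine le_trans (le_of_eq ?_) (iteratedLpNorm_liminf_le (μ := fun j => subspaceMeasure (B.V j))
    (fun j => (B.p_pos j).ne') fun k => aemeasurable_sumEquiv (hf k))
  congr 1
  funext x
  exact ((h (B.sumEquiv x)).enorm).liminf_eq.symm

theorem nu1_pos : 0 < B.nu1 := by
  have : Nonempty (Fin B.n) := ⟨⟨0, B.n_pos⟩⟩
  obtain ⟨j, hj⟩ := exists_eq_ciInf_of_finite (f := B.p)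
  rw [nu1, ← hj]
  exact B.p_pos j

/-- The `L^p` quasi-norm over balls of a fixed radius is dominated by the mixed quasi-norm. -/
theorem lintegral_ball_le_qnorm {p : ℝ} (hp : 0 < p) (hpB : ENNReal.ofReal p ≤ B.nu1) (R : ℝ) :
    ∃ C : ℝ≥0∞, C ≠ ∞ ∧ ∀ (f : EuclideanSpace ℝ ι → ℂ) (X₀ : EuclideanSpace ℝ ι), AEMeasurable f →
      (∫⁻ X in Metric.ball X₀ R, ‖f X‖ₑ ^ p) ^ (1 / p) ≤ C * B.qnorm f := by
  obtain ⟨c, hc0, hct, hc⟩ := B.exists_map_piMeasure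
  set L : EuclideanSpace ℝ ι →L[ℝ] ((j : Fin B.n) → B.V j) :=
    LinearMap.toContinuousLinearMap B.sumEquiv.symm.toLinearMap with hL
  -- In the coordinates of `ℬ` a ball of radius `R` lies in a product of balls of radius `ρ`. Their
  -- measures do not depend on the centres, which makes the constant uniform in `X₀`.
  set ρ : ℝ := ‖L‖ * R
  have hexp : ∀ j, 0 ≤ 1 / p - 1 / (B.p j).toReal := fun j => by
    rw [sub_nonneg]
    rcases eq_or_ne (B.p j) ∞ with h | h
    · simp [h, hp.le]
    · exact one_div_le_one_div_of_le hp
        ((ENNReal.ofReal_le_iff_le_toReal h).1 (hpB.trans (iInf_le _ j)))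
  set D : ℝ≥0∞ := ∏ j, subspaceMeasure (B.V j) (Metric.closedBall 0 ρ) ^
    (1 / p - 1 / (B.p j).toReal) with hD
  have hDt : D ≠ ∞ := ENNReal.prod_ne_top fun j _ =>
    ENNReal.rpow_ne_top_of_nonneg (hexp j) measure_closedBall_lt_top.ne
  refine ⟨c ^ (1 / p) * D,
    ENNReal.mul_ne_top (ENNReal.rpow_ne_top_of_nonneg (by positivity) hct) hDt, fun f X₀ hf => ?_⟩
  set x₀ := L X₀ with hx₀
  have hsub : B.sumEquiv ⁻¹' Metric.ball X₀ R ⊆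
      Set.univ.pi fun j => Metric.closedBall (x₀ j) ρ := by
    intro x hx j _
    have h1 : L (B.sumEquiv x - X₀) = x - x₀ := by
      rw [map_sub]
      congr 1
      exact B.sumEquiv.symm_apply_apply x
    have h2 := L.le_opNorm (B.sumEquiv x - X₀)
    rw [h1] at h2
    rw [Metric.mem_closedBall, dist_eq_norm]
    refine (norm_le_pi_norm (x - x₀) j).trans (h2.trans ?_)
    have : ‖B.sumEquiv x - X₀‖ ≤ R := by
      rw [← dist_eq_norm]
      exact (Metric.mem_ball.1 hx).le
    exact mul_le_mul_of_nonneg_left this (norm_nonneg L)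
  have hm : Measurable B.sumEquiv := B.continuous_sumEquiv.measurable
  have hfp : AEMeasurable (fun X => ‖f X‖ₑ ^ p) (volume : Measure (EuclideanSpace ℝ ι)) :=
    hf.enorm.pow_const p
  have h1 : ∫⁻ X in Metric.ball X₀ R, ‖f X‖ₑ ^ p ≤ c * ∫⁻ x, ‖f (B.sumEquiv x)‖ₑ ^ p
      ∂(Measure.pi fun j => (subspaceMeasure (B.V j)).restrict (Metric.closedBall (x₀ j) ρ)) := by
    have hac : B.piMeasure.map B.sumEquiv ≪ volume := B.quasiMeasurePreserving_sumEquiv.2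
    conv_lhs => rw [hc]
    rw [Measure.restrict_smul, lintegral_smul_measure, smul_eq_mul,
      Measure.restrict_map hm Metric.isOpen_ball.measurableSet, lintegral_map', 
      ← Measure.restrict_pi_pi]
    · exact mul_le_mul_right (lintegral_mono_set hsub) c
    · rw [← Measure.restrict_map hm Metric.isOpen_ball.measurableSet]
      exact (hfp.mono_ac hac).restrict
    · exact hm.aemeasurable
  calc _ ≤ (c * ∫⁻ x, ‖f (B.sumEquiv x)‖ₑ ^ p ∂(Measure.pi fun j =>
          (subspaceMeasure (B.V j)).restrict (Metric.closedBall (x₀ j) ρ))) ^ (1 / p) := by gcongr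
    _ = c ^ (1 / p) * (∫⁻ x, ‖f (B.sumEquiv x)‖ₑ ^ p ∂(Measure.pi fun j =>
          (subspaceMeasure (B.V j)).restrict (Metric.closedBall (x₀ j) ρ))) ^ (1 / p) :=
        ENNReal.mul_rpow_of_nonneg _ _ (by positivity)
    _ ≤ c ^ (1 / p) * (D * B.qnorm f) := by
        gcongr
        rw [qnorm_eq, hD]
        have h := lintegral_pi_rpow_le_iteratedLpNorm hp (μ := fun j => subspaceMeasure (B.V j))
          (fun j => hpB.trans (iInf_le B.p j)) (K := fun j => Metric.closedBall (x₀ j) ρ)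
          (fun j => measure_closedBall_lt_top.ne) (aemeasurable_sumEquiv hf)
        simpa only [Measure.addHaar_closedBall_center] using h
    _ = _ := by ring

end MixedSpace

/-! ### Point evaluations -/

section pointEval

variable {d : ℕ}

/-- The point `(x - iξ)/√2 ∈ ℂ^d` associated with `(x, ξ)`. -/
def bargmannPoint (X : Phase d) : EuclideanSpace ℂ (Fin d) :=
  WithLp.toLp 2 fun i =>
    (((Real.sqrt 2)⁻¹ * X.pos i : ℝ) : ℂ) - Complex.I * (((Real.sqrt 2)⁻¹ * X.freq i : ℝ) : ℂ)

theorem bargmannPullback_eq (F : EuclideanSpace ℂ (Fin d) → ℂ) (X : Phase d) :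
    bargmannPullback F X = (((2 * Real.pi) ^ (-(d : ℝ) / 2) * Real.exp (-‖X‖ ^ 2 / 4) : ℝ) : ℂ) *
      Complex.exp (-Complex.I * ((inner ℝ X.pos X.freq : ℝ) : ℂ) / 2) * F (bargmannPoint X) := rfl

variable (d) in
/-- `bargmannPoint` as an additive isomorphism. -/
def bargmannEquiv : Phase d ≃+ EuclideanSpace ℂ (Fin d) where
  toFun := bargmannPoint
  invFun z := WithLp.toLp 2 (Sum.elim (fun i => Real.sqrt 2 * (z i).re) fun i => -(Real.sqrt 2 * (z i).im))
  left_inv X := by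
    have h : Real.sqrt 2 * (Real.sqrt 2 / 2) = 1 := by
      rw [← mul_div_assoc, Real.mul_self_sqrt (by norm_num), div_self two_ne_zero]
    ext i
    cases i <;> simp [bargmannPoint, Phase.pos, Phase.freq, ← mul_assoc, h]
  right_inv z := by
    ext i
    apply Complex.ext <;> simp [bargmannPoint, Phase.pos, Phase.freq]
  map_add' X Y := by
    ext i
    simp [bargmannPoint, Phase.pos, Phase.freq]
    ring

theorem continuous_pos : Continuous (Phase.pos : Phase d → _) := by
  unfold Phase.pos
  fun_prop

theorem continuous_freq : Continuous (Phase.freq : Phase d → _) := by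
  unfold Phase.freq
  fun_prop

theorem continuous_bargmannPoint : Continuous (bargmannPoint : Phase d → _) := by
  have h1 := continuous_pos (d := d)
  have h2 := continuous_freq (d := d)
  unfold bargmannPoint
  fun_prop

theorem continuous_bargmannEquiv_symm : Continuous (bargmannEquiv d).symm := by
  have : ⇑(bargmannEquiv d).symm = fun z => WithLp.toLp 2
      (Sum.elim (fun i => Real.sqrt 2 * (z i).re) fun i => -(Real.sqrt 2 * (z i).im)) := rfl
  rw [this]
  refine (PiLp.continuous_toLp 2 _).comp (continuous_pi fun i => ?_)
  cases i
  · simp only [Sum.elim_inl]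
    fun_prop
  · simp only [Sum.elim_inr]
    fun_prop

theorem norm_sq_pos_add_freq (X : Phase d) : ‖X‖ ^ 2 = ‖X.pos‖ ^ 2 + ‖X.freq‖ ^ 2 := by
  simp [EuclideanSpace.norm_sq_eq, Phase.pos, Phase.freq]

theorem norm_bargmannPoint_sq (X : Phase d) : ‖bargmannPoint X‖ ^ 2 = ‖X‖ ^ 2 / 2 := by
  rw [norm_sq_pos_add_freq, EuclideanSpace.norm_sq_eq, EuclideanSpace.norm_sq_eq,
    EuclideanSpace.norm_sq_eq, ← Finset.sum_add_distrib, Finset.sum_div]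
  refine Finset.sum_congr rfl fun i _ => ?_
  rw [Complex.sq_norm, Complex.normSq_apply]
  simp only [bargmannPoint, Complex.sub_re, Complex.ofReal_re, Complex.mul_re, Complex.I_re,
    Complex.I_im, Complex.ofReal_im, Complex.sub_im, Complex.mul_im, Real.norm_eq_abs, sq_abs]
  have h : (Real.sqrt 2)⁻¹ * (Real.sqrt 2)⁻¹ = 1 / 2 := by
    rw [← mul_inv, Real.mul_self_sqrt (by norm_num)]
    norm_num
  linear_combination (X.pos i ^ 2 + X.freq i ^ 2) * h

theorem norm_bargmannPullback (F : EuclideanSpace ℂ (Fin d) → ℂ) (X : Phase d) :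
    ‖bargmannPullback F X‖ =
      (2 * Real.pi) ^ (-(d : ℝ) / 2) * Real.exp (-‖X‖ ^ 2 / 4) * ‖F (bargmannPoint X)‖ := by
  rw [bargmannPullback_eq, norm_mul, norm_mul, Complex.norm_real,
    Real.norm_of_nonneg (by positivity)]
  have : -Complex.I * ((inner ℝ X.pos X.freq : ℝ) : ℂ) / 2 =
      ((-(inner ℝ X.pos X.freq : ℝ) / 2 : ℝ) : ℂ) * Complex.I := by
    push_cast
    ring
  rw [this, Complex.norm_exp_ofReal_mul_I, mul_one]

theorem continuous_bargmannPullback {F : EuclideanSpace ℂ (Fin d) → ℂ} (hF : Continuous F) :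
    Continuous (bargmannPullback F) := by
  have h1 := continuous_pos (d := d)
  have h2 := continuous_freq (d := d)
  have h3 := continuous_bargmannPoint (d := d)
  have : bargmannPullback F = _ := funext (bargmannPullback_eq F)
  rw [this]
  fun_prop

/-- The mean value inequality is applied to `F` and then converted to `U⁻¹F`. The Gaussian factor
changes by at most `e^{|X₀|+1}` between `X₀` and the ball of radius 2, and inserting the weight
costs `1 / m`. The form with a free `m` serves two purposes: a constant on compact sets for entire
functions, and Gaussian lower bounds for distributions. -/
theorem exists_enorm_bargmannPullback_le (B : MixedSpace (Fin d ⊕ Fin d)) :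
    ∃ C : ℝ≥0∞, C ≠ ∞ ∧ ∀ (F : EuclideanSpace ℂ (Fin d) → ℂ) (ω : Phase d → ℝ) (X₀ : Phase d)
      (m : ℝ), CircleMean F → AEMeasurable ω → 0 < m → (∀ X ∈ Metric.closedBall X₀ 2, m ≤ ω X) →
      ‖bargmannPullback F X₀‖ₑ ≤ C * ENNReal.ofReal (Real.exp (‖X₀‖ + 1) / m) *
        B.qnorm fun X => bargmannPullback F X * (ω X : ℂ) := by
  -- The bound by `1` is for the mean value inequality, the bound by `nu1` for Hölder's inequality.
  set P : ℝ≥0∞ := min 1 B.nu1 with hP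
  have hP0 : 0 < P := lt_min one_pos B.nu1_pos
  have hPt : P ≠ ∞ := ((min_le_left _ _).trans_lt ENNReal.one_lt_top).ne
  set p : ℝ := P.toReal with hp
  have hp0 : 0 < p := ENNReal.toReal_pos hP0.ne' hPt
  have hp1 : p ≤ 1 := by
    have := ENNReal.toReal_mono ENNReal.one_ne_top (min_le_left 1 B.nu1)
    simpa using this
  have hpB : ENNReal.ofReal p ≤ B.nu1 := by
    rw [hp, ENNReal.ofReal_toReal hPt]
    exact min_le_right _ _
  have hT : ⇑(bargmannEquiv d) = bargmannPoint := rfl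
  -- The image of Lebesgue measure is a Haar measure on `ℂ^d`; using it directly avoids computing a
  -- Jacobian.
  set μ : Measure (EuclideanSpace ℂ (Fin d)) := (volume : Measure (Phase d)).map bargmannPoint
  have hμ : μ.IsAddHaarMeasure := (bargmannEquiv d).isAddHaarMeasure_map _
    continuous_bargmannPoint continuous_bargmannEquiv_symm
  obtain ⟨C₁, hC₁, h₁⟩ := CircleMean.enorm_rpow_le μ hp0 hp1
  obtain ⟨C₂, hC₂, h₂⟩ := MixedSpace.lintegral_ball_le_qnorm (B := B) hp0 hpB 2
  refine ⟨C₁ ^ (1 / p) * C₂,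
    ENNReal.mul_ne_top (ENNReal.rpow_ne_top_of_nonneg (by positivity) hC₁) hC₂,
    fun F ω X₀ m hF hω hm hmω => ?_⟩
  set H := bargmannPullback F with hH
  set κ : ℝ := (2 * Real.pi) ^ (-(d : ℝ) / 2) with hκ
  have hκ0 : 0 < κ := by positivity
  have hFc := hF.continuous
  have hmeas : AEMeasurable fun X => H X * (ω X : ℂ) :=
    (continuous_bargmannPullback hFc).measurable.aemeasurable.mul
      (Complex.measurable_ofReal.comp_aemeasurable hω)
  set Q := ∫⁻ X in Metric.ball X₀ 2, ‖H X * (ω X : ℂ)‖ₑ ^ p with hQ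
  -- the local bound for `F`
  have e1 : ‖F (bargmannPoint X₀)‖ₑ ^ p ≤
      C₁ * ∫⁻ X in Metric.ball X₀ 2, ‖F (bargmannPoint X)‖ₑ ^ p := by
    refine (h₁ F hF (bargmannPoint X₀)).trans ?_
    gcongr
    have hm' : Measurable fun w => ‖F (bargmannPoint X₀ + w)‖ₑ ^ p :=
      Measurable.pow_const (Continuous.measurable (by fun_prop)) _
    have hadd : ∀ X, bargmannPoint X₀ + bargmannPoint X = bargmannPoint (X₀ + X) := fun X =>
      ((bargmannEquiv d).map_add X₀ X).symm
    rw [Measure.restrict_map continuous_bargmannPoint.measurable Metric.isOpen_ball.measurableSet,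
      lintegral_map hm' continuous_bargmannPoint.measurable]
    simp only [hadd]
    -- The map shrinks norms by `√2`, so the preimage of the unit ball has radius `√2 < 2`.
    have hsub : bargmannPoint ⁻¹' Metric.ball (0 : EuclideanSpace ℂ (Fin d)) 1 ⊆
        (fun X => X₀ + X) ⁻¹' Metric.ball X₀ 2 := by
      intro X hX
      have h1 : ‖bargmannPoint X‖ < 1 := by simpa using hX
      have h2 := norm_bargmannPoint_sq X
      have h3 : ‖X‖ < 2 := by nlinarith [norm_nonneg X, norm_nonneg (bargmannPoint X)]
      simpa using h3
    refine (lintegral_mono_set hsub).trans (le_of_eq ?_)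
    have hpres := (measurePreserving_add_left (volume : Measure (Phase d)) X₀).restrict_preimage
      (Metric.isOpen_ball (x := X₀) (ε := 2)).measurableSet
    refine hpres.lintegral_comp (f := fun X => ‖F (bargmannPoint X)‖ₑ ^ p) ?_
    have := continuous_bargmannPoint (d := d)
    exact Measurable.pow_const (Continuous.measurable (by fun_prop)) _
  set b : ℝ := κ⁻¹ * Real.exp ((‖X₀‖ + 2) ^ 2 / 4) / m with hb
  have hb0 : 0 < b := by positivity
  have e2 : ∫⁻ X in Metric.ball X₀ 2, ‖F (bargmannPoint X)‖ₑ ^ p ≤ ENNReal.ofReal b ^ p * Q := by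
    rw [hQ, ← lintegral_const_mul' _ _ (by simp [hp0.le])]
    refine setLIntegral_mono_ae' Metric.isOpen_ball.measurableSet (ae_of_all _ fun X hX => ?_)
    rw [← ENNReal.mul_rpow_of_nonneg _ _ hp0.le]
    gcongr
    rw [← ofReal_norm, ← ofReal_norm, ← ENNReal.ofReal_mul hb0.le]
    refine ENNReal.ofReal_le_ofReal ?_
    have hX' : ‖X‖ ≤ ‖X₀‖ + 2 := by
      have h1 : ‖X - X₀‖ < 2 := by simpa [dist_eq_norm] using hX
      have h2 := norm_le_norm_add_norm_sub' X X₀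
      linarith
    have hω' := hmω X (Metric.ball_subset_closedBall hX)
    rw [norm_mul, hH, norm_bargmannPullback, Complex.norm_real, Real.norm_of_nonneg (hm.le.trans hω')]
    have h3 : 1 ≤ Real.exp ((‖X₀‖ + 2) ^ 2 / 4) * Real.exp (-‖X‖ ^ 2 / 4) := by
      rw [← Real.exp_add]
      refine Real.one_le_exp ?_
      have := pow_le_pow_left₀ (norm_nonneg X) hX' 2
      linarith
    calc ‖F (bargmannPoint X)‖ = 1 * ‖F (bargmannPoint X)‖ * 1 := by ring
      _ ≤ (Real.exp ((‖X₀‖ + 2) ^ 2 / 4) * Real.exp (-‖X‖ ^ 2 / 4)) * ‖F (bargmannPoint X)‖ *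
          (m⁻¹ * ω X) := by
          gcongr
          rw [inv_mul_eq_div, one_le_div hm]
          exact hω'
      _ = _ := by
          rw [hb, ← hκ]
          field_simp
  have e3 : ‖F (bargmannPoint X₀)‖ₑ ≤ C₁ ^ (1 / p) * (ENNReal.ofReal b * Q ^ (1 / p)) := by
    have h := ENNReal.rpow_le_rpow (e1.trans (mul_le_mul_right e2 C₁)) (z := 1 / p) (by positivity)
    rw [ENNReal.mul_rpow_of_nonneg _ _ (by positivity), ENNReal.mul_rpow_of_nonneg _ _ (by positivity),
      ← ENNReal.rpow_mul, ← ENNReal.rpow_mul, mul_one_div_cancel hp0.ne', ENNReal.rpow_one,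
      ENNReal.rpow_one] at h
    exact h
  have e4 : ‖H X₀‖ₑ = ENNReal.ofReal (κ * Real.exp (-‖X₀‖ ^ 2 / 4)) * ‖F (bargmannPoint X₀)‖ₑ := by
    rw [← ofReal_norm, ← ofReal_norm, hH, norm_bargmannPullback, ENNReal.ofReal_mul (by positivity)]
  -- The quadratic exponents cancel: `(|X₀| + 2)² / 4 - |X₀|² / 4 = |X₀| + 1`.
  have e5 : κ * Real.exp (-‖X₀‖ ^ 2 / 4) * b = Real.exp (‖X₀‖ + 1) / m := by
    have : Real.exp (‖X₀‖ + 1) = Real.exp (-‖X₀‖ ^ 2 / 4) * Real.exp ((‖X₀‖ + 2) ^ 2 / 4) := by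
      rw [← Real.exp_add]
      congr 1
      ring
    rw [this, hb]
    field_simp
  calc ‖H X₀‖ₑ ≤ ENNReal.ofReal (κ * Real.exp (-‖X₀‖ ^ 2 / 4)) *
        (C₁ ^ (1 / p) * (ENNReal.ofReal b * Q ^ (1 / p))) := by rw [e4]; gcongr
    _ = C₁ ^ (1 / p) * ENNReal.ofReal (Real.exp (‖X₀‖ + 1) / m) * Q ^ (1 / p) := by
        rw [← e5, ENNReal.ofReal_mul (q := b) (by positivity)]
        ring
    _ ≤ C₁ ^ (1 / p) * ENNReal.ofReal (Real.exp (‖X₀‖ + 1) / m) *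
        (C₂ * B.qnorm fun X => H X * (ω X : ℂ)) := by
        gcongr
        exact h₂ _ X₀ hmeas
    _ = _ := by ring

end pointEval

/-! ### Completeness from point evaluations -/

section completeness

variable {d : ℕ}

/-- A space with the quasi-norm `‖L f · ω‖_ℬ` is complete as soon as Cauchy sequences have limits
for which the functions `L (u k)` converge pointwise. -/
theorem isCompleteQuasiNormed_of_pointwise_limits {X : Type} [AddCommGroup X] [Module ℂ X]
    {S : Set X} (S₀ : Submodule ℂ X) (L : X →ₗ[ℂ] (Phase d → ℂ)) {ω : Phase d → ℝ}
    (hω : AEMeasurable ω) {B : MixedSpace (Fin d ⊕ Fin d)} {N : X → ℝ≥0∞}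
    (hN : ∀ f, N f = B.qnorm fun Y => L f Y * (ω Y : ℂ)) (hS : ∀ f, f ∈ S ↔ f ∈ S₀ ∧ N f < ∞)
    (hL : ∀ f ∈ S₀, AEMeasurable (L f)) (hdef : ∀ f ∈ S₀, N f = 0 → f = 0)
    (hlim : ∀ u : ℕ → X, (∀ k, u k ∈ S₀) →
      (∀ ε : ℝ≥0∞, 0 < ε → ∃ k₀, ∀ k ≥ k₀, ∀ l ≥ k₀, N (u k - u l) < ε) →
      ∃ f ∈ S₀, ∀ Y, Filter.Tendsto (fun k => L (u k) Y) Filter.atTop (nhds (L f Y)))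
    {K : ℝ≥0} (hK : B.quasiConst = K) : IsCompleteQuasiNormed S N K := by
  have hsm : ∀ (a : ℂ) f, N (a • f) = ‖a‖ₑ * N f := fun a f => by
    rw [hN, hN, ← MixedSpace.qnorm_const_mul]
    congr 1
    funext Y
    simp [mul_assoc]
  have hmeas : ∀ f ∈ S₀, AEMeasurable fun Y => L f Y * (ω Y : ℂ) := fun f hf =>
    (hL f hf).mul (Complex.measurable_ofReal.comp_aemeasurable hω)
  have hadd : ∀ f ∈ S₀, ∀ g ∈ S₀, N (f + g) ≤ K * (N f + N g) := fun f hf g hg => by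
    rw [hN, hN, hN, ← hK]
    refine le_trans (le_of_eq ?_) (MixedSpace.qnorm_add_le (hmeas f hf) (hmeas g hg))
    congr 1
    funext Y
    simp [add_mul]
  have h0 : N 0 = 0 := by simpa using hsm 0 0
  have hlt : ∀ {a b : ℝ≥0∞}, a < ∞ → b < ∞ → (K : ℝ≥0∞) * (a + b) < ∞ := fun ha hb =>
    ENNReal.mul_lt_top ENNReal.coe_lt_top (ENNReal.add_lt_top.2 ⟨ha, hb⟩)
  refine ⟨?_, ?_, ?_, ?_, ?_, ?_, ?_, ?_⟩
  · exact (hS 0).2 ⟨S₀.zero_mem, by simp [h0]⟩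
  · intro f hf g hg
    rw [hS] at hf hg ⊢
    exact ⟨S₀.add_mem hf.1 hg.1, (hadd f hf.1 g hg.1).trans_lt (hlt hf.2 hg.2)⟩
  · intro a f hf
    rw [hS] at hf ⊢
    exact ⟨S₀.smul_mem a hf.1, by rw [hsm]; exact ENNReal.mul_lt_top enorm_lt_top hf.2⟩
  · exact fun f hf => ((hS f).1 hf).2
  · exact fun f hf => ⟨hdef f ((hS f).1 hf).1, fun h => by rw [h, h0]⟩
  · exact fun a f _ => hsm a f
  · exact fun f hf g hg => hadd f ((hS f).1 hf).1 g ((hS g).1 hg).1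
  · intro u hu hc
    have hu₀ : ∀ k, u k ∈ S₀ := fun k => ((hS _).1 (hu k)).1
    obtain ⟨f, hf, hfl⟩ := hlim u hu₀ hc
    -- Fix `k` and let `l` tend to infinity: `L (u k - u l)` tends pointwise to `L (u k - f)`, and
    -- Fatou applies. No subsequence is needed.
    have key : ∀ ε : ℝ≥0∞, 0 < ε → ∃ k₀, ∀ k ≥ k₀, N (u k - f) ≤ ε := by
      intro ε hε
      obtain ⟨k₀, hk₀⟩ := hc ε hε
      refine ⟨k₀, fun k hk => ?_⟩
      have h1 : N (u k - f) ≤ Filter.liminf (fun l => N (u k - u l)) Filter.atTop := by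
        simp only [hN]
        refine MixedSpace.qnorm_le_liminf (fun l => hmeas _ (S₀.sub_mem (hu₀ k) (hu₀ l)))
          fun Y => ?_
        simp only [map_sub, Pi.sub_apply]
        exact (tendsto_const_nhds.sub (hfl Y)).mul_const _
      refine h1.trans (Filter.liminf_le_of_frequently_le' ?_)
      exact Filter.Eventually.frequently
        (Filter.eventually_atTop.2 ⟨k₀, fun l hl => (hk₀ k hk l hl).le⟩)
    refine ⟨f, (hS f).2 ⟨hf, ?_⟩, ?_⟩
    · obtain ⟨k₀, hk₀⟩ := key 1 one_pos
      have h1 := hk₀ k₀ le_rfl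
      -- Finiteness of `N f` comes from writing `f` as `u k₀` minus `u k₀ - f`.
      have h2 : N ((-1 : ℂ) • (u k₀ - f)) < ∞ := by
        rw [hsm]
        exact ENNReal.mul_lt_top enorm_lt_top (h1.trans_lt ENNReal.one_lt_top)
      have h3 := hadd (u k₀) (hu₀ k₀) ((-1 : ℂ) • (u k₀ - f))
        (S₀.smul_mem _ (S₀.sub_mem (hu₀ k₀) hf))
      have e : u k₀ + (-1 : ℂ) • (u k₀ - f) = f := by
        rw [neg_one_smul]
        abel
      rw [e] at h3
      exact h3.trans_lt (hlt ((hS _).1 (hu k₀)).2 h2)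
    · rw [ENNReal.tendsto_atTop_zero]
      exact key

end completeness

/-! ### The spaces of entire functions -/

section entire

variable {d : ℕ}

/-- Pointwise limits of locally uniformly Cauchy sequences of entire functions are entire. -/
theorem differentiable_of_locally_uniform_cauchy {E : Type*} [NormedAddCommGroup E]
    [NormedSpace ℂ E] {f : ℕ → E → ℂ} {g : E → ℂ} (hf : ∀ k, Differentiable ℂ (f k))
    (hc : ∀ z₀ : E, ∀ ε > 0, ∃ k₀, ∀ k ≥ k₀, ∀ l ≥ k₀, ∀ z ∈ Metric.ball z₀ 2,
      ‖f k z - f l z‖ ≤ ε)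
    (hg : ∀ z, Filter.Tendsto (fun k => f k z) Filter.atTop (nhds (g z))) : Differentiable ℂ g := by
  intro z₀
  -- Cauchy's estimate on unit balls centred in `ball z₀ 1`; these stay inside `ball z₀ 2`, where
  -- the functions are uniformly close. The oscillation of the difference is at most `2 ε / 3`.
  have hder : ∀ ε > 0, ∃ k₀, ∀ k ≥ k₀, ∀ l ≥ k₀, ∀ z ∈ Metric.ball z₀ 1,
      ‖fderiv ℂ (f k) z - fderiv ℂ (f l) z‖ ≤ ε := by
    intro ε hε
    obtain ⟨k₀, hk₀⟩ := hc z₀ (ε / 3) (by positivity)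
    refine ⟨k₀, fun k hk l hl z hz => ?_⟩
    have hd : Differentiable ℂ (f k - f l) := (hf k).sub (hf l)
    rw [← fderiv_sub (hf k z) (hf l z)]
    have hm : ∀ w ∈ Metric.ball z 1, ‖f k w - f l w‖ ≤ ε / 3 := fun w hw =>
      hk₀ k hk l hl w (Metric.ball_subset_ball' (by
        have := Metric.mem_ball.1 hz
        linarith) hw)
    have h := Complex.norm_fderiv_le_div_of_mapsTo_ball (f := f k - f l) (c := z) (R₁ := 1)
      (R₂ := ε) hd.differentiableOn (fun w hw => by
        rw [Metric.mem_closedBall, dist_eq_norm]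
        have h1 := hm w hw
        have h2 := hm z (Metric.mem_ball_self one_pos)
        have h3 := norm_sub_le ((f k - f l) w) ((f k - f l) z)
        simp only [Pi.sub_apply] at h3 ⊢
        linarith) one_pos
    simpa using h
  have hcs : UniformCauchySeqOn (fun k => fderiv ℂ (f k)) Filter.atTop (Metric.ball z₀ 1) := by
    rw [Metric.uniformCauchySeqOn_iff]
    intro ε hε
    obtain ⟨k₀, hk₀⟩ := hder (ε / 2) (by positivity)
    refine ⟨k₀, fun k hk l hl z hz => ?_⟩
    rw [dist_eq_norm]
    linarith [hk₀ k hk l hl z hz]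
  have hex : ∀ z ∈ Metric.ball z₀ 1, ∃ A, Filter.Tendsto (fun k => fderiv ℂ (f k) z)
      Filter.atTop (nhds A) := fun z hz => cauchySeq_tendsto_of_complete (hcs.cauchySeq hz)
  choose! g' hg' using hex
  -- Derivatives converging uniformly and values converging pointwise make the limit complex
  -- differentiable.
  have := hasFDerivAt_of_tendstoUniformlyOn (Metric.isOpen_ball (x := z₀) (ε := 1))
    (hcs.tendstoUniformlyOn_of_tendsto hg') (fun k z _ => (hf k z).hasFDerivAt)
    (fun z _ => hg z) (Metric.mem_ball_self one_pos)
  exact this.differentiableAt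

variable (d) in
/-- `bargmannPullback` as a linear map. -/
def bargmannPullbackₗ : (EuclideanSpace ℂ (Fin d) → ℂ) →ₗ[ℂ] (Phase d → ℂ) where
  toFun := bargmannPullback
  map_add' F G := by
    funext X
    simp [bargmannPullback, mul_add]
  map_smul' a F := by
    funext X
    simp only [bargmannPullback, Pi.smul_apply, smul_eq_mul, RingHom.id_apply]
    ring

/-- On compact sets `|F|` is bounded by a constant times the quasi-norm. Definiteness follows at
once, and Cauchy sequences converge locally uniformly, hence to an entire function. -/
theorem analNorm_complete {ω : Phase d → ℝ} (hω : WeightPQ ω) (B : MixedSpace (Fin d ⊕ Fin d))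
    {K : ℝ≥0} (hK : B.quasiConst = K) :
    IsCompleteQuasiNormed (analSpace ω B) (analNorm ω B) K := by
  have hωm := hω.isWeight.aemeasurable
  obtain ⟨C, hC, hpt⟩ := exists_enorm_bargmannPullback_le B
  -- bounds on compact sets
  have hloc : ∀ R : ℝ, ∃ D : ℝ≥0∞, D ≠ ∞ ∧ ∀ F : EuclideanSpace ℂ (Fin d) → ℂ,
      Differentiable ℂ F → ∀ X : Phase d, ‖X‖ ≤ R →
        ‖F (bargmannPoint X)‖ₑ ≤ D * analNorm ω B F := by
    intro R
    obtain ⟨m, hm, hmω⟩ := hω.isWeight.locally_bounded_below _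
      (isCompact_closedBall (0 : Phase d) (R + 2))
    set κ : ℝ := (2 * Real.pi) ^ (-(d : ℝ) / 2) * Real.exp (-R ^ 2 / 4) with hκ
    have hκ0 : 0 < κ := by positivity
    refine ⟨ENNReal.ofReal κ⁻¹ * (C * ENNReal.ofReal (Real.exp (R + 1) / m)),
      ENNReal.mul_ne_top ENNReal.ofReal_ne_top (ENNReal.mul_ne_top hC ENNReal.ofReal_ne_top),
      fun F hF X hX => ?_⟩
    have h := hpt F ω X m hF.circleMean hωm hm fun Y hY => hmω Y (by
      have h1 := norm_le_norm_add_norm_sub' Y X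
      rw [Metric.mem_closedBall, dist_eq_norm] at hY
      rw [Metric.mem_closedBall, dist_zero_right]
      linarith)
    have h2 : ‖F (bargmannPoint X)‖ ≤ κ⁻¹ * ‖bargmannPullback F X‖ := by
      rw [norm_bargmannPullback, inv_mul_eq_div, le_div_iff₀ hκ0, mul_comm]
      gcongr
      rw [hκ]
      gcongr
    rw [mul_assoc]
    calc ‖F (bargmannPoint X)‖ₑ ≤ ENNReal.ofReal κ⁻¹ * ‖bargmannPullback F X‖ₑ := by
          rw [← ofReal_norm, ← ofReal_norm, ← ENNReal.ofReal_mul (by positivity)]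
          exact ENNReal.ofReal_le_ofReal h2
      _ ≤ ENNReal.ofReal κ⁻¹ * (C * ENNReal.ofReal (Real.exp (R + 1) / m) * analNorm ω B F) := by
          gcongr
          refine h.trans ?_
          unfold analNorm
          gcongr
  have hsurj : ∀ z : EuclideanSpace ℂ (Fin d), ∃ X : Phase d, bargmannPoint X = z ∧
      ‖X‖ ≤ 2 * ‖z‖ := fun z => by
    obtain ⟨X, rfl⟩ := (bargmannEquiv d).surjective z
    refine ⟨X, rfl, ?_⟩
    have h := norm_bargmannPoint_sq X
    change ‖X‖ ≤ 2 * ‖bargmannPoint X‖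
    nlinarith [norm_nonneg X, norm_nonneg (bargmannPoint X)]
  have hlocz : ∀ R : ℝ, ∃ D : ℝ≥0∞, D ≠ ∞ ∧ ∀ F : EuclideanSpace ℂ (Fin d) → ℂ,
      Differentiable ℂ F → ∀ z, ‖z‖ ≤ R → ‖F z‖ₑ ≤ D * analNorm ω B F := fun R => by
    obtain ⟨D, hD, h⟩ := hloc (2 * R)
    refine ⟨D, hD, fun F hF z hz => ?_⟩
    obtain ⟨X, rfl, hX⟩ := hsurj z
    exact h F hF X (by linarith)
  let S₀ : Submodule ℂ (EuclideanSpace ℂ (Fin d) → ℂ) :=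
    { carrier := {F | Differentiable ℂ F}
      add_mem' := fun hF hG => Differentiable.add hF hG
      zero_mem' := differentiable_const 0
      smul_mem' := fun a F hF => Differentiable.const_smul hF a }
  refine isCompleteQuasiNormed_of_pointwise_limits S₀ (bargmannPullbackₗ d) hωm (N := analNorm ω B)
    (fun F => rfl)
    (fun F => Iff.rfl) ?_ ?_ ?_ hK
  · exact fun F hF => (continuous_bargmannPullback (Differentiable.continuous hF)).aemeasurable
  · intro F hF h0
    funext z
    obtain ⟨D, -, h⟩ := hlocz ‖z‖
    have := h F hF z le_rfl
    rw [h0, mul_zero] at this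
    simpa using this
  · intro u hu hc
    have hcau : ∀ (R ε : ℝ), 0 < ε → ∃ k₀, ∀ k ≥ k₀, ∀ l ≥ k₀, ∀ z, ‖z‖ ≤ R →
        ‖u k z - u l z‖ ≤ ε := by
      intro R ε hε
      obtain ⟨D, hD, h⟩ := hlocz R
      -- The `+ 1` avoids a division by zero, since `D` may vanish.
      have hδ : 0 < ENNReal.ofReal ε / (D + 1) :=
        ENNReal.div_pos (by simpa using hε) (by simp [hD])
      obtain ⟨k₀, hk₀⟩ := hc _ hδ
      refine ⟨k₀, fun k hk l hl z hz => ?_⟩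
      have h1 := h (u k - u l) (Differentiable.sub (hu k) (hu l)) z hz
      have h2 : ‖(u k - u l) z‖ₑ ≤ ENNReal.ofReal ε := by
        calc _ ≤ D * analNorm ω B (u k - u l) := h1
          _ ≤ (D + 1) * (ENNReal.ofReal ε / (D + 1)) := by
              gcongr
              · exact le_self_add
              · exact (hk₀ k hk l hl).le
          _ ≤ _ := ENNReal.mul_div_le
      rw [← ofReal_norm] at h2
      exact (ENNReal.ofReal_le_ofReal_iff hε.le).1 h2
    have hex : ∀ z, ∃ a, Filter.Tendsto (fun k => u k z) Filter.atTop (nhds a) := fun z => by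
      refine cauchySeq_tendsto_of_complete (Metric.cauchySeq_iff.2 fun ε hε => ?_)
      obtain ⟨k₀, hk₀⟩ := hcau ‖z‖ (ε / 2) (by positivity)
      refine ⟨k₀, fun k hk l hl => ?_⟩
      rw [dist_eq_norm]
      linarith [hk₀ k hk l hl z le_rfl]
    choose F hF using hex
    refine ⟨F, differentiable_of_locally_uniform_cauchy hu (fun z₀ ε hε => ?_) hF, fun Y => ?_⟩
    · obtain ⟨k₀, hk₀⟩ := hcau (‖z₀‖ + 2) ε hε
      refine ⟨k₀, fun k hk l hl z hz => hk₀ k hk l hl z ?_⟩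
      have h1 := norm_le_norm_add_norm_sub' z z₀
      rw [Metric.mem_ball, dist_eq_norm] at hz
      linarith
    · exact (hF (bargmannPoint Y)).const_mul _

end entire

/-! ### Gelfand–Shilov functions as bounded families -/

section lpInfty

variable {ι : Type*} {E : Type*} [NormedAddCommGroup E] [NormedSpace ℂ E]
  {Ψ : E → lp (fun _ : ι => ℂ) ∞}

/-- A locally bounded `ℓ^∞`-valued map with entire coordinates is continuous. -/
theorem continuous_of_differentiable_coord (hd : ∀ k, Differentiable ℂ fun z => Ψ z k)
    (hb : ∀ z₀, ∃ M : ℝ, ∀ z ∈ Metric.ball z₀ 1, ‖Ψ z‖ ≤ M) : Continuous Ψ := by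
  rw [continuous_iff_continuousAt]
  intro z₀
  obtain ⟨M, hM⟩ := hb z₀
  have hM0 : 0 ≤ M := (norm_nonneg _).trans (hM z₀ (Metric.mem_ball_self one_pos))
  -- The Schwarz lemma in each coordinate gives a Lipschitz constant at `z₀` that does not depend on
  -- the coordinate, hence a bound in the sup norm.
  have hlip : ∀ z ∈ Metric.ball z₀ 1, ‖Ψ z - Ψ z₀‖ ≤ 2 * M * dist z z₀ := by
    intro z hz
    refine lp.norm_le_of_forall_le (by positivity) fun k => ?_
    have h := Complex.dist_le_div_mul_dist_of_mapsTo_ball (f := fun z => Ψ z k) (c := z₀)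
      (R₁ := 1) (R₂ := 2 * M) (hd k).differentiableOn (fun w hw => by
        rw [Metric.mem_closedBall, dist_eq_norm]
        have h1 := (lp.norm_apply_le_norm ENNReal.top_ne_zero (Ψ w) k).trans (hM w hw)
        have h2 := (lp.norm_apply_le_norm ENNReal.top_ne_zero (Ψ z₀) k).trans
          (hM z₀ (Metric.mem_ball_self one_pos))
        linarith [norm_sub_le (Ψ w k) (Ψ z₀ k)]) hz
    rw [dist_eq_norm, div_one] at h
    exact h
  rw [ContinuousAt, tendsto_iff_norm_sub_tendsto_zero]
  refine squeeze_zero' (Filter.Eventually.of_forall fun _ => norm_nonneg _)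
    (Filter.eventually_of_mem (Metric.ball_mem_nhds z₀ one_pos) hlip) ?_
  have : Filter.Tendsto (fun z => 2 * M * dist z z₀) (nhds z₀) (nhds (2 * M * dist z₀ z₀)) :=
    Continuous.tendsto (by fun_prop) z₀
  simpa using this

/-- The mean value identity is an equality of Bochner integrals in `ℓ^∞`: it can be checked in each
coordinate, where it holds for entire functions, and it is preserved by continuous linear forms.
Holomorphy of the composite is thereby not needed. -/
theorem circleMean_clm_comp (hd : ∀ k, Differentiable ℂ fun z => Ψ z k) (hc : Continuous Ψ)
    (g : lp (fun _ : ι => ℂ) ∞ →L[ℂ] ℂ) : CircleMean fun z => g (Ψ z) := by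
  refine ⟨g.continuous.comp hc, fun z w => ?_⟩
  have hint : IntervalIntegrable
      (fun θ : ℝ => Ψ (z + Complex.exp (θ * Complex.I) • w)) volume 0 (2 * Real.pi) :=
    Continuous.intervalIntegrable (by fun_prop) _ _
  have e : Ψ z = (2 * Real.pi)⁻¹ •
      ∫ θ in (0 : ℝ)..2 * Real.pi, Ψ (z + Complex.exp (θ * Complex.I) • w) := by
    ext k
    have h1 := (lp.evalCLM ℂ (fun _ : ι => ℂ) ∞ k).intervalIntegral_comp_comm hint
    have h2 := (hd k).circleMean.mean z w
    rw [h2, lp.coeFn_smul, Pi.smul_apply]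
    congr 1
  have h3 := g.intervalIntegral_comp_comm hint
  conv_lhs => rw [e]
  rw [h3]
  exact g.map_smul_of_tower _ _

end lpInfty

/-! ### The spaces `𝒮_{1/2,h}` inside `ℓ^∞`. -/

section coordinates

variable {d : ℕ}

variable (d) in
/-- The index set of the family of all `x^β ∂^α φ(x)`. -/
abbrev GSIndex : Type := (Fin d → ℕ) × (Fin d → ℕ) × EuclideanSpace ℝ (Fin d)

/-- The number `x^β ∂^α φ(x) / (h^{|α|+|β|} (α! β!)^{1/2})`. -/
def gsCoord (h : ℝ) (φ : EuclideanSpace ℝ (Fin d) → ℂ) (k : GSIndex d) : ℂ :=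
  ((∏ i, k.2.2 i ^ k.2.1 i : ℝ) : ℂ) * multiD k.1 φ k.2.2 /
    ((gsDenom (1 / 2) h k.1 k.2.1 : ℝ) : ℂ)

theorem norm_gsCoord {h : ℝ} (hh : 0 < h) (φ : EuclideanSpace ℝ (Fin d) → ℂ) (k : GSIndex d) :
    ‖gsCoord h φ k‖ = |∏ i, k.2.2 i ^ k.2.1 i| * ‖multiD k.1 φ k.2.2‖ /
      gsDenom (1 / 2) h k.1 k.2.1 := by
  rw [gsCoord, norm_div, norm_mul, Complex.norm_real, Complex.norm_real, Real.norm_eq_abs,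
    Real.norm_of_nonneg (gsDenom_pos hh _ _).le]

theorem norm_gsCoord_le {h : ℝ} (hh : 0 < h) {φ : EuclideanSpace ℝ (Fin d) → ℂ}
    (hφ : gsNorm (1 / 2) h φ < ∞) (k : GSIndex d) :
    ‖gsCoord h φ k‖ ≤ (gsNorm (1 / 2) h φ).toReal := by
  rw [norm_gsCoord hh]
  refine (ENNReal.ofReal_le_iff_le_toReal hφ.ne).1 ?_
  exact le_iSup_of_le k.1 (le_iSup_of_le k.2.1 (le_iSup_of_le k.2.2 le_rfl))

theorem gsNorm_le_ofReal {h C : ℝ} (hh : 0 < h) {φ : EuclideanSpace ℝ (Fin d) → ℂ}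
    (hφ : ∀ k, ‖gsCoord h φ k‖ ≤ C) : gsNorm (1 / 2) h φ ≤ ENNReal.ofReal C := by
  refine iSup_le fun α => iSup_le fun β => iSup_le fun x => ENNReal.ofReal_le_ofReal ?_
  have := hφ (α, β, x)
  rwa [norm_gsCoord hh] at this

theorem multiD_comb (α : Fin d → ℕ) {f g : EuclideanSpace ℝ (Fin d) → ℂ}
    (hf : ContDiff ℝ (⊤ : ℕ∞) f) (hg : ContDiff ℝ (⊤ : ℕ∞) g) (a : ℂ) :
    multiD α (f + a • g) = multiD α f + a • multiD α g := listD_comb α _ hf hg a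

theorem gsCoord_comb (h : ℝ) {f g : EuclideanSpace ℝ (Fin d) → ℂ}
    (hf : ContDiff ℝ (⊤ : ℕ∞) f) (hg : ContDiff ℝ (⊤ : ℕ∞) g) (a : ℂ) (k : GSIndex d) :
    gsCoord h (f + a • g) k = gsCoord h f k + a * gsCoord h g k := by
  simp only [gsCoord, multiD_comb _ hf hg, Pi.add_apply, Pi.smul_apply, smul_eq_mul]
  ring

theorem listD_const_zero (l : List (Fin d)) (f : EuclideanSpace ℝ (Fin d) → ℂ) :
    listD 0 l f = f := by
  induction l with
  | nil => rfl
  | cons i l ih => exact ih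

theorem multiD_const_zero (f : EuclideanSpace ℝ (Fin d) → ℂ) : multiD 0 f = f :=
  listD_const_zero _ f

theorem gsCoord_zero_zero (h : ℝ) (f : EuclideanSpace ℝ (Fin d) → ℂ)
    (y : EuclideanSpace ℝ (Fin d)) : gsCoord h f (0, 0, y) = f y := by
  simp [gsCoord, multiD_const_zero, gsDenom]

variable (d) in
/-- The space `𝒮_{1/2,h}` as a subspace of `𝒮_{1/2}`. -/
def gsSub {h : ℝ} (hh : 0 < h) : Submodule ℂ (GelfandShilov d (1 / 2)) where
  carrier := {φ | gsNorm (1 / 2) h (φ : EuclideanSpace ℝ (Fin d) → ℂ) < ∞}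
  zero_mem' := by
    refine (gsNorm_le_ofReal hh (C := 0) fun k => ?_).trans_lt ENNReal.ofReal_lt_top
    simp [gsCoord, multiD_zero]
  add_mem' := by
    intro f g hf hg
    refine (gsNorm_le_ofReal hh (C := (gsNorm (1 / 2) h f.1).toReal +
      (gsNorm (1 / 2) h g.1).toReal) fun k => ?_).trans_lt ENNReal.ofReal_lt_top
    · have e := gsCoord_comb h f.2.1 g.2.1 1 k
      rw [one_smul, one_mul] at e
      rw [Submodule.coe_add, e]
      exact (norm_add_le _ _).trans (add_le_add (norm_gsCoord_le hh hf k) (norm_gsCoord_le hh hg k))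
  smul_mem' := by
    intro a f hf
    refine (gsNorm_le_ofReal hh (C := ‖a‖ * (gsNorm (1 / 2) h f.1).toReal)
      fun k => ?_).trans_lt ENNReal.ofReal_lt_top
    · have e := gsCoord_comb h (f := 0) contDiff_const f.2.1 a k
      rw [zero_add] at e
      rw [Submodule.coe_smul, e, show gsCoord h (0 : EuclideanSpace ℝ (Fin d) → ℂ) k = 0 by
        simp [gsCoord, multiD_zero], zero_add, norm_mul]
      exact mul_le_mul_of_nonneg_left (norm_gsCoord_le hh hf k) (norm_nonneg a)

variable (d) in
/-- The embedding of `𝒮_{1/2,h}` into `ℓ^∞`. -/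
def gsVec {h : ℝ} (hh : 0 < h) : gsSub d hh →ₗ[ℂ] lp (fun _ : GSIndex d => ℂ) ∞ where
  toFun φ := ⟨gsCoord h (φ : GelfandShilov d (1 / 2)).1, memℓp_infty
    ⟨_, by rintro _ ⟨k, rfl⟩; exact norm_gsCoord_le hh φ.2 k⟩⟩
  map_add' f g := by
    ext k
    have e := gsCoord_comb h f.1.2.1 g.1.2.1 1 k
    rw [one_smul, one_mul] at e
    exact e
  map_smul' a f := by
    ext k
    have e := gsCoord_comb h (f := 0) contDiff_const f.1.2.1 a k
    rw [zero_add, show gsCoord h (0 : EuclideanSpace ℝ (Fin d) → ℂ) k = 0 by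
      simp [gsCoord, multiD_zero], zero_add] at e
    exact e

theorem gsVec_apply {h : ℝ} (hh : 0 < h) (φ : gsSub d hh) (k : GSIndex d) :
    gsVec d hh φ k = gsCoord h (φ : GelfandShilov d (1 / 2)).1 k := rfl

/-- The coordinates with `α = β = 0` have denominator `1` and are the values of `φ`. -/
theorem gsVec_injective {h : ℝ} (hh : 0 < h) : Function.Injective (gsVec d hh) := by
  intro φ ψ e
  refine Subtype.ext (Subtype.ext (funext fun y => ?_))
  have h1 := congrArg (fun v : lp (fun _ : GSIndex d => ℂ) ∞ => v (0, 0, y)) e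
  simpa only [gsVec_apply, gsCoord_zero_zero] using h1

theorem gsNorm_le_norm_gsVec {h : ℝ} (hh : 0 < h) (φ : gsSub d hh) :
    (gsNorm (1 / 2) h (φ : GelfandShilov d (1 / 2)).1).toReal ≤ ‖gsVec d hh φ‖ := by
  refine ENNReal.toReal_le_of_le_ofReal (norm_nonneg _) (gsNorm_le_ofReal hh fun k => ?_)
  exact lp.norm_apply_le_norm ENNReal.top_ne_zero (gsVec d hh φ) k

/-- Distributions extend to continuous linear forms on `ℓ^∞`. -/
theorem exists_clm_extension {h : ℝ} (hh : 0 < h) (f : GelfandShilovDual d (1 / 2)) :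
    ∃ g : lp (fun _ : GSIndex d => ℂ) ∞ →L[ℂ] ℂ, ∀ φ : gsSub d hh,
      g (gsVec d hh φ) = (f : Module.Dual ℂ (GelfandShilov d (1 / 2))) φ := by
  obtain ⟨C, hC⟩ := f.2 h hh
  let e := LinearEquiv.ofInjective (gsVec d hh) (gsVec_injective hh)
  let g₀ : LinearMap.range (gsVec d hh) →ₗ[ℂ] ℂ :=
    (f : Module.Dual ℂ (GelfandShilov d (1 / 2))) ∘ₗ (gsSub d hh).subtype ∘ₗ e.symm.toLinearMap
  -- The continuity constant `C` carries no sign condition, hence the maximum with `0`.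
  have hg₀ : ∀ v, ‖g₀ v‖ ≤ max C 0 * ‖v‖ := by
    intro v
    obtain ⟨φ, rfl⟩ := e.surjective v
    have e1 : g₀ (e φ) = (f : Module.Dual ℂ (GelfandShilov d (1 / 2))) φ := by simp [g₀]
    rw [e1]
    refine (hC φ φ.2).trans ?_
    gcongr
    · exact le_max_left _ _
    · exact gsNorm_le_norm_gsVec hh φ
  obtain ⟨g, hg, -⟩ := exists_extension_norm_eq _ (g₀.mkContinuous _ hg₀)
  refine ⟨g, fun φ => ?_⟩
  have h1 := hg (e φ)
  rw [LinearMap.mkContinuous_apply] at h1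
  have e1 : g₀ (e φ) = (f : Module.Dual ℂ (GelfandShilov d (1 / 2))) φ := by simp [g₀]
  rw [e1] at h1
  exact h1

end coordinates

/-! ### Gaussian atoms -/

section gaussianAtoms

variable {d : ℕ}

/-- Cauchy estimates on circles of radius `√(n+1)`, which turn `n!` into `√(n!)`. Unlike in
`gEntire_bound`, the constants are uniform in `(a, ξ)` and the growth in these has arbitrarily small
Gaussian rate `δ`; the price is a large `h`. The lower bound `h₀` makes it possible to enlarge a
given space `𝒮_{1/2,h₀}`. -/
theorem gEntire_subgaussian_bound {δ : ℝ} (hδ0 : 0 < δ) (hδ : δ ≤ 1 / 4) (h₀ : ℝ) :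
    ∃ h C : ℝ, h₀ ≤ h ∧ 0 < h ∧ 0 < C ∧ ∀ (a ξ : ℝ) (n m : ℕ) (t : ℝ),
      |t| ^ m * ‖deriv^[n] (fun t : ℝ => gEntire a ξ t) t‖ ≤
        C * Real.exp (δ * (a ^ 2 + ξ ^ 2)) * h ^ (n + m) *
          (((n.factorial * m.factorial : ℕ) : ℝ) ^ (1 / 2 : ℝ)) := by
  -- `(n + 1) A` collects `r² / 2` and the term `r² / (4δ)` of `r |ξ| ≤ r² / (4δ) + δ ξ²`, with `r²
  -- = n + 1`.
  set A : ℝ := 1 / 2 + 1 / (4 * δ) with hA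
  set s : ℝ := Real.sqrt δ with hs
  have hs0 : 0 < s := Real.sqrt_pos.2 hδ0
  have hs2 : s ^ 2 = δ := Real.sq_sqrt hδ0.le
  set h : ℝ := max h₀ (max (Real.exp A) s⁻¹) with hh
  have hh1 : Real.exp A ≤ h := (le_max_left _ _).trans (le_max_right _ _)
  have hh2 : s⁻¹ ≤ h := (le_max_right _ _).trans (le_max_right _ _)
  have hh0 : 0 < h := (Real.exp_pos _).trans_le hh1
  refine ⟨h, Real.exp A, le_max_left _ _, hh0, Real.exp_pos _, fun a ξ n m t => ?_⟩
  rw [deriv_iter_ofReal (gEntire_diff a ξ)]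
  set r : ℝ := Real.sqrt (n + 1) with hr
  have hn1 : (0 : ℝ) < n + 1 := by positivity
  have hr0 : 0 < r := Real.sqrt_pos.2 hn1
  have hr2 : r ^ 2 = n + 1 := Real.sq_sqrt hn1.le
  have hc := Complex.norm_iteratedDeriv_le_of_forall_mem_sphere_norm_le (c := (t : ℂ)) n hr0
    (gEntire_diff a ξ).diffContOnCl (fun w hw => gEntire_norm a ξ t r w (by
      simpa [dist_eq_norm] using hw))
  have hsf : Real.sqrt n.factorial ≤ r ^ n := by
    apply Real.sqrt_le_iff.2
    refine ⟨by positivity, ?_⟩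
    rw [← pow_mul, mul_comm, pow_mul, hr2]
    have : n.factorial ≤ (n + 1) ^ n :=
      (Nat.factorial_le_pow n).trans (Nat.pow_le_pow_left (Nat.le_succ n) n)
    exact_mod_cast this
  have hfac : (n.factorial : ℝ) / r ^ n ≤ Real.sqrt n.factorial := by
    rw [div_le_iff₀ (by positivity)]
    calc (n.factorial : ℝ) = Real.sqrt n.factorial * Real.sqrt n.factorial :=
          (Real.mul_self_sqrt (by positivity)).symm
      _ ≤ _ := by gcongr
  have htm : |t| ^ m ≤ h ^ m * Real.sqrt m.factorial * Real.exp (δ * t ^ 2 / 2) := by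
    have h1 : (δ * t ^ 2) ^ m / m.factorial ≤ Real.exp (δ * t ^ 2) :=
      Real.pow_div_factorial_le_exp _ (by positivity) m
    rw [div_le_iff₀ (by positivity)] at h1
    have h2 : (s * |t|) ^ m ≤ Real.sqrt m.factorial * Real.exp (δ * t ^ 2 / 2) := by
      refine abs_le_of_sq_le_sq' ?_ (by positivity) |>.2
      calc ((s * |t|) ^ m) ^ 2 = (δ * t ^ 2) ^ m := by
            rw [← pow_mul, mul_comm m 2, pow_mul, mul_pow, hs2, sq_abs]
        _ ≤ Real.exp (δ * t ^ 2) * m.factorial := h1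
        _ = (Real.sqrt m.factorial * Real.exp (δ * t ^ 2 / 2)) ^ 2 := by
            rw [mul_pow, Real.sq_sqrt (by positivity), ← Real.exp_nat_mul]
            push_cast
            ring_nf
    calc |t| ^ m = (s⁻¹) ^ m * (s * |t|) ^ m := by
          rw [← mul_pow, inv_mul_cancel_left₀ hs0.ne']
      _ ≤ h ^ m * (Real.sqrt m.factorial * Real.exp (δ * t ^ 2 / 2)) := by gcongr
      _ = _ := by ring
  have hrxi : r * |ξ| ≤ (n + 1) / (4 * δ) + δ * ξ ^ 2 := by
    have h1 := sq_nonneg (r - 2 * δ * |ξ|)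
    have h2 : 4 * δ * (r * |ξ|) ≤ (n + 1) + 4 * δ * (δ * ξ ^ 2) := by
      have h3 : (r - 2 * δ * |ξ|) ^ 2 = (n + 1) - 4 * δ * (r * |ξ|) + 4 * δ * (δ * ξ ^ 2) := by
        rw [← hr2, ← sq_abs ξ]
        ring
      linarith
    have h4 : (n + 1) / (4 * δ) + δ * ξ ^ 2 = ((n + 1) + 4 * δ * (δ * ξ ^ 2)) / (4 * δ) := by
      field_simp
    rw [h4, le_div_iff₀ (by positivity)]
    linarith
  have hexp : Real.exp (δ * t ^ 2 / 2) * Real.exp (-(t - a) ^ 2 / 4 + r ^ 2 / 2 + r * |ξ|) ≤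
      Real.exp A * Real.exp (δ * (a ^ 2 + ξ ^ 2)) * h ^ n := by
    calc _ = Real.exp (δ * t ^ 2 / 2 + (-(t - a) ^ 2 / 4 + r ^ 2 / 2 + r * |ξ|)) :=
          (Real.exp_add _ _).symm
      _ ≤ Real.exp (A + δ * (a ^ 2 + ξ ^ 2) + n * A) := by
          apply Real.exp_le_exp.2
          -- From `t² ≤ 2 a² + 2 (t - a)²`; the condition `δ ≤ 1/4` lets the Gaussian in `t - a`
          -- absorb the second term.
          have h5 : δ * t ^ 2 / 2 ≤ δ * a ^ 2 + (t - a) ^ 2 / 4 := by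
            nlinarith [sq_nonneg (t - 2 * a), sq_nonneg (t - a)]
          have h6 : A + n * A = (n + 1) / 2 + (n + 1) / (4 * δ) := by
            rw [hA]
            ring
          rw [hr2]
          linarith
      _ = Real.exp A * Real.exp (δ * (a ^ 2 + ξ ^ 2)) * Real.exp A ^ n := by
          rw [Real.exp_add, Real.exp_add, Real.exp_nat_mul]
      _ ≤ _ := by gcongr
  rw [← Real.sqrt_eq_rpow]
  push_cast
  rw [Real.sqrt_mul (by positivity)]
  calc |t| ^ m * ‖iteratedDeriv n (gEntire a ξ) t‖
      ≤ (h ^ m * Real.sqrt m.factorial * Real.exp (δ * t ^ 2 / 2)) *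
        (n.factorial * Real.exp (-(t - a) ^ 2 / 4 + r ^ 2 / 2 + r * |ξ|) / r ^ n) := by
        gcongr
    _ = h ^ m * Real.sqrt m.factorial * ((n.factorial : ℝ) / r ^ n) *
        (Real.exp (δ * t ^ 2 / 2) * Real.exp (-(t - a) ^ 2 / 4 + r ^ 2 / 2 + r * |ξ|)) := by ring
    _ ≤ h ^ m * Real.sqrt m.factorial * Real.sqrt n.factorial *
        (Real.exp A * Real.exp (δ * (a ^ 2 + ξ ^ 2)) * h ^ n) := by
        gcongr
    _ = _ := by ring

theorem gsCoord_stftAtom_bound {δ : ℝ} (hδ0 : 0 < δ) (hδ : δ ≤ 1 / 4) (h₀ : ℝ) :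
    ∃ h C : ℝ, h₀ ≤ h ∧ 0 < h ∧ 0 < C ∧ ∀ (x ξ : EuclideanSpace ℝ (Fin d)) (k : GSIndex d),
      ‖gsCoord h (stftAtom x ξ) k‖ ≤ C * Real.exp (δ * (‖x‖ ^ 2 + ‖ξ‖ ^ 2)) := by
  obtain ⟨h, A, hh₀, hh, hA0, hA⟩ := gEntire_subgaussian_bound hδ0 hδ h₀
  have hκ : (0 : ℝ) < Real.pi ^ (-(d : ℝ) / 4) := by positivity
  refine ⟨h, Real.pi ^ (-(d : ℝ) / 4) * A ^ d, hh₀, hh, by positivity, ?_⟩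
  rintro x ξ ⟨α, β, y⟩
  have hu : ∀ j : Fin d, ContDiff ℝ (⊤ : ℕ∞) (fun t : ℝ => gEntire (x j) (ξ j) t) :=
    fun j => gEntire_real_contDiff _ _
  rw [norm_gsCoord hh, div_le_iff₀ (gsDenom_pos hh _ _), stftAtom_eq_tens, multiD_tens _ hu]
  unfold tens gsDenom
  rw [norm_mul, norm_prod, Finset.abs_prod, Complex.norm_real, Real.norm_of_nonneg hκ.le]
  have key : (∏ j, |y j ^ β j|) * ∏ j, ‖deriv^[α j] (fun t : ℝ => gEntire (x j) (ξ j) t) (y j)‖ ≤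
      ∏ j, (A * Real.exp (δ * (x j ^ 2 + ξ j ^ 2)) * h ^ (α j + β j) *
        ((((α j).factorial * (β j).factorial : ℕ) : ℝ) ^ (1 / 2 : ℝ))) := by
    rw [← Finset.prod_mul_distrib]
    refine Finset.prod_le_prod (fun j _ => by positivity) fun j _ => ?_
    rw [abs_pow]
    exact hA (x j) (ξ j) (α j) (β j) (y j)
  have hsum : ‖x‖ ^ 2 + ‖ξ‖ ^ 2 = ∑ j, (x j ^ 2 + ξ j ^ 2) := by
    simp [EuclideanSpace.norm_sq_eq, Finset.sum_add_distrib]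
  rw [Finset.prod_mul_distrib, Finset.prod_mul_distrib, Finset.prod_mul_distrib,
    Finset.prod_pow_eq_pow_sum, Finset.sum_add_distrib,
    Real.finsetProd_rpow _ _ (fun j _ => by positivity), ← Real.exp_sum, ← Finset.mul_sum, ← hsum,
    ← Nat.cast_prod, Finset.prod_mul_distrib, Finset.prod_const, Finset.card_univ,
    Fintype.card_fin] at key
  calc _ = Real.pi ^ (-(d : ℝ) / 4) * ((∏ j, |y j ^ β j|) *
        ∏ j, ‖deriv^[α j] (fun t : ℝ => gEntire (x j) (ξ j) t) (y j)‖) := by ring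
    _ ≤ _ := mul_le_mul_of_nonneg_left key hκ.le
    _ = _ := by ring

/-- The function `y ↦ exp(-⟨y,y⟩/2 + ⟨y,z⟩)`. -/
def bargmannKernel (z : EuclideanSpace ℂ (Fin d)) : EuclideanSpace ℝ (Fin d) → ℂ :=
  tens 1 fun j t => Complex.exp (-(t : ℂ) ^ 2 / 2 + t * z j)

theorem contDiff_expKernel (z : ℂ) :
    ContDiff ℝ (⊤ : ℕ∞) fun t : ℝ => Complex.exp (-(t : ℂ) ^ 2 / 2 + t * z) := by
  have : ContDiff ℝ (⊤ : ℕ∞) (fun t : ℝ => (t : ℂ)) := Complex.ofRealCLM.contDiff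
  fun_prop

/-- Hermite-type polynomials. They do not depend on `z` and `t`, so each derivative at a fixed `t`
is visibly entire in `z`. -/
theorem exists_polynomial_deriv_expKernel (n : ℕ) : ∃ Q : Polynomial ℂ, ∀ (z : ℂ) (t : ℝ),
    deriv^[n] (fun t : ℝ => Complex.exp (-(t : ℂ) ^ 2 / 2 + t * z)) t =
      Q.eval (z - t) * Complex.exp (-(t : ℂ) ^ 2 / 2 + t * z) := by
  induction n with
  | zero => exact ⟨1, fun z t => by simp⟩
  | succ n ih =>
    obtain ⟨Q, hQ⟩ := ih
    refine ⟨Polynomial.X * Q - Polynomial.derivative Q, fun z t => ?_⟩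
    rw [Function.iterate_succ_apply', funext (hQ z)]
    have h1 : HasDerivAt (fun s : ℂ => Q.eval (z - s) * Complex.exp (-s ^ 2 / 2 + s * z))
        (Q.derivative.eval (z - t) * (-1) * Complex.exp (-(t : ℂ) ^ 2 / 2 + t * z) +
          Q.eval (z - t) * (Complex.exp (-(t : ℂ) ^ 2 / 2 + t * z) * (-t + z))) (t : ℂ) := by
      refine HasDerivAt.mul ?_ (HasDerivAt.cexp ?_)
      · exact (Q.hasDerivAt (z - t)).comp (t : ℂ) ((hasDerivAt_id (t : ℂ)).const_sub z)
      · have h2 : HasDerivAt (fun s : ℂ => -s ^ 2 / 2 + s * z)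
            (-((2 : ℕ) * (t : ℂ) ^ (2 - 1)) / 2 + 1 * z) (t : ℂ) :=
          ((hasDerivAt_pow 2 (t : ℂ)).neg.div_const 2).add ((hasDerivAt_id (t : ℂ)).mul_const z)
        refine h2.congr_deriv ?_
        push_cast
        ring
    rw [h1.comp_ofReal.deriv]
    simp only [Polynomial.eval_sub, Polynomial.eval_mul, Polynomial.eval_X]
    ring

theorem differentiable_gsCoord_bargmannKernel (h : ℝ) (k : GSIndex d) :
    Differentiable ℂ fun z : EuclideanSpace ℂ (Fin d) => gsCoord h (bargmannKernel z) k := by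
  obtain ⟨α, β, y⟩ := k
  choose Q hQ using exists_polynomial_deriv_expKernel
  have e : ∀ z : EuclideanSpace ℂ (Fin d), multiD α (bargmannKernel z) y =
      ∏ j, (Q (α j)).eval (z j - y j) * Complex.exp (-(y j : ℂ) ^ 2 / 2 + y j * z j) := by
    intro z
    rw [bargmannKernel, multiD_tens _ fun j => contDiff_expKernel (z j)]
    simp only [tens, hQ, one_mul]
  simp only [gsCoord, e]
  have hz : ∀ j, Differentiable ℂ fun z : EuclideanSpace ℂ (Fin d) => z j := fun j =>
    (EuclideanSpace.proj j : EuclideanSpace ℂ (Fin d) →L[ℂ] ℂ).differentiable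
  simp only [div_eq_mul_inv _ ((gsDenom _ _ _ _ : ℝ) : ℂ)]
  refine Differentiable.mul_const (Differentiable.const_mul (fun z => (HasFDerivAt.finsetProd
    fun j _ => (Differentiable.mul ?_ ?_ z).hasFDerivAt).differentiableAt) _) _
  · exact (Q (α j)).differentiable.comp ((hz j).sub_const _)
  · exact ((hz j).const_mul _).const_add _ |>.cexp

/-- Expanding the square separates a scalar from a kernel depending on `(x, ξ)` only through `x -
iξ`, and holomorphically so. -/
theorem stftAtom_eq_smul (x ξ : EuclideanSpace ℝ (Fin d)) :
    stftAtom x ξ = ((Real.pi ^ (-(d : ℝ) / 4) * Real.exp (-‖x‖ ^ 2 / 2) : ℝ) : ℂ) •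
      bargmannKernel (WithLp.toLp 2 fun j => (x j : ℂ) - Complex.I * ξ j) := by
  rw [stftAtom_eq_tens]
  funext y
  simp only [tens, bargmannKernel, Pi.smul_apply, smul_eq_mul, one_mul]
  push_cast
  rw [mul_assoc]
  congr 1
  simp only [gEntire]
  rw [← Complex.exp_sum, ← Complex.exp_sum, ← Complex.exp_add]
  congr 1
  rw [← Complex.ofReal_pow, EuclideanSpace.norm_sq_eq]
  push_cast
  rw [neg_div, Finset.sum_div, ← Finset.sum_neg_distrib, ← Finset.sum_add_distrib]
  refine Finset.sum_congr rfl fun j _ => ?_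
  rw [← Complex.ofReal_pow, Real.norm_eq_abs, sq_abs]
  push_cast
  ring

theorem bargmannKernel_eq_smul (z : EuclideanSpace ℂ (Fin d)) :
    bargmannKernel z = ((Real.pi ^ (-(d : ℝ) / 4) *
      Real.exp (-‖(WithLp.toLp 2 fun j => (z j).re : EuclideanSpace ℝ (Fin d))‖ ^ 2 / 2) : ℝ) : ℂ)⁻¹ •
      stftAtom (WithLp.toLp 2 fun j => (z j).re) (WithLp.toLp 2 fun j => -(z j).im) := by
  rw [stftAtom_eq_smul, inv_smul_smul₀]
  · congr 1
    ext j
    apply Complex.ext <;> simp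
  · rw [Complex.ofReal_ne_zero]
    positivity

theorem bargmannKernel_mem (z : EuclideanSpace ℂ (Fin d)) :
    bargmannKernel z ∈ GelfandShilov d (1 / 2) := by
  rw [bargmannKernel_eq_smul]
  exact Submodule.smul_mem _ _ (stftAtom_mem _ _)

/-- The atoms as elements of `𝒮_{1/2}`. -/
def gsAtom (x ξ : EuclideanSpace ℝ (Fin d)) : GelfandShilov d (1 / 2) :=
  ⟨stftAtom x ξ, stftAtom_mem x ξ⟩

/-- `bargmannKernel` as an element of `𝒮_{1/2}`. -/
def gsKernel (z : EuclideanSpace ℂ (Fin d)) : GelfandShilov d (1 / 2) :=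
  ⟨bargmannKernel z, bargmannKernel_mem z⟩

theorem gsAtom_eq_smul (x ξ : EuclideanSpace ℝ (Fin d)) :
    gsAtom x ξ = ((Real.pi ^ (-(d : ℝ) / 4) * Real.exp (-‖x‖ ^ 2 / 2) : ℝ) : ℂ) •
      gsKernel (WithLp.toLp 2 fun j => (x j : ℂ) - Complex.I * ξ j) :=
  Subtype.ext (stftAtom_eq_smul x ξ)

theorem gsKernel_eq_smul (z : EuclideanSpace ℂ (Fin d)) :
    gsKernel z = ((Real.pi ^ (-(d : ℝ) / 4) *
      Real.exp (-‖(WithLp.toLp 2 fun j => (z j).re : EuclideanSpace ℝ (Fin d))‖ ^ 2 / 2) : ℝ) : ℂ)⁻¹ •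
      gsAtom (WithLp.toLp 2 fun j => (z j).re) (WithLp.toLp 2 fun j => -(z j).im) :=
  Subtype.ext (bargmannKernel_eq_smul z)

/-- The atoms lie in `𝒮_{1/2,h}` for large `h`, with subgaussian norms, and the corresponding
bounded families depend continuously on the parameters. -/
theorem exists_gsVec_bound {δ : ℝ} (hδ0 : 0 < δ) (hδ : δ ≤ 1 / 4) (h₀ : ℝ) :
    ∃ (h C : ℝ) (hh : 0 < h) (ha : ∀ x ξ : EuclideanSpace ℝ (Fin d), gsAtom x ξ ∈ gsSub d hh)
      (hk : ∀ z : EuclideanSpace ℂ (Fin d), gsKernel z ∈ gsSub d hh), h₀ ≤ h ∧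
      (∀ x ξ, ‖gsVec d hh ⟨gsAtom x ξ, ha x ξ⟩‖ ≤ C * Real.exp (δ * (‖x‖ ^ 2 + ‖ξ‖ ^ 2))) ∧
      (Continuous fun z => gsVec d hh ⟨gsKernel z, hk z⟩) ∧
      Continuous fun q : EuclideanSpace ℝ (Fin d) × EuclideanSpace ℝ (Fin d) =>
        gsVec d hh ⟨gsAtom q.1 q.2, ha q.1 q.2⟩ := by
  obtain ⟨h, C, hh₀, hh, hC, hb⟩ := gsCoord_stftAtom_bound (d := d) hδ0 hδ h₀
  have ha : ∀ x ξ : EuclideanSpace ℝ (Fin d), gsAtom x ξ ∈ gsSub d hh := fun x ξ =>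
    (gsNorm_le_ofReal hh (hb x ξ)).trans_lt ENNReal.ofReal_lt_top
  have hk : ∀ z : EuclideanSpace ℂ (Fin d), gsKernel z ∈ gsSub d hh := fun z => by
    rw [gsKernel_eq_smul]
    exact Submodule.smul_mem _ _ (ha _ _)
  have hn : ∀ x ξ, ‖gsVec d hh ⟨gsAtom x ξ, ha x ξ⟩‖ ≤
      C * Real.exp (δ * (‖x‖ ^ 2 + ‖ξ‖ ^ 2)) := fun x ξ =>
    lp.norm_le_of_forall_le (by positivity) fun k => hb x ξ k
  have hkc : Continuous fun z => gsVec d hh ⟨gsKernel z, hk z⟩ := by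
    refine continuous_of_differentiable_coord
      (fun k => differentiable_gsCoord_bargmannKernel h k) fun z₀ => ?_
    set R := ‖z₀‖ + 1
    refine ⟨(Real.pi ^ (-(d : ℝ) / 4) * Real.exp (-R ^ 2 / 2))⁻¹ *
      (C * Real.exp (δ * R ^ 2)), fun z hz => ?_⟩
    have hzR : ‖z‖ ≤ R := by
      have h1 := norm_le_norm_add_norm_sub' z z₀
      rw [Metric.mem_ball, dist_eq_norm] at hz
      simp only [R]
      linarith
    have hsplit : ‖(WithLp.toLp 2 fun j => (z j).re : EuclideanSpace ℝ (Fin d))‖ ^ 2 +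
        ‖(WithLp.toLp 2 fun j => -(z j).im : EuclideanSpace ℝ (Fin d))‖ ^ 2 = ‖z‖ ^ 2 := by
      simp only [EuclideanSpace.norm_sq_eq, ← Finset.sum_add_distrib, Complex.sq_norm,
        Complex.normSq_apply, Real.norm_eq_abs, sq_abs]
      exact Finset.sum_congr rfl fun j _ => by ring
    have hsq : ‖z‖ ^ 2 ≤ R ^ 2 := pow_le_pow_left₀ (norm_nonneg z) hzR 2
    have hre : ‖(WithLp.toLp 2 fun j => (z j).re : EuclideanSpace ℝ (Fin d))‖ ^ 2 ≤ R ^ 2 := by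
      nlinarith [sq_nonneg ‖(WithLp.toLp 2 fun j => -(z j).im : EuclideanSpace ℝ (Fin d))‖]
    have e : gsVec d hh ⟨gsKernel z, hk z⟩ = ((Real.pi ^ (-(d : ℝ) / 4) *
        Real.exp (-‖(WithLp.toLp 2 fun j => (z j).re : EuclideanSpace ℝ (Fin d))‖ ^ 2 / 2) : ℝ) :
          ℂ)⁻¹ • gsVec d hh ⟨gsAtom _ _, ha (WithLp.toLp 2 fun j => (z j).re)
            (WithLp.toLp 2 fun j => -(z j).im)⟩ := by
      rw [← map_smul]
      exact congrArg _ (Subtype.ext (gsKernel_eq_smul z))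
    rw [e, norm_smul, norm_inv, Complex.norm_real, Real.norm_of_nonneg (by positivity)]
    gcongr
    refine (hn _ _).trans ?_
    rw [hsplit]
    gcongr
  refine ⟨h, C, hh, ha, hk, hh₀, hn, hkc, ?_⟩
  have e : (fun q : EuclideanSpace ℝ (Fin d) × EuclideanSpace ℝ (Fin d) =>
      gsVec d hh ⟨gsAtom q.1 q.2, ha q.1 q.2⟩) = fun q =>
      ((Real.pi ^ (-(d : ℝ) / 4) * Real.exp (-‖q.1‖ ^ 2 / 2) : ℝ) : ℂ) •
        gsVec d hh ⟨_, hk (WithLp.toLp 2 fun j => (q.1 j : ℂ) - Complex.I * q.2 j)⟩ := by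
    funext q
    rw [← map_smul]
    exact congrArg _ (Subtype.ext (gsAtom_eq_smul q.1 q.2))
  rw [e]
  have hz : Continuous fun q : EuclideanSpace ℝ (Fin d) × EuclideanSpace ℝ (Fin d) =>
      (WithLp.toLp 2 fun j => (q.1 j : ℂ) - Complex.I * q.2 j : EuclideanSpace ℂ (Fin d)) := by
    fun_prop
  have hc : Continuous fun q : EuclideanSpace ℝ (Fin d) × EuclideanSpace ℝ (Fin d) =>
      ((Real.pi ^ (-(d : ℝ) / 4) * Real.exp (-‖q.1‖ ^ 2 / 2) : ℝ) : ℂ) := by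
    fun_prop
  exact hc.smul (hkc.comp hz)

theorem stft_eq (f : GelfandShilovDual d (1 / 2)) (X : Phase d) :
    stft f X = (((2 * Real.pi) ^ (-(d : ℝ) / 2) : ℝ) : ℂ) *
      (f : Module.Dual ℂ (GelfandShilov d (1 / 2))) (gsAtom X.pos X.freq) := rfl

/-- The Bargmann transform. -/
theorem exists_stft_eq_bargmannPullback (f : GelfandShilovDual d (1 / 2)) :
    ∃ F : EuclideanSpace ℂ (Fin d) → ℂ, CircleMean F ∧ stft f = bargmannPullback F := by
  obtain ⟨h, C, hh, ha, hk, -, -, hkc, -⟩ :=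
    exists_gsVec_bound (d := d) (δ := 1 / 4) (by norm_num) le_rfl 0
  obtain ⟨g, hg⟩ := exists_clm_extension hh f
  -- The Bargmann transform is `F(z) = π^{-d/4} e^{-⟨z,z⟩/2} ⟨f, exp(-⟨y,y⟩/2 + √2⟨y,z⟩)⟩`; the `√2`
  -- undoes the one in `bargmannPoint`.
  set q : EuclideanSpace ℂ (Fin d) → ℂ := fun z =>
    ((Real.pi ^ (-(d : ℝ) / 4) : ℝ) : ℂ) * Complex.exp (-(∑ j, z j ^ 2) / 2) with hq
  have hz : ∀ j, Differentiable ℂ fun z : EuclideanSpace ℂ (Fin d) => z j := fun j =>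
    (EuclideanSpace.proj j : EuclideanSpace ℂ (Fin d) →L[ℂ] ℂ).differentiable
  have hqd : Differentiable ℂ q := by
    have hs : Differentiable ℂ fun z : EuclideanSpace ℂ (Fin d) => ∑ j, z j ^ 2 :=
      Differentiable.fun_sum fun j _ => (hz j).pow 2
    simp only [hq]
    fun_prop
  set s : ℂ := ((Real.sqrt 2 : ℝ) : ℂ) with hs
  set Ψ : EuclideanSpace ℂ (Fin d) → lp (fun _ : GSIndex d => ℂ) ∞ := fun z =>
    q z • gsVec d hh ⟨_, hk (s • z)⟩ with hΨ
  have hΨc : Continuous Ψ := hqd.continuous.smul (hkc.comp (continuous_const_smul s))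
  have hΨd : ∀ k, Differentiable ℂ fun z => Ψ z k := fun k =>
    hqd.mul ((differentiable_gsCoord_bargmannKernel h k).comp (differentiable_id.const_smul s))
  refine ⟨fun z => g (Ψ z), circleMean_clm_comp hΨd hΨc g, funext fun X => ?_⟩
  have e1 : (WithLp.toLp 2 fun j => ((X.pos j : ℝ) : ℂ) - Complex.I * (X.freq j : ℝ) :
      EuclideanSpace ℂ (Fin d)) = s • bargmannPoint X := by
    have h1 : s * ((Real.sqrt 2)⁻¹ : ℝ) = 1 := by
      rw [hs, ← Complex.ofReal_mul, mul_inv_cancel₀ (by positivity), Complex.ofReal_one]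
    ext j
    simp only [PiLp.smul_apply, smul_eq_mul, bargmannPoint]
    push_cast at h1 ⊢
    linear_combination (-(X.pos j : ℂ) + Complex.I * X.freq j) * h1
  rw [stft_eq, bargmannPullback_eq, gsAtom_eq_smul, map_smul, e1, hΨ]
  simp only [map_smul]
  rw [hg ⟨_, hk (s • bargmannPoint X)⟩]
  simp only [smul_eq_mul, hq]
  rw [Complex.ofReal_mul, Complex.ofReal_mul, Complex.ofReal_exp, Complex.ofReal_exp]
  -- For `z = (x - iξ)/√2` one has `⟨z,z⟩ = (|x|² - |ξ|²)/2 - i⟨x,ξ⟩`, so the three exponents on the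
  -- right add up to `-|x|²/2`.
  have e2 : Complex.exp (((-‖X.pos‖ ^ 2 / 2 : ℝ) : ℂ)) = Complex.exp (((-‖X‖ ^ 2 / 4 : ℝ) : ℂ)) *
      Complex.exp (-Complex.I * ((inner ℝ X.pos X.freq : ℝ) : ℂ) / 2) *
      Complex.exp (-(∑ j, (bargmannPoint X) j ^ 2) / 2) := by
    rw [← Complex.exp_add, ← Complex.exp_add]
    congr 1
    rw [norm_sq_pos_add_freq, EuclideanSpace.norm_sq_eq, EuclideanSpace.norm_sq_eq,
      PiLp.inner_apply]
    simp only [Real.norm_eq_abs, sq_abs]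
    push_cast
    have h2 : ∀ j, (bargmannPoint X) j ^ 2 =
        ((X.pos j : ℂ) ^ 2 - (X.freq j : ℂ) ^ 2) / 2 - Complex.I * (X.pos j * X.freq j) := by
      intro j
      have h1 : (((Real.sqrt 2)⁻¹ : ℝ) : ℂ) ^ 2 = 1 / 2 := by
        rw [← Complex.ofReal_pow, inv_pow, Real.sq_sqrt (by norm_num)]
        norm_num
      simp only [bargmannPoint]
      push_cast at h1 ⊢
      linear_combination ((X.pos j : ℂ) - Complex.I * X.freq j) ^ 2 * h1 +
        (X.freq j : ℂ) ^ 2 / 2 * Complex.I_sq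
    simp only [h2, Finset.sum_sub_distrib, ← Finset.sum_div, ← Finset.mul_sum]
    simp [mul_comm]
    ring
  rw [e2]
  ring

end gaussianAtoms

/-! ### Gaussian decay from moment bounds -/

section gaussianDecay

variable {d : ℕ}

/-- The central binomial coefficient is at most `4 ^ n`. -/
theorem sqrt_factorial_two_mul_le (n : ℕ) : Real.sqrt (2 * n).factorial ≤ 2 ^ n * n.factorial := by
  rw [Real.sqrt_le_iff]
  refine ⟨by positivity, ?_⟩
  have h1 : (2 * n).factorial ≤ 4 ^ n * (n.factorial * n.factorial) := by
    have h := Nat.choose_mul_factorial_mul_factorial (show n ≤ 2 * n by omega)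
    rw [← h, show 2 * n - n = n by omega, mul_assoc]
    gcongr
    calc (2 * n).choose n ≤ 2 ^ (2 * n) := Nat.choose_le_two_pow _ _
      _ = 4 ^ n := by rw [pow_mul]; norm_num
  calc ((2 * n).factorial : ℝ) ≤ 4 ^ n * (n.factorial * n.factorial) := by exact_mod_cast h1
    _ = (2 ^ n * n.factorial : ℝ) ^ 2 := by
      rw [mul_pow, ← pow_mul, mul_comm n 2, pow_mul]
      norm_num
      ring

/-- Expand `exp(ε t²)` in its power series: the moment of order `2n` bounds the `n`-th term by
`2^{-n} A`. -/
theorem mul_exp_sq_le_of_moments {a A H t ε : ℝ} (ha : 0 ≤ a) (hε : 0 ≤ ε)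
    (hεH : 4 * ε * H ^ 2 ≤ 1) (h : ∀ m : ℕ, |t| ^ m * a ≤ A * H ^ m * Real.sqrt m.factorial) :
    Real.exp (ε * t ^ 2) * a ≤ 2 * A := by
  have hA : 0 ≤ A := by
    have := h 0
    simp at this
    linarith
  have h1 : HasSum (fun n : ℕ => (ε * t ^ 2) ^ n / n.factorial * a) (Real.exp (ε * t ^ 2) * a) := by
    rw [Real.exp_eq_exp_ℝ]
    exact (NormedSpace.expSeries_div_hasSum_exp _).mul_right a
  have h2 := hasSum_geometric_two.mul_right A
  refine hasSum_le (fun n => ?_) h1 h2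
  rw [div_mul_eq_mul_div, div_le_iff₀ (by positivity)]
  calc (ε * t ^ 2) ^ n * a = ε ^ n * (|t| ^ (2 * n) * a) := by
        rw [mul_pow, pow_mul, sq_abs]
        ring
    _ ≤ ε ^ n * (A * H ^ (2 * n) * (2 ^ n * n.factorial)) := by
        refine mul_le_mul_of_nonneg_left ((h (2 * n)).trans ?_) (by positivity)
        exact mul_le_mul_of_nonneg_left (sqrt_factorial_two_mul_le n)
          (mul_nonneg hA (Even.pow_nonneg (even_two_mul n) H))
    _ = (2 * ε * H ^ 2) ^ n * A * n.factorial := by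
        rw [mul_pow, mul_pow, pow_mul]
        ring
    _ ≤ (1 / 2) ^ n * A * n.factorial := by
        gcongr
        linarith

/-- Moment bounds of factorial type in each coordinate give Gaussian decay. -/
theorem le_exp_neg_of_moments {a A H : ℝ} (ha : 0 ≤ a) (hH : 0 < H)
    (y : EuclideanSpace ℝ (Fin d)) (h0 : a ≤ A)
    (h : ∀ (i : Fin d) (m : ℕ), |y i| ^ m * a ≤ A * H ^ m * Real.sqrt m.factorial) :
    a ≤ 2 * A * Real.exp (-(1 / (4 * (d + 1) * H ^ 2)) * ‖y‖ ^ 2) := by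
  set ε : ℝ := 1 / (4 * (d + 1) * H ^ 2) with hε
  have hε0 : 0 < ε := by positivity
  suffices Real.exp (ε * ‖y‖ ^ 2) * a ≤ 2 * A by
    rw [neg_mul, Real.exp_neg, ← div_eq_mul_inv, le_div_iff₀ (Real.exp_pos _), mul_comm]
    exact this
  -- Without coordinates the moments say nothing, and `h0` is the only information. Otherwise the
  -- largest coordinate controls the norm; `d + 1` in place of `d` keeps the rate positive for `d =
  -- 0`.
  rcases isEmpty_or_nonempty (Fin d) with hd | hd
  · have : ‖y‖ = 0 := by simp [EuclideanSpace.norm_eq]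
    rw [this]
    simp
    linarith
  · obtain ⟨i, hi⟩ := Finite.exists_max fun i => (y i) ^ 2
    have h1 : ‖y‖ ^ 2 ≤ (d + 1) * (y i) ^ 2 := by
      simp only [EuclideanSpace.norm_sq_eq, Real.norm_eq_abs, sq_abs]
      calc ∑ j, y j ^ 2 ≤ ∑ _j : Fin d, y i ^ 2 := Finset.sum_le_sum fun j _ => hi j
        _ = d * y i ^ 2 := by simp
        _ ≤ _ := by nlinarith [sq_nonneg (y i)]
    calc Real.exp (ε * ‖y‖ ^ 2) * a ≤ Real.exp (ε * (d + 1) * (y i) ^ 2) * a := by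
          rw [mul_assoc]
          gcongr
      _ ≤ 2 * A := mul_exp_sq_le_of_moments ha (by positivity) (by
          rw [hε]
          field_simp
          exact le_rfl) (h i)

end gaussianDecay

/-! ### Derivatives of Gelfand–Shilov functions -/

section derivatives

variable {d : ℕ}

theorem listD_single (i : Fin d) (n : ℕ) (f : EuclideanSpace ℝ (Fin d) → ℂ) (l : List (Fin d)) :
    l.Nodup → listD (Pi.single i n) l f = if i ∈ l then (partialD i)^[n] f else f := by
  induction l with
  | nil => simp [listD]
  | cons j l ih =>
    intro hl
    rw [List.nodup_cons] at hl
    change (partialD j)^[(Pi.single i n : Fin d → ℕ) j] (listD (Pi.single i n) l f) = _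
    rw [ih hl.2]
    by_cases hj : j = i
    · subst hj
      simp [hl.1]
    · simp [hj, Ne.symm hj]

theorem multiD_single (i : Fin d) (n : ℕ) (f : EuclideanSpace ℝ (Fin d) → ℂ) :
    multiD (Pi.single i n) f = (partialD i)^[n] f := by
  rw [multiD, listD_single i n f _ (List.nodup_finRange d), if_pos (List.mem_finRange i)]

theorem moment_partialD_le {h : ℝ} (hh : 0 < h) {φ : EuclideanSpace ℝ (Fin d) → ℂ}
    (hφ : gsNorm (1 / 2) h φ < ∞) (i j : Fin d) (n m : ℕ) (y : EuclideanSpace ℝ (Fin d)) :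
    |y j| ^ m * ‖(partialD i)^[n] φ y‖ ≤ (gsNorm (1 / 2) h φ).toReal * h ^ n *
      Real.sqrt n.factorial * h ^ m * Real.sqrt m.factorial := by
  have h1 := norm_gsCoord_le hh hφ (Pi.single i n, Pi.single j m, y)
  have hfac : ∀ (i : Fin d) (n : ℕ), ∏ k, ((Pi.single i n : Fin d → ℕ) k).factorial =
      n.factorial := fun i n => by
    rw [Finset.prod_eq_single i]
    · simp
    · intro k _ hk
      simp [hk]
    · simp
  rw [norm_gsCoord hh, div_le_iff₀ (gsDenom_pos hh _ _)] at h1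
  dsimp only at h1
  rw [multiD_single, Finset.prod_eq_single j, Pi.single_eq_same, abs_pow, gsDenom, hfac, hfac, ← Real.sqrt_eq_rpow, Nat.cast_mul,
    Real.sqrt_mul (by positivity), Finset.sum_pi_single', Finset.sum_pi_single',
    if_pos (Finset.mem_univ _), if_pos (Finset.mem_univ _), pow_add] at h1
  · refine h1.trans (le_of_eq ?_)
    ring
  · intro k _ hk
    simp [hk]
  · simp

/-- The Gaussian rate of decay of the elements of `𝒮_{1/2,h}`. -/
def gsRate (d : ℕ) (h : ℝ) : ℝ := 1 / (4 * (d + 1) * h ^ 2)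

theorem gsRate_pos {h : ℝ} (hh : 0 < h) : 0 < gsRate d h := by
  unfold gsRate
  positivity

theorem norm_partialD_le {h : ℝ} (hh : 0 < h) {φ : EuclideanSpace ℝ (Fin d) → ℂ}
    (hφ : gsNorm (1 / 2) h φ < ∞) (i : Fin d) (n : ℕ) (y : EuclideanSpace ℝ (Fin d)) :
    ‖(partialD i)^[n] φ y‖ ≤ 2 * ((gsNorm (1 / 2) h φ).toReal * h ^ n *
      Real.sqrt n.factorial) * Real.exp (-gsRate d h * ‖y‖ ^ 2) := by
  refine le_exp_neg_of_moments (norm_nonneg _) hh y ?_ fun j m =>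
    moment_partialD_le hh hφ i j n m y
  simpa using moment_partialD_le hh hφ i i n 0 y

/-- Separate from `norm_partialD_le` because it requires no coordinate `i`, and so includes `d = 0`.
-/
theorem norm_le_gsNorm_mul_exp {h : ℝ} (hh : 0 < h) {φ : EuclideanSpace ℝ (Fin d) → ℂ}
    (hφ : gsNorm (1 / 2) h φ < ∞) (y : EuclideanSpace ℝ (Fin d)) :
    ‖φ y‖ ≤ 2 * (gsNorm (1 / 2) h φ).toReal * Real.exp (-gsRate d h * ‖y‖ ^ 2) := by
  have h0 : ∀ β : Fin d → ℕ, |∏ i, y i ^ β i| * ‖φ y‖ ≤ (gsNorm (1 / 2) h φ).toReal *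
      gsDenom (1 / 2) h 0 β := fun β => by
    have h1 := norm_gsCoord_le hh hφ (0, β, y)
    rwa [norm_gsCoord hh, div_le_iff₀ (gsDenom_pos hh _ _), multiD_const_zero] at h1
  refine le_exp_neg_of_moments (norm_nonneg _) hh y (by simpa [gsDenom] using h0 0) fun i m => ?_
  have := moment_partialD_le hh hφ i i 0 m y
  simpa using this

theorem partialD_mul {f g : EuclideanSpace ℝ (Fin d) → ℂ} (hf : ContDiff ℝ (⊤ : ℕ∞) f)
    (hg : ContDiff ℝ (⊤ : ℕ∞) g) (i : Fin d) (y : EuclideanSpace ℝ (Fin d)) :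
    partialD i (fun y => f y * g y) y = f y * partialD i g y + partialD i f y * g y := by
  have h1 := (hf.differentiable (by simp) y).hasFDerivAt.mul
    (hg.differentiable (by simp) y).hasFDerivAt
  simp only [partialD]
  rw [show (fun y => f y * g y) = f * g from rfl, HasFDerivAt.fderiv h1]
  simp [mul_comm]

theorem partialD_iterate_mul {f g : EuclideanSpace ℝ (Fin d) → ℂ} (hf : ContDiff ℝ (⊤ : ℕ∞) f)
    (hg : ContDiff ℝ (⊤ : ℕ∞) g) (i : Fin d) (n : ℕ) (y : EuclideanSpace ℝ (Fin d)) :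
    (partialD i)^[n] (fun y => f y * g y) y = ∑ p ∈ Finset.HasAntidiagonal.antidiagonal n,
      (n.choose p.1 : ℂ) * ((partialD i)^[p.1] f y * (partialD i)^[p.2] g y) := by
  induction n generalizing y with
  | zero => simp
  | succ n ih =>
    have hfk := partialD_iterate_contDiff hf i
    have hgk := partialD_iterate_contDiff hg i
    rw [Finset.sum_antidiagonal_choose_succ_mul
      (fun k l => (partialD i)^[k] f y * (partialD i)^[l] g y), Function.iterate_succ_apply',
      funext ih, ← Finset.sum_add_distrib]
    have h1 : ∀ p ∈ Finset.HasAntidiagonal.antidiagonal n, HasFDerivAt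
        (fun y => (n.choose p.1 : ℂ) * ((partialD i)^[p.1] f y * (partialD i)^[p.2] g y))
        ((n.choose p.1 : ℂ) • fderiv ℝ
          (fun y => (partialD i)^[p.1] f y * (partialD i)^[p.2] g y) y) y := fun p _ =>
      (((hfk p.1).mul (hgk p.2)).differentiable (by simp) y).hasFDerivAt.const_mul _
    have h2 := HasFDerivAt.fun_sum h1
    simp only [partialD] at h2 ⊢
    rw [h2.fderiv, sum_apply]
    refine Finset.sum_congr rfl fun p hp => ?_
    have h4 : n.choose p.2 = n.choose p.1 := by
      rw [Finset.HasAntidiagonal.mem_antidiagonal] at hp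
      rw [← hp, Nat.choose_symm_add]
    have h3 := partialD_mul (hfk p.1) (hgk p.2) i y
    simp only [partialD] at h3
    rw [smul_apply, h3, smul_eq_mul, mul_add, h4,
      Function.iterate_succ_apply', Function.iterate_succ_apply']
    rfl

theorem partialD_comp_sub (f : EuclideanSpace ℝ (Fin d) → ℂ) (i : Fin d)
    (x : EuclideanSpace ℝ (Fin d)) :
    partialD i (fun y => f (y - x)) = fun y => partialD i f (y - x) := by
  funext y
  simp only [partialD]
  rw [fderiv_comp_sub]

theorem partialD_iterate_comp_sub (f : EuclideanSpace ℝ (Fin d) → ℂ) (i : Fin d) (n : ℕ)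
    (x : EuclideanSpace ℝ (Fin d)) :
    (partialD i)^[n] (fun y => f (y - x)) = fun y => (partialD i)^[n] f (y - x) := by
  induction n with
  | zero => rfl
  | succ n ih =>
    rw [Function.iterate_succ_apply', ih, partialD_comp_sub, Function.iterate_succ_apply']

/-- Derivatives of a product `φ(y) γ(y - x)`. -/
theorem norm_partialD_mul_translate_le {h k : ℝ} (hh : 0 < h) (hk : 0 < k)
    {φ γ : EuclideanSpace ℝ (Fin d) → ℂ} (hφc : ContDiff ℝ (⊤ : ℕ∞) φ)
    (hγc : ContDiff ℝ (⊤ : ℕ∞) γ) (hφ : gsNorm (1 / 2) h φ < ∞) (hγ : gsNorm (1 / 2) k γ < ∞)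
    (i : Fin d) (n : ℕ) (x y : EuclideanSpace ℝ (Fin d)) :
    ‖(partialD i)^[n] (fun y => φ y * γ (y - x)) y‖ ≤
      4 * (gsNorm (1 / 2) h φ).toReal * (gsNorm (1 / 2) k γ).toReal * (h + k) ^ n *
        Real.sqrt n.factorial *
        (Real.exp (-gsRate d h * ‖y‖ ^ 2) * Real.exp (-gsRate d k * ‖y - x‖ ^ 2)) := by
  set P := (gsNorm (1 / 2) h φ).toReal
  set Q := (gsNorm (1 / 2) k γ).toReal
  have hP : 0 ≤ P := ENNReal.toReal_nonneg
  have hQ : 0 ≤ Q := ENNReal.toReal_nonneg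
  set e₁ := Real.exp (-gsRate d h * ‖y‖ ^ 2)
  set e₂ := Real.exp (-gsRate d k * ‖y - x‖ ^ 2)
  have hγx : ContDiff ℝ (⊤ : ℕ∞) fun y => γ (y - x) := hγc.comp (contDiff_id.sub contDiff_const)
  rw [partialD_iterate_mul hφc hγx]
  have hterm : ∀ p ∈ Finset.HasAntidiagonal.antidiagonal n,
      ‖(n.choose p.1 : ℂ) * ((partialD i)^[p.1] φ y *
        (partialD i)^[p.2] (fun y => γ (y - x)) y)‖ ≤
      (h ^ p.1 * k ^ p.2 * n.choose p.1) * (4 * P * Q * Real.sqrt n.factorial * (e₁ * e₂)) := by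
    intro p hp
    rw [Finset.HasAntidiagonal.mem_antidiagonal] at hp
    rw [norm_mul, norm_mul, Complex.norm_natCast, partialD_iterate_comp_sub]
    have h1 := norm_partialD_le hh hφ i p.1 y
    have h2 := norm_partialD_le hk hγ i p.2 (y - x)
    -- The product `p! q!` divides `(p + q)!`, so the factorials combine without loss and the
    -- binomial theorem produces `(h + k) ^ n`.
    have h3 : Real.sqrt p.1.factorial * Real.sqrt p.2.factorial ≤ Real.sqrt n.factorial := by
      rw [← Real.sqrt_mul (by positivity)]
      apply Real.sqrt_le_sqrt
      rw [← hp]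
      exact_mod_cast Nat.le_of_dvd (Nat.factorial_pos _)
        (Nat.factorial_mul_factorial_dvd_factorial_add p.1 p.2)
    calc _ ≤ (n.choose p.1 : ℝ) * ((2 * (P * h ^ p.1 * Real.sqrt p.1.factorial) * e₁) *
          (2 * (Q * k ^ p.2 * Real.sqrt p.2.factorial) * e₂)) := by gcongr
      _ = (h ^ p.1 * k ^ p.2 * n.choose p.1) * (4 * P * Q *
          (Real.sqrt p.1.factorial * Real.sqrt p.2.factorial) * (e₁ * e₂)) := by ring
      _ ≤ _ := by gcongr
  refine (norm_sum_le_of_le _ hterm).trans (le_of_eq ?_)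
  rw [← Finset.sum_mul, (Commute.all h k).add_pow', mul_assoc, mul_assoc]
  simp only [nsmul_eq_mul]
  rw [Finset.sum_congr rfl fun p _ => mul_comm (h ^ p.1 * k ^ p.2) (n.choose p.1 : ℝ)]
  ring

end derivatives

/-! ### The Gabor expansion -/

section fourierDecay

open scoped FourierTransform

variable {d : ℕ}

theorem integrable_exp_neg_mul_sq {ε : ℝ} (hε : 0 < ε) :
    Integrable fun y : EuclideanSpace ℝ (Fin d) => Real.exp (-ε * ‖y‖ ^ 2) := by
  have h := (GaussianFourier.integrable_cexp_neg_mul_sq_norm_add (b := (ε : ℂ)) (by simpa) 0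
    (0 : EuclideanSpace ℝ (Fin d))).norm
  refine h.congr (Filter.Eventually.of_forall fun y => ?_)
  simp only [Complex.norm_exp]
  congr 1
  simp [← Complex.ofReal_pow]

/-- Integration by parts against a character; since characters are bounded, integrability of `P` and
of the derivative suffices. -/
theorem fourier_partialD {P : EuclideanSpace ℝ (Fin d) → ℂ} (hP : ContDiff ℝ (⊤ : ℕ∞) P)
    (hi : Integrable P) {i : Fin d} (hi' : Integrable (partialD i P))
    (w : EuclideanSpace ℝ (Fin d)) :
    𝓕 (partialD i P) w = 2 * Real.pi * Complex.I * w i * 𝓕 P w := by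
  set e : EuclideanSpace ℝ (Fin d) → ℂ := fun y =>
    Complex.exp (((-2 * Real.pi * inner ℝ y w : ℝ) : ℂ) * Complex.I) with he
  have hec : Continuous e := by fun_prop
  have hen : ∀ y, ‖e y‖ = 1 := fun y => Complex.norm_exp_ofReal_mul_I _
  have hed : ∀ y, HasFDerivAt e (e y • (((innerSL ℝ w).smulRight
      ((-2 * Real.pi : ℝ) * Complex.I : ℂ)))) y := by
    intro y
    have h1 : HasFDerivAt (fun y : EuclideanSpace ℝ (Fin d) =>
        ((-2 * Real.pi * inner ℝ y w : ℝ) : ℂ) * Complex.I)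
        ((innerSL ℝ w).smulRight ((-2 * Real.pi : ℝ) * Complex.I : ℂ)) y := by
      have h2 := ((innerSL ℝ w).smulRight ((-2 * Real.pi : ℝ) * Complex.I : ℂ)).hasFDerivAt (x := y)
      refine h2.congr_of_eventuallyEq (Filter.Eventually.of_forall fun z => ?_)
      simp only [ContinuousLinearMap.smulRight_apply, innerSL_apply_apply, Complex.real_smul,
        real_inner_comm w z]
      push_cast
      ring
    exact h1.cexp
  have hde : ∀ y, fderiv ℝ e y (EuclideanSpace.single i 1) =
      -(2 * Real.pi * Complex.I * w i) * e y := by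
    intro y
    rw [(hed y).fderiv]
    simp [EuclideanSpace.inner_single_right]
    ring
  have hb : ∀ {Q : EuclideanSpace ℝ (Fin d) → ℂ}, Integrable Q → Integrable fun y => Q y * e y :=
    fun hQ => hQ.mul_bdd (c := 1) hec.aestronglyMeasurable
      (Filter.Eventually.of_forall fun y => (hen y).le)
  have hparts := integral_mul_fderiv_eq_neg_fderiv_mul_of_integrable (μ := volume) (𝕜 := ℂ)
    (f := P) (g := e) (v := EuclideanSpace.single i 1) (hb hi') (by
      simp only [hde]
      refine ((hb hi).const_mul (-(2 * Real.pi * Complex.I * w i))).congr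
        (Filter.Eventually.of_forall fun y => ?_)
      simp only
      ring) (hb hi) (fun y _ => hP.differentiable (by simp) y)
    (fun y _ => (hed y).differentiableAt)
  have hF : ∀ Q : EuclideanSpace ℝ (Fin d) → ℂ, 𝓕 Q w = ∫ y, Q y * e y := fun Q => by
    rw [Real.fourier_eq']
    refine integral_congr_ae (Filter.Eventually.of_forall fun y => ?_)
    simp only [he, smul_eq_mul]
    rw [mul_comm]
  rw [hF, hF, ← integral_const_mul]
  rw [eq_neg_iff_add_eq_zero, add_comm, ← eq_neg_iff_add_eq_zero, ← integral_neg] at hparts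
  refine hparts.trans (integral_congr_ae (Filter.Eventually.of_forall fun y => ?_))
  simp only [hde]
  ring

/-- The factor `(2π) ^ n ≥ 1` on the left is discarded. -/
theorem pow_mul_norm_fourier_le {P : EuclideanSpace ℝ (Fin d) → ℂ} (hP : ContDiff ℝ (⊤ : ℕ∞) P)
    (i : Fin d) (hi : ∀ n, Integrable ((partialD i)^[n] P)) (n : ℕ)
    (w : EuclideanSpace ℝ (Fin d)) :
    |w i| ^ n * ‖𝓕 P w‖ ≤ ∫ y, ‖(partialD i)^[n] P y‖ := by
  have h1 : 𝓕 ((partialD i)^[n] P) w = (2 * Real.pi * Complex.I * w i) ^ n * 𝓕 P w := by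
    induction n with
    | zero => simp
    | succ n ih =>
      have h := hi (n + 1)
      rw [Function.iterate_succ_apply'] at h
      rw [Function.iterate_succ_apply', fourier_partialD (partialD_iterate_contDiff hP i n) (hi n) h,
        ih, pow_succ]
      ring
  have h2 : ‖𝓕 ((partialD i)^[n] P) w‖ ≤ ∫ y, ‖(partialD i)^[n] P y‖ :=
    VectorFourier.norm_fourierIntegral_le_integral_norm _ _ _ _ _
  refine le_trans ?_ h2
  rw [h1, norm_mul, norm_pow]
  gcongr
  simp only [norm_mul, Complex.norm_I, Complex.norm_real, Real.norm_eq_abs, mul_one,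
    Complex.norm_ofNat, abs_of_pos Real.pi_pos]
  nlinarith [abs_nonneg (w i), Real.pi_gt_three]

/-- From `|x|² ≤ 2|y|² + 2|y - x|²`: part of the decay is spent on `x`, and the rest keeps the
expression integrable in `y`. -/
theorem exp_mul_exp_translate_le {a b : ℝ} (ha : 0 < a) (hb : 0 < b)
    (x y : EuclideanSpace ℝ (Fin d)) :
    Real.exp (-a * ‖y‖ ^ 2) * Real.exp (-b * ‖y - x‖ ^ 2) ≤
      Real.exp (-(min a b / 4) * ‖x‖ ^ 2) * Real.exp (-(min a b / 2) * ‖y‖ ^ 2) := by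
  rw [← Real.exp_add, ← Real.exp_add, Real.exp_le_exp]
  have hx : ‖x‖ ≤ ‖y‖ + ‖y - x‖ := by
    have := norm_sub_le y (y - x)
    rwa [sub_sub_cancel] at this
  have h1 : ‖x‖ ^ 2 ≤ 2 * ‖y‖ ^ 2 + 2 * ‖y - x‖ ^ 2 := by
    nlinarith [norm_nonneg x, sq_nonneg (‖y‖ - ‖y - x‖)]
  have h2 := mul_le_mul_of_nonneg_right (min_le_left a b) (sq_nonneg ‖y‖)
  have h3 := mul_le_mul_of_nonneg_right (min_le_right a b) (sq_nonneg ‖y - x‖)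
  have h4 := mul_le_mul_of_nonneg_left h1 (lt_min ha hb).le
  nlinarith [mul_nonneg (lt_min ha hb).le (sq_nonneg ‖y - x‖)]

theorem integrable_and_integral_partialD_le {h k : ℝ} (hh : 0 < h) (hk : 0 < k)
    {φ γ : EuclideanSpace ℝ (Fin d) → ℂ} (hφc : ContDiff ℝ (⊤ : ℕ∞) φ)
    (hγc : ContDiff ℝ (⊤ : ℕ∞) γ) (hφ : gsNorm (1 / 2) h φ < ∞) (hγ : gsNorm (1 / 2) k γ < ∞)
    (i : Fin d) (n : ℕ) (x : EuclideanSpace ℝ (Fin d)) :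
    Integrable ((partialD i)^[n] (fun y => φ y * γ (y - x))) ∧
    ∫ y, ‖(partialD i)^[n] (fun y => φ y * γ (y - x)) y‖ ≤
      (4 * (gsNorm (1 / 2) h φ).toReal * (gsNorm (1 / 2) k γ).toReal *
        (∫ y : EuclideanSpace ℝ (Fin d), Real.exp (-(min (gsRate d h) (gsRate d k) / 2) * ‖y‖ ^ 2)) *
        Real.exp (-(min (gsRate d h) (gsRate d k) / 4) * ‖x‖ ^ 2)) * (h + k) ^ n *
        Real.sqrt n.factorial := by
  set m := min (gsRate d h) (gsRate d k)
  have hm : 0 < m := lt_min (gsRate_pos hh) (gsRate_pos hk)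
  set D := 4 * (gsNorm (1 / 2) h φ).toReal * (gsNorm (1 / 2) k γ).toReal * (h + k) ^ n *
        Real.sqrt n.factorial with hD
  have hD0 : 0 ≤ D := by positivity
  have hbd : ∀ y, ‖(partialD i)^[n] (fun y => φ y * γ (y - x)) y‖ ≤
      (D * Real.exp (-(m / 4) * ‖x‖ ^ 2)) * Real.exp (-(m / 2) * ‖y‖ ^ 2) := fun y => by
    refine (norm_partialD_mul_translate_le hh hk hφc hγc hφ hγ i n x y).trans ?_
    rw [mul_assoc D]
    exact mul_le_mul_of_nonneg_left
      (exp_mul_exp_translate_le (gsRate_pos hh) (gsRate_pos hk) x y) hD0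
  have hg := (integrable_exp_neg_mul_sq (d := d) (ε := m / 2) (by positivity)).const_mul
    (D * Real.exp (-(m / 4) * ‖x‖ ^ 2))
  have hPc : ContDiff ℝ (⊤ : ℕ∞) fun y => φ y * γ (y - x) :=
    hφc.mul (hγc.comp (contDiff_id.sub contDiff_const))
  have hint : Integrable ((partialD i)^[n] (fun y => φ y * γ (y - x))) :=
    hg.mono' (partialD_iterate_contDiff hPc i n).continuous.aestronglyMeasurable
      (Filter.Eventually.of_forall hbd)
  refine ⟨hint, (integral_mono hint.norm hg hbd).trans (le_of_eq ?_)⟩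
  rw [integral_const_mul, hD]
  ring

/-- Decay in `x` comes from the separation of the two Gaussian profiles. Decay in `w` comes from the
`√(n!)` growth of the derivatives, which become moment bounds for the Fourier transform. -/
theorem norm_fourier_mul_translate_le {h k : ℝ} (hh : 0 < h) (hk : 0 < k)
    {φ γ : EuclideanSpace ℝ (Fin d) → ℂ} (hφc : ContDiff ℝ (⊤ : ℕ∞) φ)
    (hγc : ContDiff ℝ (⊤ : ℕ∞) γ) (hφ : gsNorm (1 / 2) h φ < ∞) (hγ : gsNorm (1 / 2) k γ < ∞)
    (x w : EuclideanSpace ℝ (Fin d)) :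
    ‖𝓕 (fun y => φ y * γ (y - x)) w‖ ≤ 2 * (4 * (gsNorm (1 / 2) h φ).toReal *
        (gsNorm (1 / 2) k γ).toReal *
        (∫ y : EuclideanSpace ℝ (Fin d), Real.exp (-(min (gsRate d h) (gsRate d k) / 2) * ‖y‖ ^ 2)) *
        Real.exp (-(min (gsRate d h) (gsRate d k) / 4) * ‖x‖ ^ 2)) *
      Real.exp (-gsRate d (h + k) * ‖w‖ ^ 2) := by
  have hPc : ContDiff ℝ (⊤ : ℕ∞) fun y => φ y * γ (y - x) :=
    hφc.mul (hγc.comp (contDiff_id.sub contDiff_const))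
  refine le_exp_neg_of_moments (norm_nonneg _) (by positivity) w ?_ fun i n => ?_
  · refine (VectorFourier.norm_fourierIntegral_le_integral_norm _ _ _ _ _).trans ?_
    have hbd : ∀ y, ‖φ y * γ (y - x)‖ ≤ (4 * (gsNorm (1 / 2) h φ).toReal *
        (gsNorm (1 / 2) k γ).toReal *
        Real.exp (-(min (gsRate d h) (gsRate d k) / 4) * ‖x‖ ^ 2)) *
          Real.exp (-(min (gsRate d h) (gsRate d k) / 2) * ‖y‖ ^ 2) := fun y => by
      rw [norm_mul]
      calc _ ≤ (2 * (gsNorm (1 / 2) h φ).toReal * Real.exp (-gsRate d h * ‖y‖ ^ 2)) *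
            (2 * (gsNorm (1 / 2) k γ).toReal * Real.exp (-gsRate d k * ‖y - x‖ ^ 2)) :=
          mul_le_mul (norm_le_gsNorm_mul_exp hh hφ y) (norm_le_gsNorm_mul_exp hk hγ _)
            (norm_nonneg _) (by positivity)
        _ = 4 * (gsNorm (1 / 2) h φ).toReal * (gsNorm (1 / 2) k γ).toReal *
            (Real.exp (-gsRate d h * ‖y‖ ^ 2) * Real.exp (-gsRate d k * ‖y - x‖ ^ 2)) := by ring
        _ ≤ _ := by
          rw [mul_assoc (4 * _ * _)]
          exact mul_le_mul_of_nonneg_left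
            (exp_mul_exp_translate_le (gsRate_pos hh) (gsRate_pos hk) x y) (by positivity)
    have hg := (integrable_exp_neg_mul_sq (d := d) (ε := min (gsRate d h) (gsRate d k) / 2)
      (half_pos (lt_min (gsRate_pos hh) (gsRate_pos hk)))).const_mul
      (4 * (gsNorm (1 / 2) h φ).toReal * (gsNorm (1 / 2) k γ).toReal *
        Real.exp (-(min (gsRate d h) (gsRate d k) / 4) * ‖x‖ ^ 2))
    refine (integral_mono_of_nonneg (Filter.Eventually.of_forall fun y => norm_nonneg _) hg
      (Filter.Eventually.of_forall hbd)).trans (le_of_eq ?_)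
    rw [integral_const_mul]
    ring
  · have H := fun n => integrable_and_integral_partialD_le hh hk hφc hγc hφ hγ i n x
    exact (pow_mul_norm_fourier_le hPc i (fun n => (H n).1) n w).trans (H n).2

end fourierDecay

/-! ### Superpositions of Gaussian atoms by Fourier inversion. -/

section gaborExpansion

open scoped FourierTransform

variable {d : ℕ}

theorem gaussWindow_eq_stftAtom : gaussWindow d = stftAtom 0 0 := by
  funext y
  simp [stftAtom, gaussWindow, -Complex.ofReal_mul, Complex.conj_ofReal]

theorem gaussWindow_mem : gaussWindow d ∈ GelfandShilov d (1 / 2) :=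
  gaussWindow_eq_stftAtom (d := d) ▸ stftAtom_mem 0 0

theorem norm_gaussWindow_le (y : EuclideanSpace ℝ (Fin d)) :
    ‖gaussWindow d y‖ ≤ Real.pi ^ (-(d : ℝ) / 4) := by
  rw [gaussWindow, Complex.norm_real, Real.norm_of_nonneg (by positivity)]
  refine mul_le_of_le_one_right (by positivity) ?_
  rw [Real.exp_le_one_iff]
  have := sq_nonneg ‖y‖
  linarith

theorem stftAtom_eq (x ξ y : EuclideanSpace ℝ (Fin d)) :
    stftAtom x ξ y = gaussWindow d (y - x) * Complex.exp (-Complex.I * ((inner ℝ y ξ : ℝ) : ℂ)) := by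
  rw [stftAtom, gaussWindow, Complex.conj_ofReal]

theorem norm_stftAtom_le (x ξ y : EuclideanSpace ℝ (Fin d)) :
    ‖stftAtom x ξ y‖ ≤ Real.pi ^ (-(d : ℝ) / 4) := by
  rw [stftAtom_eq, norm_mul, show -Complex.I * ((inner ℝ y ξ : ℝ) : ℂ) =
    ((-inner ℝ y ξ : ℝ) : ℂ) * Complex.I by push_cast; ring, Complex.norm_exp_ofReal_mul_I, mul_one]
  exact norm_gaussWindow_le _

theorem continuous_stftAtom (y : EuclideanSpace ℝ (Fin d)) :
    Continuous fun q : EuclideanSpace ℝ (Fin d) × EuclideanSpace ℝ (Fin d) =>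
      stftAtom q.1 (-(2 * Real.pi) • q.2) y := by
  simp only [stftAtom_eq, gaussWindow]
  fun_prop

theorem integral_gaussWindow_sq (y : EuclideanSpace ℝ (Fin d)) :
    ∫ x, gaussWindow d (y - x) * gaussWindow d (y - x) = 1 := by
  rw [integral_sub_left_eq_self (fun x => gaussWindow d x * gaussWindow d x) volume y]
  have e : ∀ x : EuclideanSpace ℝ (Fin d), gaussWindow d x * gaussWindow d x =
      ((Real.pi ^ (-(d : ℝ) / 2) * Real.exp (-1 * ‖x‖ ^ 2) : ℝ) : ℂ) := by
    intro x
    rw [gaussWindow, ← Complex.ofReal_mul, mul_mul_mul_comm, ← Real.rpow_add Real.pi_pos,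
      ← Real.exp_add]
    congr 3 <;> ring
  simp only [e]
  rw [integral_complex_ofReal, integral_const_mul,
    GaussianFourier.integral_rexp_neg_mul_sq_norm one_pos, div_one, ← Real.rpow_add Real.pi_pos,
    finrank_euclideanSpace_fin, neg_div, neg_add_cancel, Real.rpow_zero, Complex.ofReal_one]

theorem integrable_exp_neg_mul_sq_prod {ε : ℝ} (hε : 0 < ε) :
    Integrable fun q : EuclideanSpace ℝ (Fin d) × EuclideanSpace ℝ (Fin d) =>
      Real.exp (-ε * (‖q.1‖ ^ 2 + ‖q.2‖ ^ 2)) := by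
  have h := (integrable_exp_neg_mul_sq (d := d) hε).mul_prod (integrable_exp_neg_mul_sq (d := d) hε)
  refine h.congr (Filter.Eventually.of_forall fun q => ?_)
  simp only [← Real.exp_add]
  congr 1
  ring

/-- Elements of `𝒮_{1/2,h}` are superpositions of Gaussian atoms with Gaussian coefficients. -/
theorem exists_gabor_expansion {h : ℝ} (hh : 0 < h) : ∃ ε C : ℝ, 0 < ε ∧ 0 ≤ C ∧
    ∀ φ : EuclideanSpace ℝ (Fin d) → ℂ, ContDiff ℝ (⊤ : ℕ∞) φ → gsNorm (1 / 2) h φ < ∞ →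
      ∃ c : EuclideanSpace ℝ (Fin d) × EuclideanSpace ℝ (Fin d) → ℂ, StronglyMeasurable c ∧
        (∀ q, ‖c q‖ ≤ C * (gsNorm (1 / 2) h φ).toReal *
          Real.exp (-ε * (‖q.1‖ ^ 2 + ‖q.2‖ ^ 2))) ∧
        ∀ y, φ y = ∫ q, c q * stftAtom q.1 (-(2 * Real.pi) • q.2) y := by
  obtain ⟨hgc, k, hk, hgk⟩ := gaussWindow_mem (d := d)
  set m := min (gsRate d h) (gsRate d k)
  have hm : 0 < m := lt_min (gsRate_pos hh) (gsRate_pos hk)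
  set ε := min (m / 4) (gsRate d (h + k))
  have hε : 0 < ε := lt_min (by positivity) (gsRate_pos (by positivity))
  set J := ∫ y : EuclideanSpace ℝ (Fin d), Real.exp (-(m / 2) * ‖y‖ ^ 2)
  have hJ : 0 ≤ J := integral_nonneg fun _ => (Real.exp_pos _).le
  refine ⟨ε, 8 * (gsNorm (1 / 2) k (gaussWindow d)).toReal * J, hε, by positivity,
    fun φ hφc hφ => ?_⟩
  set A := (gsNorm (1 / 2) h φ).toReal
  -- Fourier inversion in `w` recovers `φ(y) γ(y - x)`, where `γ` is the window; multiplying by `γ(y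
  -- - x)` and integrating in `x` recovers `φ(y)`, as `γ` is real with `L²` norm `1`. The frequency
  -- `-2π w` translates between the two normalisations of the exponential.
  set c : EuclideanSpace ℝ (Fin d) × EuclideanSpace ℝ (Fin d) → ℂ :=
    fun q => 𝓕 (fun y => φ y * gaussWindow d (y - q.1)) q.2 with hc
  have hφcont := hφc.continuous
  have hgcont := hgc.continuous
  have hcm : StronglyMeasurable c := by
    simp only [hc, Real.fourier_eq']
    refine StronglyMeasurable.integral_prod_right (Continuous.stronglyMeasurable ?_)
    simp only [Function.uncurry_def]
    fun_prop
  have hcb0 : ∀ q, ‖c q‖ ≤ (8 * (gsNorm (1 / 2) k (gaussWindow d)).toReal * J * A) *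
      (Real.exp (-ε * ‖q.1‖ ^ 2) * Real.exp (-ε * ‖q.2‖ ^ 2)) := fun q => by
    have h1 := norm_fourier_mul_translate_le hh hk hφc hgc hφ hgk q.1 q.2
    calc _ ≤ _ := h1
      _ = (8 * (gsNorm (1 / 2) k (gaussWindow d)).toReal * J * A) *
        (Real.exp (-(m / 4) * ‖q.1‖ ^ 2) * Real.exp (-gsRate d (h + k) * ‖q.2‖ ^ 2)) := by ring
      _ ≤ _ := by
        gcongr
        · exact min_le_left _ _
        · exact min_le_right _ _
  refine ⟨c, hcm, fun q => ?_, fun y => ?_⟩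
  · rw [mul_add, Real.exp_add]
    exact hcb0 q
  · have hcint : Integrable c := by
      refine ((integrable_exp_neg_mul_sq_prod (d := d) hε).const_mul
        (8 * (gsNorm (1 / 2) k (gaussWindow d)).toReal * J * A)).mono' hcm.aestronglyMeasurable
        (Filter.Eventually.of_forall fun q => ?_)
      rw [mul_add, Real.exp_add]
      exact hcb0 q
    have hint : Integrable fun q : EuclideanSpace ℝ (Fin d) × EuclideanSpace ℝ (Fin d) =>
        c q * stftAtom q.1 (-(2 * Real.pi) • q.2) y :=
      hcint.mul_bdd (c := Real.pi ^ (-(d : ℝ) / 4)) (continuous_stftAtom y).aestronglyMeasurable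
        (Filter.Eventually.of_forall fun q => norm_stftAtom_le _ _ _)
    rw [Measure.volume_eq_prod, integral_prod _ hint]
    have hinner : ∀ x, ∫ w, c (x, w) * stftAtom x (-(2 * Real.pi) • w) y =
        φ y * (gaussWindow d (y - x) * gaussWindow d (y - x)) := by
      intro x
      have hPc : Continuous fun y => φ y * gaussWindow d (y - x) := by fun_prop
      have hPi : Integrable fun y => φ y * gaussWindow d (y - x) := by
        refine Integrable.mul_bdd (c := Real.pi ^ (-(d : ℝ) / 4)) ?_
          (Continuous.aestronglyMeasurable (by fun_prop))
          (Filter.Eventually.of_forall fun y => norm_gaussWindow_le _)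
        exact ((integrable_exp_neg_mul_sq (d := d) (gsRate_pos hh)).const_mul (2 * A)).mono'
          hφcont.aestronglyMeasurable
          (Filter.Eventually.of_forall fun y => norm_le_gsNorm_mul_exp hh hφ y)
      have hFi : Integrable (𝓕 fun y => φ y * gaussWindow d (y - x)) := by
        refine ((integrable_exp_neg_mul_sq (d := d) hε).const_mul
          ((8 * (gsNorm (1 / 2) k (gaussWindow d)).toReal * J * A) *
            Real.exp (-ε * ‖x‖ ^ 2))).mono' ?_ (Filter.Eventually.of_forall fun w => ?_)
        · exact (hcm.comp_measurable measurable_prodMk_left).aestronglyMeasurable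
        · rw [mul_assoc]
          exact hcb0 (x, w)
      have h1 := congrFun (hPc.fourierInv_fourier_eq hPi hFi) y
      rw [Real.fourierInv_eq'] at h1
      rw [← mul_assoc, ← h1, ← integral_mul_const]
      refine integral_congr_ae (Filter.Eventually.of_forall fun w => ?_)
      simp only [hc, stftAtom_eq, smul_eq_mul, inner_smul_right, real_inner_comm w y]
      rw [show -Complex.I * ((-(2 * Real.pi) * inner ℝ w y : ℝ) : ℂ) =
        ((2 * Real.pi * inner ℝ w y : ℝ) : ℂ) * Complex.I by push_cast; ring]
      ring
    simp only [hinner]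
    rw [integral_const_mul, integral_gaussWindow_sq, mul_one]

end gaborExpansion

/-! ### Reconstruction of distributions from their values on atoms. -/

section reconstruction

variable {d : ℕ}

theorem gsNorm_anti {s h h' : ℝ} (hh : 0 < h) (hle : h ≤ h') (φ : EuclideanSpace ℝ (Fin d) → ℂ) :
    gsNorm s h' φ ≤ gsNorm s h φ := by
  refine iSup_mono fun α => iSup_mono fun β => iSup_mono fun x => ENNReal.ofReal_le_ofReal ?_
  exact div_le_div_of_nonneg_left (by positivity) (gsDenom_pos hh _ _) (gsDenom_mono hh hle α β)

/-- Immediate from the tensor form of the atoms; no commutation of mixed partial derivatives is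
required. -/
theorem partialD_multiD_stftAtom (x ξ : EuclideanSpace ℝ (Fin d)) (α : Fin d → ℕ) (i : Fin d) :
    partialD i (multiD α (stftAtom x ξ)) = multiD (α + Pi.single i 1) (stftAtom x ξ) := by
  have hu : ∀ j : Fin d, ContDiff ℝ (⊤ : ℕ∞) (fun t : ℝ => gEntire (x j) (ξ j) t) :=
    fun j => gEntire_real_contDiff _ _
  rw [stftAtom_eq_tens, multiD_tens _ hu, multiD_tens _ hu,
    partialD_tens _ fun j => deriv_iter_contDiff (hu j) _]
  congr 1
  funext j
  by_cases hj : j = i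
  · subst hj
    simp [Function.iterate_succ_apply']
  · simp [hj]

theorem gsCoord_zero_right (h : ℝ) (φ : EuclideanSpace ℝ (Fin d) → ℂ) (α : Fin d → ℕ)
    (y : EuclideanSpace ℝ (Fin d)) :
    gsCoord h φ (α, 0, y) = multiD α φ y / ((gsDenom (1 / 2) h α 0 : ℝ) : ℂ) := by
  simp [gsCoord]

/-- Differentiation under the integral sign. -/
theorem partialD_integral {Q : Type*} [MeasurableSpace Q] {μ : Measure Q}
    {G : EuclideanSpace ℝ (Fin d) → ℂ} {T : Q → EuclideanSpace ℝ (Fin d) → ℂ} {b : Q → ℝ}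
    {i : Fin d} (hG : ContDiff ℝ (⊤ : ℕ∞) G) (hT : ∀ q, ContDiff ℝ (⊤ : ℕ∞) (T q))
    (hi : ∀ y, Integrable (fun q => T q y) μ)
    (hm : ∀ y, AEStronglyMeasurable (fun q => partialD i (T q) y) μ)
    (hb : ∀ q y, ‖partialD i (T q) y‖ ≤ b q) (hbi : Integrable b μ)
    (h : ∀ y, G y = ∫ q, T q y ∂μ) (y : EuclideanSpace ℝ (Fin d)) :
    partialD i G y = ∫ q, partialD i (T q) y ∂μ := by
  have hline : ∀ t : ℝ, HasDerivAt (fun t : ℝ => y + t • (EuclideanSpace.single i (1 : ℝ)))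
      (EuclideanSpace.single i (1 : ℝ)) t := fun t => by
    simpa using ((hasDerivAt_id t).smul_const (EuclideanSpace.single i (1 : ℝ))).const_add y
  have hder : ∀ F : EuclideanSpace ℝ (Fin d) → ℂ, ContDiff ℝ (⊤ : ℕ∞) F → ∀ t : ℝ,
      HasDerivAt (fun t : ℝ => F (y + t • (EuclideanSpace.single i (1 : ℝ))))
        (partialD i F (y + t • (EuclideanSpace.single i (1 : ℝ)))) t := fun F hF t =>
    (hF.differentiable (by simp) _).hasFDerivAt.comp_hasDerivAt t (hline t)
  have h1 := (hasDerivAt_integral_of_dominated_loc_of_deriv_le (μ := μ) (𝕜 := ℝ) (x₀ := 0)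
    (s := Set.univ) (bound := b)
    (F := fun t q => T q (y + t • (EuclideanSpace.single i (1 : ℝ))))
    (F' := fun t q => partialD i (T q) (y + t • (EuclideanSpace.single i (1 : ℝ))))
    Filter.univ_mem (Filter.Eventually.of_forall fun t => (hi _).aestronglyMeasurable) (hi _)
    (hm _) (Filter.Eventually.of_forall fun q t _ => hb q _) hbi
    (Filter.Eventually.of_forall fun q t _ => hder (T q) (hT q) t)).2
  have h2 := hder G hG 0
  simp only [h (_ + _)] at h2
  have h3 := h2.unique h1
  simpa using h3

/-- Superpositions of atoms may be differentiated termwise. -/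
theorem multiD_superposition {h : ℝ} (hh : 0 < h)
    {x ξ : EuclideanSpace ℝ (Fin d) × EuclideanSpace ℝ (Fin d) → EuclideanSpace ℝ (Fin d)}
    (ha : ∀ q, gsAtom (x q) (ξ q) ∈ gsSub d hh)
    {c : EuclideanSpace ℝ (Fin d) × EuclideanSpace ℝ (Fin d) → ℂ}
    (hci : Integrable fun q => c q • gsVec d hh ⟨gsAtom (x q) (ξ q), ha q⟩)
    {φ : EuclideanSpace ℝ (Fin d) → ℂ} (hφ : ContDiff ℝ (⊤ : ℕ∞) φ)
    (h0 : ∀ y, φ y = ∫ q, c q * stftAtom (x q) (ξ q) y) (α : Fin d → ℕ)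
    (y : EuclideanSpace ℝ (Fin d)) :
    multiD α φ y = ∫ q, c q * multiD α (stftAtom (x q) (ξ q)) y := by
  have hcoord : ∀ (β : Fin d → ℕ) q y, c q * multiD β (stftAtom (x q) (ξ q)) y =
      gsDenom (1 / 2) h β 0 * (c q • gsVec d hh ⟨gsAtom (x q) (ξ q), ha q⟩) (β, 0, y) := by
    intro β q y
    rw [lp.coeFn_smul, Pi.smul_apply, gsVec_apply, gsCoord_zero_right, smul_eq_mul]
    have : ((gsDenom (1 / 2) h β 0 : ℝ) : ℂ) ≠ 0 :=
      Complex.ofReal_ne_zero.2 (gsDenom_pos hh _ _).ne'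
    field_simp
    rfl
  have hbd : ∀ (β : Fin d → ℕ) q y, ‖c q * multiD β (stftAtom (x q) (ξ q)) y‖ ≤
      gsDenom (1 / 2) h β 0 * ‖c q • gsVec d hh ⟨gsAtom (x q) (ξ q), ha q⟩‖ := by
    intro β q y
    rw [hcoord, norm_mul, Complex.norm_real, Real.norm_of_nonneg (gsDenom_pos hh _ _).le]
    exact mul_le_mul_of_nonneg_left (lp.norm_apply_le_norm ENNReal.top_ne_zero _ _)
      (gsDenom_pos hh _ _).le
  have hint : ∀ (β : Fin d → ℕ) y, Integrable fun q =>
      c q * multiD β (stftAtom (x q) (ξ q)) y := by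
    intro β y
    simp only [hcoord]
    exact ((lp.evalCLM ℂ (fun _ : GSIndex d => ℂ) ∞ (β, 0, y)).integrable_comp hci).const_mul _
  -- The induction carries along that `T q` is some derivative of the atom: its product with `c q`
  -- is then a multiple of a coordinate of an integrable `ℓ^∞`-valued function, whose norm is a
  -- majorant independent of `y`.
  let Rep (G : EuclideanSpace ℝ (Fin d) → ℂ)
      (T : EuclideanSpace ℝ (Fin d) × EuclideanSpace ℝ (Fin d) → EuclideanSpace ℝ (Fin d) → ℂ) :
      Prop := ContDiff ℝ (⊤ : ℕ∞) G ∧ (∃ β, ∀ q, T q = multiD β (stftAtom (x q) (ξ q))) ∧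
        ∀ y, G y = ∫ q, c q * T q y
  have hstep : ∀ (i : Fin d) G T, Rep G T → Rep (partialD i G) (fun q => partialD i (T q)) := by
    rintro i G T ⟨hG, ⟨β, hβ⟩, hGT⟩
    have e : ∀ q, partialD i (T q) = multiD (β + Pi.single i 1) (stftAtom (x q) (ξ q)) :=
      fun q => by rw [hβ, partialD_multiD_stftAtom]
    have hTc : ∀ q, ContDiff ℝ (⊤ : ℕ∞) (T q) := fun q => by
      rw [hβ]
      exact listD_contDiff _ _ (stftAtom_mem _ _).1
    have hp : ∀ q, partialD i (fun y => c q * T q y) = fun y => c q * partialD i (T q) y := by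
      intro q
      funext y
      have := ((hTc q).differentiable (by simp) y).hasFDerivAt.const_mul (c q)
      simp only [partialD]
      rw [this.fderiv]
      rfl
    refine ⟨partialD_contDiff hG i, ⟨_, e⟩, fun y => ?_⟩
    rw [partialD_integral (T := fun q y => c q * T q y) hG (fun q => contDiff_const.mul (hTc q))
      (b := fun q => gsDenom (1 / 2) h (β + Pi.single i 1) 0 *
        ‖c q • gsVec d hh ⟨gsAtom (x q) (ξ q), ha q⟩‖) ?_ ?_ ?_ (hci.norm.const_mul _) hGT]
    · simp only [hp]
    · intro y
      simp only [hβ]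
      exact hint β y
    · intro y
      simp only [hp, e]
      exact (hint _ y).aestronglyMeasurable
    · intro q y
      rw [hp, e]
      exact hbd _ q y
  have hiter : ∀ (i : Fin d) (k : ℕ) G T, Rep G T →
      Rep ((partialD i)^[k] G) (fun q => (partialD i)^[k] (T q)) := by
    intro i k
    induction k with
    | zero => exact fun G T hR => hR
    | succ k ih =>
      intro G T hR
      simp only [Function.iterate_succ_apply']
      exact hstep i _ _ (ih G T hR)
  have hlist : ∀ l : List (Fin d), Rep (listD α l φ)
      (fun q => listD α l (stftAtom (x q) (ξ q))) := by
    intro l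
    induction l with
    | nil => exact ⟨hφ, ⟨0, fun q => (multiD_const_zero _).symm⟩, h0⟩
    | cons i l ih => exact hiter i (α i) _ _ ih
  exact (hlist _).2.2 y

/-- Since `(2π)² ≤ 40`, a growth of rate `ε / 80` in the atoms costs at most half of the decay `ε`
of the coefficients. -/
theorem sq_weight_le {ε δ : ℝ} (hε : 0 < ε) (hδ : δ ≤ ε / 80) (x w : EuclideanSpace ℝ (Fin d)) :
    -ε * (‖x‖ ^ 2 + ‖w‖ ^ 2) + δ * (‖x‖ ^ 2 + ‖-(2 * Real.pi) • w‖ ^ 2) ≤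
      -(ε / 2) * (‖x‖ ^ 2 + ‖w‖ ^ 2) := by
  have h1 : ‖-(2 * Real.pi) • w‖ ^ 2 ≤ 40 * ‖w‖ ^ 2 := by
    rw [norm_smul, mul_pow, norm_neg, Real.norm_of_nonneg (by positivity)]
    gcongr
    nlinarith [Real.pi_lt_d2, Real.pi_pos]
  have h2 : ‖x‖ ^ 2 + ‖-(2 * Real.pi) • w‖ ^ 2 ≤ 40 * (‖x‖ ^ 2 + ‖w‖ ^ 2) := by
    nlinarith [sq_nonneg ‖x‖]
  have h3 : δ * (‖x‖ ^ 2 + ‖-(2 * Real.pi) • w‖ ^ 2) ≤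
      ε / 80 * (40 * (‖x‖ ^ 2 + ‖w‖ ^ 2)) :=
    mul_le_mul hδ h2 (by positivity) (by positivity)
  linarith

/-- Distributions act on `𝒮_{1/2,h}` through their short-time Fourier transforms. -/
theorem exists_reconstruction {h : ℝ} (hh : 0 < h) : ∃ ε C : ℝ, 0 < ε ∧ 0 ≤ C ∧
    ∀ φ : GelfandShilov d (1 / 2), gsNorm (1 / 2) h φ.1 < ∞ →
      ∃ c : EuclideanSpace ℝ (Fin d) × EuclideanSpace ℝ (Fin d) → ℂ,
        (∀ q, ‖c q‖ ≤ C * (gsNorm (1 / 2) h φ.1).toReal *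
          Real.exp (-ε * (‖q.1‖ ^ 2 + ‖q.2‖ ^ 2))) ∧
        ∀ f : GelfandShilovDual d (1 / 2), (f : Module.Dual ℂ (GelfandShilov d (1 / 2))) φ =
          ∫ q, c q * (f : Module.Dual ℂ (GelfandShilov d (1 / 2)))
            (gsAtom q.1 (-(2 * Real.pi) • q.2)) := by
  obtain ⟨ε, C, hε, hC, H⟩ := exists_gabor_expansion (d := d) hh
  refine ⟨ε, C, hε, hC, fun φ hφ => ?_⟩
  obtain ⟨c, hcm, hcb, hrep⟩ := H φ.1 φ.2.1 hφ
  refine ⟨c, hcb, fun f => ?_⟩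
  -- The atoms live in a larger space `𝒮_{1/2,k}` with `k ≥ h`, chosen so that their norms grow
  -- slower than the coefficients decay. The extension `g` of `f` to the corresponding `ℓ^∞` enters
  -- only the identity, so the bounds on `c` do not involve `f`.
  obtain ⟨k, D, hk, ha, -, hhk, hbd, -, hcont⟩ := exists_gsVec_bound (d := d)
    (δ := min (1 / 4) (ε / 80)) (by positivity) (min_le_left _ _) h
  obtain ⟨g, hg⟩ := exists_clm_extension hk f
  have hvc : Continuous fun q : EuclideanSpace ℝ (Fin d) × EuclideanSpace ℝ (Fin d) =>
      gsVec d hk ⟨gsAtom q.1 (-(2 * Real.pi) • q.2), ha q.1 (-(2 * Real.pi) • q.2)⟩ :=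
    hcont.comp (f := fun q : EuclideanSpace ℝ (Fin d) × EuclideanSpace ℝ (Fin d) =>
      (q.1, -(2 * Real.pi) • q.2)) (by fun_prop)
  have hD : 0 ≤ D := by
    have := (norm_nonneg _).trans (hbd 0 0)
    simpa using this
  have hci : Integrable fun q : EuclideanSpace ℝ (Fin d) × EuclideanSpace ℝ (Fin d) =>
      c q • gsVec d hk ⟨gsAtom q.1 (-(2 * Real.pi) • q.2), ha q.1 (-(2 * Real.pi) • q.2)⟩ := by
    refine ((integrable_exp_neg_mul_sq_prod (d := d) (half_pos hε)).const_mul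
      (C * (gsNorm (1 / 2) h φ.1).toReal * D)).mono'
      (hcm.aestronglyMeasurable.smul hvc.aestronglyMeasurable)
      (Filter.Eventually.of_forall fun q => ?_)
    rw [norm_smul]
    calc _ ≤ (C * (gsNorm (1 / 2) h φ.1).toReal * Real.exp (-ε * (‖q.1‖ ^ 2 + ‖q.2‖ ^ 2))) *
          (D * Real.exp (min (1 / 4) (ε / 80) *
            (‖q.1‖ ^ 2 + ‖-(2 * Real.pi) • q.2‖ ^ 2))) :=
          mul_le_mul (hcb q) (hbd _ _) (norm_nonneg _) (by positivity)
      _ = (C * (gsNorm (1 / 2) h φ.1).toReal * D) *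
          Real.exp (-ε * (‖q.1‖ ^ 2 + ‖q.2‖ ^ 2) + min (1 / 4) (ε / 80) *
            (‖q.1‖ ^ 2 + ‖-(2 * Real.pi) • q.2‖ ^ 2)) := by
          rw [Real.exp_add]
          ring
      _ ≤ _ := by
          gcongr
          exact sq_weight_le hε (min_le_right _ _) q.1 q.2
  -- The pointwise expansion of `φ` is lifted to an identity in `ℓ^∞` by termwise differentiation;
  -- `g` then passes through the Bochner integral.
  have hv : gsVec d hk ⟨φ, (gsNorm_anti hh hhk φ.1).trans_lt hφ⟩ = ∫ q,
      c q • gsVec d hk ⟨gsAtom q.1 (-(2 * Real.pi) • q.2), ha q.1 (-(2 * Real.pi) • q.2)⟩ := by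
    ext ⟨α, β, y⟩
    have h1 := (lp.evalCLM ℂ (fun _ : GSIndex d => ℂ) ∞ (α, β, y)).integral_comp_comm hci
    refine Eq.trans ?_ h1
    have h2 := multiD_superposition hk (x := fun q => q.1) (ξ := fun q => -(2 * Real.pi) • q.2)
      (fun q => ha _ _) hci φ.2.1 hrep α y
    rw [gsVec_apply, gsCoord]
    dsimp only
    rw [h2, mul_div_right_comm, ← integral_const_mul]
    refine integral_congr_ae (Filter.Eventually.of_forall fun q => ?_)
    change _ = c q * gsCoord k (stftAtom q.1 (-(2 * Real.pi) • q.2)) (α, β, y)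
    rw [gsCoord]
    ring
  rw [← hg ⟨φ, (gsNorm_anti hh hhk φ.1).trans_lt hφ⟩, hv, ← g.integral_comp_comm hci]
  refine integral_congr_ae (Filter.Eventually.of_forall fun q => ?_)
  simp only [map_smul, smul_eq_mul]
  rw [hg ⟨_, ha _ _⟩]

end reconstruction

/-! ### Modulation spaces -/

section modulation

variable {d : ℕ} {ω : Phase d → ℝ}

theorem MixedSpace.one_le_quasiConst {ι : Type} [Fintype ι] (B : MixedSpace ι) :
    1 ≤ B.quasiConst := by
  refine Finset.one_le_prod' fun j _ => ?_
  unfold ENNReal.LpAddConst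
  split_ifs with h
  · refine ENNReal.one_le_rpow (by norm_num) ?_
    have h1 : (B.p j).toReal < 1 := by
      simpa using (ENNReal.toReal_lt_toReal h.2.ne_top ENNReal.one_ne_top).2 h.2
    have h0 : 0 < (B.p j).toReal := ENNReal.toReal_pos h.1.ne' h.2.ne_top
    rw [sub_pos]
    exact one_lt_one_div h0 h1
  · exact le_rfl

/-- Elements of `M(ω, ℬ)` have subgaussian short-time Fourier transforms. -/
theorem exists_enorm_stft_le (hω : WeightPQ0 ω) (B : MixedSpace (Fin d ⊕ Fin d)) {δ : ℝ}
    (hδ : 0 < δ) : ∃ C : ℝ≥0∞, C ≠ ∞ ∧ ∀ (f : GelfandShilovDual d (1 / 2)) (X : Phase d),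
      ‖stft f X‖ₑ ≤ C * ENNReal.ofReal (Real.exp (δ * ‖X‖ ^ 2)) * modNorm ω B f := by
  obtain ⟨C, hC, H⟩ := exists_enorm_bargmannPullback_le B
  -- The bound `(|X| + 2)² ≤ 2|X|² + 8` uses up `δ|X|²/2`; the other half of `δ|X|²` absorbs the
  -- factor `e^{|X|}`.
  obtain ⟨D, hD, hg⟩ := hω.gauss (δ / 4) (by positivity)
  set K := D * Real.exp (2 * δ + 1 / (2 * δ) + 1)
  refine ⟨C * ENNReal.ofReal K, ENNReal.mul_ne_top hC ENNReal.ofReal_ne_top, fun f X => ?_⟩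
  obtain ⟨F, hF, e⟩ := exists_stft_eq_bargmannPullback f
  have hm : 0 < D⁻¹ * Real.exp (-(δ / 4) * (‖X‖ + 2) ^ 2) := by positivity
  have h1 := H F ω X _ hF hω.isWeight.aemeasurable hm fun Y hY => by
    refine le_trans ?_ (hg Y).1
    have hn : ‖Y‖ ≤ ‖X‖ + 2 := by
      have h1 := norm_le_norm_add_norm_sub' Y X
      rw [Metric.mem_closedBall, dist_eq_norm] at hY
      linarith
    gcongr D⁻¹ * Real.exp ?_
    rw [neg_mul, neg_mul, neg_le_neg_iff]
    gcongr
  rw [← e] at h1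
  refine h1.trans ?_
  rw [mul_assoc C (ENNReal.ofReal K), ← ENNReal.ofReal_mul (by positivity)]
  change _ ≤ C * _ * B.qnorm _
  gcongr
  rw [div_le_iff₀ hm]
  have h2 : Real.exp (‖X‖ + 1) ≤ Real.exp (2 * δ + 1 / (2 * δ) + 1) * Real.exp (δ * ‖X‖ ^ 2) *
      Real.exp (-(δ / 4) * (‖X‖ + 2) ^ 2) := by
    rw [← Real.exp_add, ← Real.exp_add, Real.exp_le_exp]
    have h3 : ‖X‖ ≤ δ / 2 * ‖X‖ ^ 2 + 1 / (2 * δ) := by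
      have : 0 ≤ (δ * ‖X‖ - 1) ^ 2 / (2 * δ) := by positivity
      have e : (δ * ‖X‖ - 1) ^ 2 / (2 * δ) = δ / 2 * ‖X‖ ^ 2 + 1 / (2 * δ) - ‖X‖ := by
        field_simp
        ring
      linarith
    nlinarith [mul_nonneg hδ.le (sq_nonneg (‖X‖ - 2))]
  calc _ ≤ _ := h2
    _ = K * Real.exp (δ * ‖X‖ ^ 2) * (D⁻¹ * Real.exp (-(δ / 4) * (‖X‖ + 2) ^ 2)) := by
      simp only [K]
      field_simp

theorem exists_enorm_gsAtom_le (hω : WeightPQ0 ω) (B : MixedSpace (Fin d ⊕ Fin d)) {δ : ℝ}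
    (hδ : 0 < δ) : ∃ C : ℝ≥0∞, C ≠ ∞ ∧ ∀ (f : GelfandShilovDual d (1 / 2))
      (x ξ : EuclideanSpace ℝ (Fin d)),
      ‖(f : Module.Dual ℂ (GelfandShilov d (1 / 2))) (gsAtom x ξ)‖ₑ ≤
        C * ENNReal.ofReal (Real.exp (δ * (‖x‖ ^ 2 + ‖ξ‖ ^ 2))) * modNorm ω B f := by
  obtain ⟨C, hC, H⟩ := exists_enorm_stft_le hω B hδ
  set κ : ℂ := (((2 * Real.pi) ^ (-(d : ℝ) / 2) : ℝ) : ℂ) with hκ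
  have hκ0 : κ ≠ 0 := Complex.ofReal_ne_zero.2 (by positivity)
  refine ⟨‖κ⁻¹‖ₑ * C, ENNReal.mul_ne_top enorm_ne_top hC, fun f x ξ => ?_⟩
  set X : Phase d := WithLp.toLp 2 (Sum.elim x ξ) with hX
  have hpos : X.pos = x := rfl
  have hfreq : X.freq = ξ := rfl
  have h1 := stft_eq f X
  rw [hpos, hfreq, ← hκ] at h1
  have h2 : (f : Module.Dual ℂ (GelfandShilov d (1 / 2))) (gsAtom x ξ) = κ⁻¹ * stft f X := by
    rw [h1, inv_mul_cancel_left₀ hκ0]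
  rw [h2, enorm_mul, ← hpos, ← hfreq, ← norm_sq_pos_add_freq, mul_assoc, mul_assoc]
  gcongr
  rw [← mul_assoc]
  exact H f X

/-- `M(ω, ℬ)` is continuously embedded in `𝒮_{1/2}'`. -/
theorem exists_enorm_apply_le (hω : WeightPQ0 ω) (B : MixedSpace (Fin d ⊕ Fin d)) {h : ℝ}
    (hh : 0 < h) : ∃ C : ℝ≥0∞, C ≠ ∞ ∧ ∀ (f : GelfandShilovDual d (1 / 2))
      (φ : GelfandShilov d (1 / 2)), gsNorm (1 / 2) h φ.1 < ∞ →
      ‖(f : Module.Dual ℂ (GelfandShilov d (1 / 2))) φ‖ₑ ≤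
        C * gsNorm (1 / 2) h φ.1 * modNorm ω B f := by
  obtain ⟨ε, A, hε, hA, H⟩ := exists_reconstruction (d := d) hh
  obtain ⟨C, hC, hs⟩ := exists_enorm_gsAtom_le hω B (δ := ε / 80) (by positivity)
  set J : ℝ≥0∞ := ∫⁻ q : EuclideanSpace ℝ (Fin d) × EuclideanSpace ℝ (Fin d),
    ENNReal.ofReal (Real.exp (-(ε / 2) * (‖q.1‖ ^ 2 + ‖q.2‖ ^ 2)))
  have hJ : J ≠ ∞ := (integrable_exp_neg_mul_sq_prod (d := d) (half_pos hε)).lintegral_lt_top.ne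
  refine ⟨J * (ENNReal.ofReal A * C), ENNReal.mul_ne_top hJ
    (ENNReal.mul_ne_top ENNReal.ofReal_ne_top hC), fun f φ hφ => ?_⟩
  obtain ⟨c, hcb, hc⟩ := H φ hφ
  rw [hc f]
  refine (enorm_integral_le_lintegral_enorm _).trans ?_
  rw [mul_assoc J, mul_assoc J, ← lintegral_mul_const _ (by fun_prop)]
  refine lintegral_mono fun q => ?_
  rw [enorm_mul]
  have h1 : ‖c q‖ₑ ≤ ENNReal.ofReal A * gsNorm (1 / 2) h φ.1 *
      ENNReal.ofReal (Real.exp (-ε * (‖q.1‖ ^ 2 + ‖q.2‖ ^ 2))) := by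
    rw [← ofReal_norm, ← ENNReal.ofReal_toReal hφ.ne, ← ENNReal.ofReal_mul hA,
      ← ENNReal.ofReal_mul (by positivity)]
    exact ENNReal.ofReal_le_ofReal (hcb q)
  calc _ ≤ (ENNReal.ofReal A * gsNorm (1 / 2) h φ.1 *
        ENNReal.ofReal (Real.exp (-ε * (‖q.1‖ ^ 2 + ‖q.2‖ ^ 2)))) *
        (C * ENNReal.ofReal (Real.exp (ε / 80 * (‖q.1‖ ^ 2 + ‖-(2 * Real.pi) • q.2‖ ^ 2))) *
          modNorm ω B f) := mul_le_mul' h1 (hs f _ _)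
    _ = (ENNReal.ofReal (Real.exp (-ε * (‖q.1‖ ^ 2 + ‖q.2‖ ^ 2))) *
        ENNReal.ofReal (Real.exp (ε / 80 * (‖q.1‖ ^ 2 + ‖-(2 * Real.pi) • q.2‖ ^ 2)))) *
        (ENNReal.ofReal A * C * gsNorm (1 / 2) h φ.1 * modNorm ω B f) := by ring
    _ ≤ _ := by
      rw [← ENNReal.ofReal_mul (by positivity), ← Real.exp_add]
      gcongr
      exact sq_weight_le hε le_rfl q.1 q.2

variable (d) in
/-- The short-time Fourier transform as a linear map. -/
def stftₗ : GelfandShilovDual d (1 / 2) →ₗ[ℂ] (Phase d → ℂ) where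
  toFun := stft
  map_add' f g := by
    funext X
    simp [stft, mul_add]
  map_smul' a f := by
    funext X
    simp only [stft, Submodule.coe_smul, LinearMap.smul_apply, Pi.smul_apply, smul_eq_mul,
      RingHom.id_apply]
    ring

theorem exists_forall_lt_mul_le_ofReal {C a : ℝ≥0∞} (hC : C ≠ ∞) (ha : a < ∞) {ε : ℝ} (hε : 0 < ε) :
    ∃ η : ℝ≥0∞, 0 < η ∧ ∀ t < η, C * a * t ≤ ENNReal.ofReal ε := by
  have hCa : C * a ≠ ∞ := ENNReal.mul_ne_top hC ha.ne
  refine ⟨ENNReal.ofReal ε / (C * a + 1), ENNReal.div_pos (by simpa using hε) (by simp [hCa]),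
    fun t ht => ?_⟩
  calc C * a * t ≤ (C * a + 1) * (ENNReal.ofReal ε / (C * a + 1)) := by
        gcongr
        exact le_self_add
    _ ≤ _ := ENNReal.mul_div_le

/-- The continuous embedding in `𝒮_{1/2}'` gives definiteness and makes a Cauchy sequence converge
on every test function; pairing with atoms then gives pointwise convergence of the transforms. -/
theorem modNorm_complete (hω : WeightPQ0 ω) (B : MixedSpace (Fin d ⊕ Fin d)) {K : ℝ≥0}
    (hK : B.quasiConst = K) : IsCompleteQuasiNormed (modSpace ω B) (modNorm ω B) K := by
  refine isCompleteQuasiNormed_of_pointwise_limits ⊤ (stftₗ d) hω.isWeight.aemeasurable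
    (N := modNorm ω B) (fun f => rfl) (fun f => by simp [modSpace]) ?_ ?_ ?_ hK
  · intro f _
    obtain ⟨F, hF, e⟩ := exists_stft_eq_bargmannPullback f
    change AEMeasurable (stft f)
    rw [e]
    exact (continuous_bargmannPullback hF.continuous).aemeasurable
  · intro f _ h0
    refine Subtype.ext (LinearMap.ext fun φ => ?_)
    obtain ⟨h, hh, hφ⟩ := φ.2.2
    obtain ⟨C, -, hC⟩ := exists_enorm_apply_le hω B hh
    have := hC f φ hφ
    rw [h0, mul_zero] at this
    simpa using this
  · intro u _ hc
    have hcau : ∀ (φ : GelfandShilov d (1 / 2)) (ε : ℝ), 0 < ε → ∃ k₀, ∀ k ≥ k₀, ∀ l ≥ k₀,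
        ‖(u k : Module.Dual ℂ (GelfandShilov d (1 / 2))) φ -
          (u l : Module.Dual ℂ (GelfandShilov d (1 / 2))) φ‖ ≤ ε := by
      intro φ ε hε
      obtain ⟨h, hh, hφ⟩ := φ.2.2
      obtain ⟨C, hCt, hC⟩ := exists_enorm_apply_le hω B hh
      obtain ⟨η, hη, hηb⟩ := exists_forall_lt_mul_le_ofReal hCt hφ hε
      obtain ⟨k₀, hk₀⟩ := hc η hη
      refine ⟨k₀, fun k hk l hl => ?_⟩
      have h1 := (hC (u k - u l) φ hφ).trans (hηb _ (hk₀ k hk l hl))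
      rw [← ofReal_norm] at h1
      exact (ENNReal.ofReal_le_ofReal_iff hε.le).1 h1
    have hex : ∀ φ : GelfandShilov d (1 / 2), ∃ a, Filter.Tendsto
        (fun k => (u k : Module.Dual ℂ (GelfandShilov d (1 / 2))) φ) Filter.atTop (nhds a) :=
      fun φ => by
      refine cauchySeq_tendsto_of_complete (Metric.cauchySeq_iff.2 fun ε hε => ?_)
      obtain ⟨k₀, hk₀⟩ := hcau φ (ε / 2) (by positivity)
      refine ⟨k₀, fun k hk l hl => ?_⟩
      rw [dist_eq_norm]
      linarith [hk₀ k hk l hl]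
    choose F hF using hex
    let f : Module.Dual ℂ (GelfandShilov d (1 / 2)) :=
      { toFun := F
        map_add' := fun φ ψ => tendsto_nhds_unique (hF (φ + ψ)) (by
          simpa only [map_add] using (hF φ).add (hF ψ))
        map_smul' := fun a φ => tendsto_nhds_unique (hF (a • φ)) (by
          simpa only [map_smul, RingHom.id_apply] using (hF φ).const_smul a) }
    -- From some `k₀` on, all `u k` are within distance `1` of `u k₀`, so on `𝒮_{1/2,h}` they share
    -- the bound `C + D`, which survives in the limit.
    have hf : f ∈ GelfandShilovDual d (1 / 2) := by
      intro h hh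
      obtain ⟨C, hCt, hC⟩ := exists_enorm_apply_le hω B hh
      obtain ⟨k₀, hk₀⟩ := hc 1 one_pos
      obtain ⟨D, hD⟩ := (u k₀).2 h hh
      refine ⟨C.toReal + D, fun φ hφ => ?_⟩
      have h1 : ∀ k ≥ k₀, ‖(u k : Module.Dual ℂ (GelfandShilov d (1 / 2))) φ‖ ≤
          (C.toReal + D) * (gsNorm (1 / 2) h φ.1).toReal := by
        intro k hk
        have h2 : ‖(u k : Module.Dual ℂ (GelfandShilov d (1 / 2))) φ -
            (u k₀ : Module.Dual ℂ (GelfandShilov d (1 / 2))) φ‖ ≤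
            C.toReal * (gsNorm (1 / 2) h φ.1).toReal := by
          have h3 : ‖(u k : Module.Dual ℂ (GelfandShilov d (1 / 2))) φ -
              (u k₀ : Module.Dual ℂ (GelfandShilov d (1 / 2))) φ‖ₑ ≤
              C * gsNorm (1 / 2) h φ.1 := by
            refine (hC (u k - u k₀) φ hφ).trans ?_
            exact mul_le_of_le_one_right' (hk₀ k hk k₀ le_rfl).le
          rw [← ENNReal.toReal_mul, ← toReal_enorm]
          exact ENNReal.toReal_mono (ENNReal.mul_ne_top hCt hφ.ne) h3
        have h4 := norm_le_norm_add_norm_sub'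
          ((u k : Module.Dual ℂ (GelfandShilov d (1 / 2))) φ)
          ((u k₀ : Module.Dual ℂ (GelfandShilov d (1 / 2))) φ)
        linarith [hD φ hφ]
      exact le_of_tendsto (hF φ).norm (Filter.eventually_atTop.2 ⟨k₀, h1⟩)
    exact ⟨⟨f, hf⟩, trivial, fun Y => (hF _).const_mul _⟩

end modulation
end

end GSMod

open GSMod

theorem mainTheorem3 (d : ℕ) (ω₁ ω₂ : Phase d → ℝ) (hω₁ : WeightPQ0 ω₁) (hω₂ : WeightPQ ω₂)
    (B : MixedSpace (Fin d ⊕ Fin d)) :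
    (IsQuasiBanachSpace (modSpace ω₁ B) (modNorm ω₁ B) ∧
      IsQuasiBanachSpace (analSpace ω₂ B) (analNorm ω₂ B)) ∧
    (1 ≤ B.nu1 →
      IsBanachSpace (modSpace ω₁ B) (modNorm ω₁ B) ∧
        IsBanachSpace (analSpace ω₂ B) (analNorm ω₂ B)) := by
  have hK : B.quasiConst = (B.quasiConst.toNNReal : ENNReal) :=
    (ENNReal.coe_toNNReal B.quasiConst_ne_top).symm
  have hK1 : 1 ≤ B.quasiConst.toNNReal := by
    rw [← ENNReal.coe_le_coe, ← hK, ENNReal.coe_one]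
    exact B.one_le_quasiConst
  exact ⟨⟨⟨_, hK1, modNorm_complete hω₁ B hK⟩, ⟨_, hK1, analNorm_complete hω₂ B hK⟩⟩, fun h =>
    ⟨modNorm_complete hω₁ B (B.quasiConst_eq_one h), analNorm_complete hω₂ B
      (B.quasiConst_eq_one h)⟩⟩
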